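/- Let $G$ be a finite connected simple graph with $n$ vertices, with symmetric edge weights $w_{xy}>0$ and a $\mathrm{U}(1)$-connection, i.e. phases $\phi_{xy}\in\mathbb{C}$, $|\phi_{xy}|=1$, $\phi_{yx}=\overline{\phi_{xy}}$, on the oriented edges. Let $\deg(x)=\sum_{y\sim x}w_{xy}$, $p_{xy}=w_{xy}/\deg(x)$, and let $\Pi$ be the $n\times n$ matrix with $\Pi_{xy}=p_{xy}\phi_{xy}$ for $x\sim y$ and $\Pi_{xy}=0$ otherwise. For an oriented cycle $c=(x_0,\dots,x_{k-1},x_0)$ (with $k\ge 2$ distinct vertices) let $\mathrm{hol}(c)=\phi_{x_0x_1}\cdots\phi_{x_{k-1}x_0}=e^{-i\theta(c)}$. Assume that $\mathrm{hol}(c)\neq1$ for at least one cycle $c$, and that $\cos\theta(c)\ge0$ for all cycles $c$. Let $T$ be the total number of random walk steps made by the algorithm CyclePopping with acceptance probabilities $\alpha(c)=1-\cos\theta(c)$, run with any fixed ordering of the vertices. That is: starting from the empty graph, as long as some vertex is missing, run a random walk with transition probabilities $p_{xy}$ from the first missing vertex and erase its loops chronologically; each time the walk closes a cycle $c$ with its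 current loop-erased path, the cycle is accepted with probability $\alpha(c)$ and otherwise erased, independently of everything else; stop the walk when it hits the graph built so far or accepts a cycle, and add the resulting branch, or branch with its cycle, to the graph. Then $\mathbb{I}-\Pi$ and $\mathbb{I}+\Pi$ are invertible, $T$ is almost surely finite with finite second moment, and, with $M=\Pi(\mathbb{I}-\Pi)^{-1}$, $$\mathbb{E}[t^T]=t^n\exp\sum_{k=1}^{\infty}\frac{(t-1)^k}{k}\operatorname{Tr}(M^k)$$ for every $t\in[-1,1]$ for which the series converges; it converges in particular (absolutely) whenever $|1-t|\,\rho(M)<1$, where $\rho(M)$ is the spectral radius of $M$. Moreover $$\mathbb{E}[T]=n+\operatorname{Tr}(M),\qquad \operatorname{var}[T]=\operatorname{Tr}(M)+\operatorname{Tr}(M^2),\qquad \mathbb{E}[(-1)^T]=\frac{\det(\Pi-\mathbb{I})}{\det(\Pi+\mathbb{I})}.$$ -/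

import Mathlib

open MeasureTheory ProbabilityTheory Filter Topology
open scoped Matrix ComplexConjugate

/-- A finite weighted graph (no loops, no multiple edges) with a `U(1)`-connection: `W` is the
symmetric matrix of edge weights, positive exactly on the edges, and `Φ` is the matrix of the
phases `φ_{xy}`, complex numbers of modulus one on the oriented edges, with
`φ_{yx} = conj φ_{xy}`. -/
structure U1Graph (V : Type*) where
  graph : SimpleGraph V
  W : Matrix V V ℝ
  W_symm : ∀ x y, W y x = W x y
  W_pos : ∀ x y, graph.Adj x y → 0 < W x y
  W_zero : ∀ x y, ¬ graph.Adj x y → W x y = 0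
  Φ : Matrix V V ℂ
  Φ_norm : ∀ x y, graph.Adj x y → ‖Φ x y‖ = 1
  Φ_conj : ∀ x y, graph.Adj x y → Φ y x = conj (Φ x y)
  Φ_zero : ∀ x y, ¬ graph.Adj x y → Φ x y = 0

/-- The product `f x₀ x₁ * f x₁ x₂ * ⋯ * f x_{k-1} x₀` along the closed sequence of a list
`[x₀, …, x_{k-1}]`. -/
def closedProd {V : Type*} (f : V → V → ℂ) (l : List V) : ℂ :=
  (List.zipWith f l (l.rotate 1)).prod

theorem closedProd_rotate {V : Type*} (f : V → V → ℂ) (l : List V) (k : ℕ) :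
    closedProd f (l.rotate k) = closedProd f l := by
  unfold closedProd
  have h : List.zipWith f (l.rotate k) ((l.rotate k).rotate 1)
      = (List.zipWith f l (l.rotate 1)).rotate k := by
    rw [List.zipWith_rotate_distrib f l (l.rotate 1) k (by simp), List.rotate_rotate,
      List.rotate_rotate, Nat.add_comm]
  rw [h]
  exact (List.rotate_perm _ k).prod_eq

namespace U1Graph

/-- An oriented cycle of the graph: a cyclically ordered sequence of at least two distinct
vertices, each adjacent to the next one. Length two (a backtrack) is allowed, and the base point
is forgotten. -/
def OrientedCycle {V : Type*} (H : U1Graph V) : Type _ :=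
  {c : Cycle V // c.Nodup ∧ 2 ≤ c.length ∧ c.Chain H.graph.Adj}

/-- The holonomy `hol(c) = φ_{x₀x₁} ⋯ φ_{x_{k-1}x₀} = exp(-i θ(c))` of an oriented cycle. -/
def hol {V : Type*} (H : U1Graph V) (c : H.OrientedCycle) : ℂ :=
  Quotient.lift (closedProd fun x y => H.Φ x y)
    (by rintro a b ⟨k, rfl⟩; exact (closedProd_rotate _ a k).symm) c.1

/-- The connection is non-trivial: some cycle has holonomy different from one. -/
def NonTrivial {V : Type*} (H : U1Graph V) : Prop :=
  ∃ c : H.OrientedCycle, H.hol c ≠ 1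

/-- The cycles are weakly inconsistent: `cos θ(c) = Re hol(c) ≥ 0` for all cycles. -/
def WeaklyInconsistent {V : Type*} (H : U1Graph V) : Prop :=
  ∀ c : H.OrientedCycle, 0 ≤ (H.hol c).re

/-- The acceptance probability `α(c) = 1 - cos θ(c)` of a cycle. -/
def α {V : Type*} (H : U1Graph V) (c : H.OrientedCycle) : ℝ :=
  1 - (H.hol c).re

/-- The weighted degree. -/
def deg {V : Type*} [Fintype V] (H : U1Graph V) (x : V) : ℝ :=
  ∑ y, H.W x y

/-- The transition probabilities `p_{xy} = w_{xy} / deg(x)` of the simple random walk. -/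
noncomputable def p {V : Type*} [Fintype V] (H : U1Graph V) (x y : V) : ℝ :=
  H.W x y / H.deg x

/-- The connection-aware transition matrix `Π = D⁻¹ (W ⊙ Φ)`. -/
noncomputable def PiMat {V : Type*} [Fintype V] [DecidableEq V] (H : U1Graph V) :
    Matrix V V ℂ :=
  (Matrix.diagonal fun x => (H.deg x : ℂ))⁻¹ * (H.W.map (fun r : ℝ => (r : ℂ)) ⊙ H.Φ)

end U1Graph

/-- The chronological loop-erasure of `(X 0, …, X n)`, listed from `X 0` to `X n`. When the walk
steps to `y`, the part of the current path after an earlier visit of `y` (if any) is erased. -/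
def loopErasure {V : Type*} [DecidableEq V] (X : ℕ → V) : ℕ → List V
  | 0 => [X 0]
  | n + 1 => (loopErasure X n).takeWhile (fun v => decide (v ≠ X (n + 1))) ++ [X (n + 1)]

namespace U1Graph

/-- The oriented cycle `c` is formed at time `n`: the step to `X n` closes `c` with the final
part, starting at `X n`, of the loop-erased path at time `n - 1`. -/
def FormedAt {V : Type*} [DecidableEq V] (H : U1Graph V) (X : ℕ → V) (c : H.OrientedCycle)
    (n : ℕ) : Prop :=
  ∃ m, n = m + 1 ∧
    c.1 = (((loopErasure X m).dropWhile (fun v => decide (v ≠ X (m + 1))) : List V) : Cycle V)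

/-- The first hitting time of `A`; it is `⊤` if `A` is never hit. -/
noncomputable def hitTime {V : Type*} (X : ℕ → V) (A : Finset V) : ℕ∞ :=
  ⨅ n ∈ {n : ℕ | X n ∈ A}, (n : ℕ∞)

/-- The first time at which the cycle `c` is formed and accepted, where `b c n` says whether `c`
would be accepted at time `n`; it is `⊤` if there is no such time. -/
noncomputable def cycleTime {V : Type*} [DecidableEq V] (H : U1Graph V) (X : ℕ → V)
    (b : H.OrientedCycle → ℕ → Bool) (c : H.OrientedCycle) : ℕ∞ :=
  ⨅ n ∈ {n : ℕ | H.FormedAt X c n ∧ b c n = true}, (n : ℕ∞)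

/-- The first time at which the walk hits `A` or a cycle is accepted. -/
noncomputable def stopTime {V : Type*} [DecidableEq V] (H : U1Graph V) (X : ℕ → V)
    (b : H.OrientedCycle → ℕ → Bool) (A : Finset V) : ℕ∞ :=
  hitTime X A ⊓ ⨅ c : H.OrientedCycle, H.cycleTime X b c

/-- The branch or lasso `(x₀, …, x_{k-1})` added by a walk that stops at time `τ ≥ 1`: the
loop-erased path just before `τ`, followed by `X τ`, which lies in the graph built before
(branch) or on this path (lasso). -/
def newPart {V : Type*} [DecidableEq V] (X : ℕ → V) (τ : ℕ) : List V :=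
  loopErasure X (τ - 1) ++ [X τ]

/-- A state of the algorithm: the nodes and the oriented edges of the subgraph built so far, and
the number of random walk steps made so far. -/
structure PoppingState (V : Type*) where
  nodes : Finset V
  edges : Finset (V × V)
  steps : ℕ∞

/-- One iteration of the algorithm, with the given trajectories `X x` of the walks started from
the nodes `x` and the acceptance variables `b x`: if some node is missing, run the walk from the
first missing node `x₀` in the order `ι` up to its stopping time, and add its branch or lasso. -/
noncomputable def popStage {V : Type*} [Fintype V] [DecidableEq V] (H : U1Graph V)
    (ι : Fin (Fintype.card V) ≃ V) (X : V → ℕ → V) (b : V → H.OrientedCycle → ℕ → Bool)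
    (s : PoppingState V) : PoppingState V :=
  if h : (Finset.univ.filter fun k => ι k ∉ s.nodes).Nonempty then
    let x₀ := ι ((Finset.univ.filter fun k => ι k ∉ s.nodes).min' h)
    let τ := H.stopTime (X x₀) (b x₀) s.nodes
    let J := newPart (X x₀) τ.toNat
    { nodes := s.nodes ∪ J.toFinset
      edges := s.edges ∪ (J.zip J.tail).toFinset
      steps := s.steps + τ }
  else s

/-- The state after `ℓ` iterations, started from the empty graph. -/
noncomputable def popState {V : Type*} [Fintype V] [DecidableEq V] (H : U1Graph V)
    (ι : Fin (Fintype.card V) ≃ V) (X : V → ℕ → V) (b : V → H.OrientedCycle → ℕ → Bool)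
    (ℓ : ℕ) : PoppingState V :=
  (H.popStage ι X b)^[ℓ] { nodes := ∅, edges := ∅, steps := 0 }

/-- The total number of random walk steps made by the algorithm. Each iteration adds at least one
node, so that the algorithm has terminated after (at most) as many iterations as there are nodes;
further iterations change nothing. The value is `⊤` if some walk never stops. -/
noncomputable def numSteps {V : Type*} [Fintype V] [DecidableEq V] (H : U1Graph V)
    (ι : Fin (Fintype.card V) ≃ V) (X : V → ℕ → V) (b : V → H.OrientedCycle → ℕ → Bool) : ℕ∞ :=
  (H.popState ι X b (Fintype.card V)).steps

/-- The random input of the algorithm: for each node `x`, a simple random walk `X x` started from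
`x`, and for each oriented cycle `c` a sequence `B x c` of Bernoulli variables with success
probability `α(c)`; all walks and all Bernoulli variables are independent. -/
structure IsRandomInput {V : Type*} [Fintype V] [DecidableEq V] (H : U1Graph V)
    {Ω : Type*} [MeasurableSpace Ω] (μ : Measure Ω)
    (X : V → ℕ → Ω → V) (B : V → H.OrientedCycle → ℕ → Ω → Bool) : Prop where
  measurable_walk : ∀ x n, Measurable[_, ⊤] (X x n)
  measurable_bernoulli : ∀ x c n, Measurable[_, ⊤] (B x c n)
  /-- `X x` is a Markov chain with initial law `δ_x` and transition probabilities `p`. -/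
  walk_law : ∀ x n (v : ℕ → V), μ {ω | ∀ i ≤ n, X x i ω = v i} =
    ENNReal.ofReal (if v 0 = x then ∏ i ∈ Finset.range n, H.p (v i) (v (i + 1)) else 0)
  bernoulli_law : ∀ x c n, μ {ω | B x c n ω = true} = ENNReal.ofReal (H.α c)
  indep : iIndep (Sum.elim
    (fun x : V => ⨆ n, MeasurableSpace.comap (X x n) ⊤)
    (fun j : V × H.OrientedCycle × ℕ => MeasurableSpace.comap (B j.1 j.2.1 j.2.2) ⊤)) μ

end U1Graph

/-! Let U be the set of missing vertices when a walk starts at x. Seen through its loop-erased path,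
the walk is a Markov chain on self-avoiding paths in U, killed when it leaves U or accepts a cycle.
A step that closes a cycle c survives with probability 1 - α(c) = cos θ(c), and cos θ(c) ≥ 0 makes
this legitimate. Write D_S(t) for the principal minor of 1 - tΠ on S. The generating function, in
time, of the probability that the current path is γ equals t^(|γ|-1) p(γ) D_{U∖γ}(t) / D_U(t), where
|γ| counts vertices and p(γ) is the product of the transition probabilities along γ.

This formula is checked through the forward equation (`pathGreen_eq`), which amounts to the
expansion of a minor along the simple cycles through one vertex (`detOn_insert`). In that expansion
an oriented cycle has the complex weight p(c) hol(c). Reversing c keeps p(c), since the walk is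
reversible, and conjugates hol(c), so that only p(c) cos θ(c) survives in the sum
(`detMinor_insert`): the probability of walking along c and having it rejected.

If the walk stops with path γ, the later stages contribute by induction t^|U∖γ| D_{U∖γ}(1) /
D_{U∖γ}(t). The minors D_{U∖γ}(t) cancel, and what remains is t^|U| / D_U(t) times a sum free of t,
which is D_U(1) by the forward equation at t = 1 (`sum_pathGreen_stopped`). Hence the generating
function of T is t^n det(1 - Π) / det(1 - tΠ) (`IsRandomInput.mk_stepsEvent`). The argument takes
place in formal power series and needs no prior finiteness of T.

A maximum principle shows det(1 - tΠ) ≠ 0 for |t| ≤ 1 (`det_one_sub_smul_ne_zero`). The rational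
function thus converges beyond the unit disc; its value 1 at t = 1 gives T < ∞ almost surely, and
its derivatives there give the moments. Since 1 - tΠ = (1 - (t-1)M)(1 - Π), the generating function
is t^n / det(1 - (t-1)M), and the exponential formula follows from the logarithmic derivative of the
determinant and Abel's limit theorem (`det_mul_exp_trace`). -/

set_option linter.unusedSectionVars false

/-! ### Self-avoiding lists and products along lists -/

/-- The self-avoiding lists in `S`. -/
def saws {V : Type*} [Fintype V] [DecidableEq V] (S : Finset V) : Finset (List V) :=
  ((Finset.univ : Finset {l : List V // l.Nodup}).image Subtype.val).filter fun l => ∀ a ∈ l, a ∈ S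

section Saws
variable {V : Type*} [Fintype V] [DecidableEq V]

theorem mem_saws {S : Finset V} {l : List V} : l ∈ saws S ↔ l.Nodup ∧ ∀ a ∈ l, a ∈ S := by
  simp [saws]

/-- Sum over self-avoiding lists, sorted by their first element. -/
theorem sum_saws {M : Type*} [AddCommMonoid M] (S : Finset V) (F : List V → M) :
    ∑ l ∈ saws S, F l = F [] + ∑ y ∈ S, ∑ l ∈ saws (S.erase y), F (y :: l) := by
  have h : saws S = insert [] (S.biUnion fun y => (saws (S.erase y)).image (List.cons y)) := by
    ext l
    cases l with
    | nil => simp [mem_saws]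
    | cons a l =>
      simp only [mem_saws, Finset.mem_insert, Finset.mem_biUnion, Finset.mem_image]
      constructor
      · rintro ⟨h1, h2⟩
        refine Or.inr ⟨a, h2 a (by simp), l, ⟨(List.nodup_cons.1 h1).2, fun b hb => ?_⟩, rfl⟩
        refine Finset.mem_erase.2 ⟨?_, h2 b (by simp [hb])⟩
        rintro rfl
        exact (List.nodup_cons.1 h1).1 hb
      · rintro (h | ⟨y, hy, l', ⟨h1, h2⟩, h3⟩)
        · simp at h
        · obtain ⟨rfl, rfl⟩ := List.cons_eq_cons.1 h3
          refine ⟨List.nodup_cons.2 ⟨fun h => ?_, h1⟩, fun b hb => ?_⟩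
          · exact (Finset.mem_erase.1 (h2 _ h)).1 rfl
          · rcases List.mem_cons.1 hb with rfl | hb
            · exact hy
            · exact (Finset.mem_erase.1 (h2 _ hb)).2
  rw [h, Finset.sum_insert (by simp), Finset.sum_biUnion]
  · congr 1
    refine Finset.sum_congr rfl fun y _ => ?_
    rw [Finset.sum_image (by simp)]
  · intro a _ b _ hab
    rw [Function.onFun, Finset.disjoint_left]
    rintro l hl hl'
    obtain ⟨l1, -, rfl⟩ := Finset.mem_image.1 hl
    obtain ⟨l2, -, h2⟩ := Finset.mem_image.1 hl'
    exact hab (List.cons_eq_cons.1 h2).1.symm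

/-- Self-avoiding lists may be reversed in a sum. -/
theorem sum_saws_reverse {M : Type*} [AddCommMonoid M] (S : Finset V) (F : List V → M) :
    ∑ l ∈ saws S, F l.reverse = ∑ l ∈ saws S, F l :=
  Finset.sum_nbij' List.reverse List.reverse (by simp [mem_saws]) (by simp [mem_saws])
    (by simp) (by simp) (by simp)

end Saws

/-- The product of `f` over the consecutive pairs of a list. -/
def listProd {V R : Type*} [CommMonoid R] (f : V → V → R) : List V → R
  | [] => 1
  | [_] => 1
  | a :: b :: l => f a b * listProd f (b :: l)

section ListProd
variable {V R : Type*} [CommMonoid R]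

theorem listProd_append (f : V → V → R) (l : List V) (x : V) (l' : List V) :
    listProd f (l ++ x :: l') = listProd f (l ++ [x]) * listProd f (x :: l') := by
  induction l with
  | nil => simp [listProd]
  | cons a l ih =>
    cases l with
    | nil => simp [listProd]
    | cons b l => simp only [List.cons_append, listProd] at ih ⊢; rw [ih, mul_assoc]

theorem listProd_append_pair (f : V → V → R) (l : List V) (x y : V) :
    listProd f (l ++ [x] ++ [y]) = listProd f (l ++ [x]) * f x y := by
  rw [List.append_assoc, List.singleton_append, listProd_append]
  simp [listProd]

theorem listProd_reverse (f : V → V → R) (l : List V) :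
    listProd f l.reverse = listProd (fun x y => f y x) l := by
  induction l with
  | nil => rfl
  | cons a l ih =>
    cases l with
    | nil => rfl
    | cons b l =>
      rw [List.reverse_cons, List.reverse_cons, listProd_append_pair, ← List.reverse_cons, ih]
      simp [listProd, mul_comm]

theorem listProd_mul (f g : V → V → R) (l : List V) :
    listProd (fun x y => f x y * g x y) l = listProd f l * listProd g l := by
  induction l with
  | nil => simp [listProd]
  | cons a l ih =>
    cases l with
    | nil => simp [listProd]
    | cons b l => simp only [listProd] at ih ⊢; rw [ih, mul_mul_mul_comm]

theorem listProd_map {S F : Type*} [CommMonoid S] [FunLike F R S] [MonoidHomClass F R S] (φ : F)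
    (f : V → V → R) (l : List V) :
    φ (listProd f l) = listProd (fun x y => φ (f x y)) l := by
  induction l with
  | nil => simp [listProd]
  | cons a l ih =>
    cases l with
    | nil => simp [listProd]
    | cons b l => simp only [listProd] at ih ⊢; rw [map_mul, ih]

theorem listProd_const (t : R) (l : List V) :
    listProd (fun _ _ => t) l = t ^ (l.length - 1) := by
  induction l with
  | nil => simp [listProd]
  | cons a l ih =>
    cases l with
    | nil => simp [listProd]
    | cons b l => simp only [listProd] at ih ⊢; rw [ih]; simp [pow_succ']

end ListProd

/-- The product along a closed sequence, as a product over consecutive pairs. -/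
theorem closedProd_cons {V : Type*} (f : V → V → ℂ) (x : V) (l : List V) :
    closedProd f (x :: l) = listProd f (x :: l ++ [x]) := by
  have key : ∀ (l : List V) (a z : V),
      (List.zipWith f (a :: l) (l ++ [z])).prod = listProd f (a :: l ++ [z]) := by
    intro l
    induction l with
    | nil => intro a z; simp [listProd]
    | cons b l ih =>
      intro a z
      have := ih b z
      simp only [List.cons_append, List.zipWith_cons_cons, List.prod_cons, listProd] at this ⊢
      rw [this]
  rw [← key l x x]
  simp [closedProd]

/-! ### Expansion of a determinant along self-avoiding paths -/

section Det
variable {V R : Type*} [Fintype V] [DecidableEq V] [CommRing R]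

/-- The matrix `1 - A` with the rows outside `S` replaced by those of the identity. -/
def rowsOn (A : Matrix V V R) (S : Finset V) : Matrix V V R :=
  Matrix.of fun i => if i ∈ S then Pi.single i 1 - A i else Pi.single i 1

/-- The principal minor of `1 - A` on `S`. -/
def detOn (A : Matrix V V R) (S : Finset V) : R := (rowsOn A S).det

theorem rowsOn_apply_of_notMem (A : Matrix V V R) {S : Finset V} {i : V} (h : i ∉ S) :
    rowsOn A S i = Pi.single i 1 := by
  ext j; simp [rowsOn, h]

theorem detOn_empty (A : Matrix V V R) : detOn A ∅ = 1 := by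
  have : rowsOn A ∅ = 1 := by
    ext i j; simp [rowsOn, Matrix.one_apply, Pi.single_apply, eq_comm]
  rw [detOn, this, Matrix.det_one]

theorem detOn_univ (A : Matrix V V R) : detOn A Finset.univ = (1 - A).det := by
  have : rowsOn A Finset.univ = 1 - A := by
    ext i j; simp [rowsOn, Matrix.one_apply, Pi.single_apply, eq_comm]
  rw [detOn, this]

/-- The cofactor of `1 - A` on `insert x S` at the entry `(x, y)`. -/
def cofactorOn (A : Matrix V V R) (S : Finset V) (x y : V) : R :=
  ((rowsOn A S).updateRow x (Pi.single y 1)).det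

theorem rowsOn_eq_updateRow (A : Matrix V V R) {S : Finset V} {y : V} (hy : y ∈ S) :
    rowsOn A S = (rowsOn A (S.erase y)).updateRow y (Pi.single y 1 - A y) := by
  ext i j
  by_cases hi : i = y
  · subst hi; simp [rowsOn, hy]
  · simp [rowsOn, hi, Matrix.updateRow_ne]

/-- Linearity of the determinant in one row, which `Matrix.cramer` packages as a linear map. -/
theorem det_updateRow_eq_sum (N : Matrix V V R) (x : V) (b : V → R) :
    (N.updateRow x b).det = ∑ y, b y * (N.updateRow x (Pi.single y 1)).det := by
  simp_rw [← Matrix.cramer_transpose_apply]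
  conv_lhs => rw [pi_eq_sum_univ' b]
  rw [map_sum, Finset.sum_apply]
  refine Finset.sum_congr rfl fun y _ => ?_
  rw [map_smul]
  simp

theorem det_updateRow_sub (N : Matrix V V R) (x : V) (a b : V → R) :
    (N.updateRow x (a - b)).det = (N.updateRow x a).det - (N.updateRow x b).det := by
  simp_rw [← Matrix.cramer_transpose_apply, map_sub, Pi.sub_apply]

theorem Finset.sdiff_insert_eq_erase_sdiff {V : Type*} [DecidableEq V] (S L : Finset V) (y : V) :
    S \ insert y L = S.erase y \ L := by
  ext a; simp; tauto

theorem cofactorOn_self (A : Matrix V V R) {S : Finset V} {x : V} (hx : x ∉ S) :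
    cofactorOn A S x x = detOn A S := by
  rw [cofactorOn, detOn, ← rowsOn_apply_of_notMem A hx, Matrix.updateRow_eq_self]

/-- Row y outside S is already the unit vector e_y, so rows x and y coincide. -/
theorem cofactorOn_of_notMem (A : Matrix V V R) {S : Finset V} {x y : V} (hy : y ∉ S)
    (hxy : y ≠ x) : cofactorOn A S x y = 0 := by
  refine Matrix.det_zero_of_row_eq hxy ?_
  rw [Matrix.updateRow_ne hxy, Matrix.updateRow_self, rowsOn_apply_of_notMem A hy]

/-- Row x is e_y, so the part e_y of row y = e_y - A_y drops out. Exchanging rows x and y costs a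
sign that cancels the remaining minus. Now row x is A_y and y has left the set; expand along row x.
-/
theorem cofactorOn_step (A : Matrix V V R) {S : Finset V} {x y : V} (hx : x ∉ S) (hy : y ∈ S) :
    cofactorOn A S x y = ∑ z, A y z * cofactorOn A (S.erase y) x z := by
  have hxy : x ≠ y := fun h => hx (h ▸ hy)
  set N := rowsOn A (S.erase y) with hN
  have hNy : N y = Pi.single y 1 := rowsOn_apply_of_notMem A (by simp)
  have h1 : cofactorOn A S x y
      = -((N.updateRow x (Pi.single y 1)).updateRow y (A y)).det := by
    rw [cofactorOn, rowsOn_eq_updateRow A hy, Matrix.updateRow_comm _ hxy.symm, det_updateRow_sub,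
      Matrix.det_zero_of_row_eq hxy, zero_sub]
    rw [Matrix.updateRow_ne hxy, Matrix.updateRow_self, Matrix.updateRow_self]
  have h2 : (N.updateRow x (Pi.single y 1)).updateRow y (A y)
      = (N.updateRow x (A y)).submatrix (Equiv.swap x y) id := by
    ext i j
    rcases eq_or_ne i y with rfl | hi
    · simp
    · rcases eq_or_ne i x with rfl | hi'
      · simp [hxy, hxy.symm, hNy, Matrix.updateRow_ne]
      · simp [Equiv.swap_apply_of_ne_of_ne hi' hi, Matrix.updateRow_ne hi, Matrix.updateRow_ne hi']
  rw [h1, h2, Matrix.det_permute, Equiv.Perm.sign_swap hxy, det_updateRow_eq_sum]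
  simp [cofactorOn, hN]

theorem sum_mul_cofactorOn (A : Matrix V V R) {S : Finset V} {x : V} (hx : x ∉ S) (b : V → R) :
    ∑ z, b z * cofactorOn A S x z
      = b x * detOn A S + ∑ z ∈ S, b z * cofactorOn A S x z := by
  rw [← Finset.add_sum_erase _ _ (Finset.mem_univ x), cofactorOn_self A hx]
  congr 1
  refine (Finset.sum_subset ?_ ?_).symm
  · intro z hz; simp; rintro rfl; exact hx hz
  · intro z hz hz'
    rw [cofactorOn_of_notMem A hz' (by simpa using hz), mul_zero]

/-- A cofactor is a sum over self-avoiding paths. -/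
theorem cofactorOn_eq_sum (A : Matrix V V R) (S : Finset V) {x y : V} (hx : x ∉ S) (hy : y ∈ S) :
    cofactorOn A S x y
      = ∑ l ∈ saws (S.erase y), listProd A (y :: l ++ [x]) * detOn A (S.erase y \ l.toFinset) := by
  -- Each step y → z removes y from the set, which makes the unrolled path self-avoiding; the term z
  -- = x ends it.
  induction S using Finset.strongInduction generalizing y with
  | H S ih =>
    have hx' : x ∉ S.erase y := fun h => hx (Finset.mem_of_mem_erase h)
    rw [cofactorOn_step A hx hy, sum_mul_cofactorOn A hx', sum_saws]
    congr 1
    · simp [listProd]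
    · refine Finset.sum_congr rfl fun z hz => ?_
      rw [ih _ (Finset.erase_ssubset hy) hx' hz, Finset.mul_sum]
      refine Finset.sum_congr rfl fun l _ => ?_
      rw [List.toFinset_cons, Finset.sdiff_insert_eq_erase_sdiff]
      simp only [List.cons_append, listProd, mul_assoc]

/-- Expansion of a principal minor of `1 - A` along the simple cycles through `x`. -/
theorem detOn_insert (A : Matrix V V R) {S : Finset V} {x : V} (hx : x ∉ S) :
    detOn A (insert x S) = detOn A S
      - ∑ l ∈ saws S, listProd A (x :: l ++ [x]) * detOn A (S \ l.toFinset) := by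
  -- Row x is e_x - A_x: the first part gives the minor on S, the second gives cofactors, which are
  -- sums over paths returning to x.
  have h : detOn A (insert x S) = detOn A S - ∑ z, A x z * cofactorOn A S x z := by
    rw [detOn, rowsOn_eq_updateRow A (Finset.mem_insert_self x S), Finset.erase_insert hx,
      det_updateRow_sub, det_updateRow_eq_sum _ _ (A x), ← rowsOn_apply_of_notMem A hx,
      Matrix.updateRow_eq_self]
    rfl
  rw [h, sum_mul_cofactorOn A hx, sum_saws]
  congr 2
  · simp [listProd]
  · refine Finset.sum_congr rfl fun z hz => ?_
    rw [cofactorOn_eq_sum A S hx hz, Finset.mul_sum]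
    refine Finset.sum_congr rfl fun l _ => ?_
    rw [List.toFinset_cons, Finset.sdiff_insert_eq_erase_sdiff]
    simp only [List.cons_append, listProd, mul_assoc]

end Det

/-! ### The killed loop-erased walk and its Green function -/

namespace U1Graph

section Green
variable {V : Type*} [Fintype V] [DecidableEq V] (H : U1Graph V)

/-- The entries `p_{xy} φ_{xy}`. -/
noncomputable def transMat : Matrix V V ℂ := Matrix.of fun x y => (H.p x y : ℂ) * H.Φ x y

theorem PiMat_eq_transMat (hdeg : ∀ x, 0 < H.deg x) : H.PiMat = H.transMat := by
  have h : (Matrix.diagonal fun x => (H.deg x : ℂ))⁻¹ = Matrix.diagonal fun x => (H.deg x : ℂ)⁻¹ := by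
    refine Matrix.inv_eq_left_inv ?_
    rw [Matrix.diagonal_mul_diagonal, ← Matrix.diagonal_one]
    congr 1
    ext x
    exact inv_mul_cancel₀ (by exact_mod_cast (hdeg x).ne')
  ext x y
  simp only [PiMat, h, Matrix.diagonal_mul, Matrix.hadamard_apply, Matrix.map_apply, transMat,
    Matrix.of_apply, p]
  push_cast
  ring

theorem Φ_swap (x y : V) : H.Φ y x = conj (H.Φ x y) := by
  by_cases h : H.graph.Adj x y
  · exact H.Φ_conj x y h
  · rw [H.Φ_zero x y h, H.Φ_zero y x fun h' => h h'.symm, map_zero]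

theorem p_nonneg (x y : V) : 0 ≤ H.p x y := by
  have hW : ∀ x y, 0 ≤ H.W x y := fun x y => by
    by_cases h : H.graph.Adj x y
    · exact (H.W_pos x y h).le
    · exact (H.W_zero x y h).ge
  exact div_nonneg (hW x y) (Finset.sum_nonneg fun y _ => hW x y)

theorem sum_p (hdeg : ∀ x, 0 < H.deg x) (x : V) : ∑ y, H.p x y = 1 := by
  simp only [p, ← Finset.sum_div]
  exact div_self (hdeg x).ne'

theorem p_eq_zero {x y : V} (h : ¬ H.graph.Adj x y) : H.p x y = 0 := by
  rw [p, H.W_zero x y h, zero_div]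

/-- Detailed balance, deg(x) p_{xy} = w_{xy} = w_{yx}, telescoped along a path. On a closed path the
two degrees cancel. -/
theorem listProd_p_swap (hdeg : ∀ x, 0 < H.deg x) (l : List V) (x z : V) :
    listProd H.p (x :: l ++ [z]) * H.deg x
      = listProd (fun x y => H.p y x) (x :: l ++ [z]) * H.deg z := by
  have hp : ∀ x y, H.p x y * H.deg x = H.p y x * H.deg y := fun x y => by
    rw [p, p, div_mul_cancel₀ _ (hdeg x).ne', div_mul_cancel₀ _ (hdeg y).ne', H.W_symm]
  induction l generalizing x with
  | nil => simpa [listProd] using hp x z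
  | cons y l ih =>
    have := ih y
    simp only [List.cons_append, listProd] at this ⊢
    calc _ = (H.p x y * H.deg x) * listProd H.p (y :: (l ++ [z])) := by ring
      _ = H.p y x * (listProd H.p (y :: (l ++ [z])) * H.deg y) := by rw [hp]; ring
      _ = _ := by rw [this]; ring

theorem listProd_p_swap_closed (hdeg : ∀ x, 0 < H.deg x) (l : List V) (x : V) :
    listProd (fun x y => H.p y x) (x :: l ++ [x]) = listProd H.p (x :: l ++ [x]) :=
  (mul_right_cancel₀ (hdeg x).ne' (H.listProd_p_swap hdeg l x x)).symm

theorem listProd_transMat (l : List V) :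
    listProd (fun x y => H.transMat x y) l = ((listProd H.p l : ℝ) : ℂ) * listProd (fun x y => H.Φ x y) l := by
  have h : ((listProd H.p l : ℝ) : ℂ) = listProd (fun x y => (H.p x y : ℂ)) l :=
    listProd_map Complex.ofRealHom _ _
  rw [h, ← listProd_mul]
  rfl

theorem listProd_transMat_reverse (hdeg : ∀ x, 0 < H.deg x) (l : List V) (x : V) :
    listProd (fun x y => H.transMat x y) (x :: l.reverse ++ [x])
      = ((listProd H.p (x :: l ++ [x]) : ℝ) : ℂ) * conj (listProd (fun x y => H.Φ x y) (x :: l ++ [x])) := by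
  have h : x :: l.reverse ++ [x] = (x :: l ++ [x]).reverse := by simp
  rw [h, H.listProd_transMat, listProd_reverse, listProd_reverse, H.listProd_p_swap_closed hdeg,
    listProd_map (starRingEnd ℂ)]
  simp_rw [← H.Φ_swap]

variable {R : Type*} [CommRing R] [Algebra ℂ R]

/-- The determinant of `1 - t Π` restricted to `S`. -/
noncomputable def detMinor (t : R) (S : Finset V) : R :=
  detOn (Matrix.of fun x y => t * algebraMap ℂ R (H.transMat x y)) S

/-- The two orientations of a cycle have conjugate weights and the same complementary minor, so each
may be given the real part. The general algebra R serves both t = 1 in ℂ and the indeterminate in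
ℂ⟦X⟧. -/
theorem detMinor_insert (hdeg : ∀ x, 0 < H.deg x) (t : R) {S : Finset V} {z : V} (hz : z ∉ S) :
    H.detMinor t (insert z S) = H.detMinor t S
      - ∑ l ∈ saws S, t ^ (l.length + 1) * algebraMap ℂ R (listProd H.p (z :: l ++ [z]) *
          (listProd (fun x y => H.Φ x y) (z :: l ++ [z])).re : ℝ) * H.detMinor t (S \ l.toFinset) := by
  rw [detMinor, detOn_insert _ hz]
  congr 1
  have h1 : ∀ l : List V, listProd (fun x y => t * algebraMap ℂ R (H.transMat x y))
      (z :: l ++ [z]) = t ^ (l.length + 1) * algebraMap ℂ R (listProd (fun x y => H.transMat x y) (z :: l ++ [z])) := by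
    intro l
    rw [listProd_map (algebraMap ℂ R)]
    have := listProd_const (V := V) t (z :: l ++ [z])
    simp only [List.cons_append, List.length_cons, List.length_append, List.length_nil,
      zero_add, Nat.add_sub_cancel] at this
    rw [List.cons_append, ← this, ← listProd_mul]
  change ∑ l ∈ saws S, listProd (fun x y => t * algebraMap ℂ R (H.transMat x y)) (z :: l ++ [z]) *
    H.detMinor t (S \ l.toFinset) = _
  simp_rw [h1]
  set F : List V → R := fun l => t ^ (l.length + 1) *
    algebraMap ℂ R (listProd (fun x y => H.transMat x y) (z :: l ++ [z])) * H.detMinor t (S \ l.toFinset) with hF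
  -- The sum is the mean of itself and of its image under reversal of the lists.
  have h2 : ∑ l ∈ saws S, F l = algebraMap ℂ R (1 / 2) * (∑ l ∈ saws S, F l + ∑ l ∈ saws S, F l) := by
    rw [← two_mul, ← mul_assoc, ← map_ofNat (algebraMap ℂ R) 2, ← map_mul]
    norm_num
  change ∑ l ∈ saws S, F l = _
  rw [h2]
  nth_rewrite 2 [← sum_saws_reverse]
  rw [← Finset.sum_add_distrib, Finset.mul_sum]
  refine Finset.sum_congr rfl fun l _ => ?_
  have h3 : ((listProd H.p (z :: l ++ [z]) * (listProd (fun x y => H.Φ x y) (z :: l ++ [z])).re : ℝ) : ℂ)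
      = 1 / 2 * (listProd (fun x y => H.transMat x y) (z :: l ++ [z])
        + listProd (fun x y => H.transMat x y) (z :: l.reverse ++ [z])) := by
    rw [H.listProd_transMat_reverse hdeg, H.listProd_transMat, ← mul_add, Complex.add_conj]
    push_cast
    ring
  rw [h3, hF]
  simp only [List.length_reverse, List.toFinset_reverse, map_mul, map_add]
  ring

/-- The loop-erased paths in `U` starting at `x`. -/
def pathsFrom (U : Finset V) (x : V) : Finset (List V) :=
  (saws U).filter fun γ => γ.head? = some x

theorem mem_pathsFrom {U : Finset V} {x : V} {γ : List V} :
    γ ∈ pathsFrom U x ↔ (γ.Nodup ∧ ∀ a ∈ γ, a ∈ U) ∧ γ.head? = some x := by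
  simp [pathsFrom, mem_saws]

theorem ne_nil_of_mem_pathsFrom {U : Finset V} {x : V} {γ : List V} (h : γ ∈ pathsFrom U x) :
    γ ≠ [] := by
  rintro rfl
  simp [mem_pathsFrom] at h

end Green

end U1Graph

/-! ### One step of the loop-erased path -/

/-- The path after a step to `y`, with the loop through `y`, if any, erased. -/
def nextPath {V : Type*} [DecidableEq V] (γ : List V) (y : V) : List V :=
  γ.takeWhile (fun v => decide (v ≠ y)) ++ [y]

section NextPath
variable {V : Type*} [DecidableEq V]

theorem takeWhile_ne_of_notMem {γ : List V} {y : V} (h : y ∉ γ) :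
    γ.takeWhile (fun v => decide (v ≠ y)) = γ := by
  rw [List.takeWhile_eq_self_iff]
  intro a ha
  simpa using fun hay : a = y => h (hay ▸ ha)

theorem takeWhile_ne_append_cons {β δ : List V} {y : V} (h : y ∉ β) :
    (β ++ y :: δ).takeWhile (fun v => decide (v ≠ y)) = β := by
  rw [List.takeWhile_append_of_pos]
  · simp
  · intro a ha
    simpa using fun hay : a = y => h (hay ▸ ha)

theorem dropWhile_ne_append_cons {β δ : List V} {y : V} (h : y ∉ β) :
    (β ++ y :: δ).dropWhile (fun v => decide (v ≠ y)) = y :: δ := by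
  rw [List.dropWhile_append_of_pos]
  · simp
  · intro a ha
    simpa using fun hay : a = y => h (hay ▸ ha)

theorem dropWhile_ne_of_notMem {γ : List V} {y : V} (h : y ∉ γ) :
    γ.dropWhile (fun v => decide (v ≠ y)) = [] := by
  rw [List.dropWhile_eq_nil_iff]
  intro a ha
  simpa using fun hay : a = y => h (hay ▸ ha)

theorem exists_split_of_mem {γ : List V} {y : V} (h : y ∈ γ) :
    ∃ β δ, γ = β ++ y :: δ ∧ y ∉ β := by
  induction γ with
  | nil => simp at h
  | cons a γ ih =>
    by_cases hay : y = a
    · exact ⟨[], γ, by simp [hay], by simp⟩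
    · obtain ⟨β, δ, h1, h2⟩ := ih ((List.mem_cons.1 h).resolve_left hay)
      exact ⟨a :: β, δ, by simp [h1], by simp [hay, h2]⟩

theorem nextPath_nodup {γ : List V} {y : V} (h : γ.Nodup) : (nextPath γ y).Nodup := by
  rw [nextPath]
  refine List.Nodup.append (h.sublist (List.takeWhile_sublist _)) (by simp) ?_
  intro a ha hay
  have := List.mem_takeWhile_imp ha
  simp at this hay
  exact this hay

theorem mem_nextPath {γ : List V} {y a : V} (h : a ∈ nextPath γ y) : a ∈ γ ∨ a = y := by
  rw [nextPath, List.mem_append, List.mem_singleton] at h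
  exact h.imp_left fun h => (List.takeWhile_sublist _).subset h

theorem nextPath_head {γ : List V} {y x : V} (h : γ.head? = some x) :
    (nextPath γ y).head? = some x := by
  cases γ with
  | nil => simp at h
  | cons a γ =>
    simp at h
    subst h
    by_cases hay : a = y
    · simp [nextPath, hay]
    · simp [nextPath, hay]

end NextPath

/-! ### The forward equation for the Green function -/

namespace U1Graph
section Green
variable {V : Type*} [Fintype V] [DecidableEq V] (H : U1Graph V)

theorem nextPath_mem_pathsFrom {U : Finset V} {x y : V} {γ : List V} (h : γ ∈ pathsFrom U x)
    (hy : y ∈ U) : nextPath γ y ∈ pathsFrom U x := by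
  rw [mem_pathsFrom] at h ⊢
  refine ⟨⟨nextPath_nodup h.1.1, fun a ha => ?_⟩, nextPath_head h.2⟩
  rcases mem_nextPath ha with h' | rfl
  · exact h.1.2 a h'
  · exact hy

/-- The sum over the predecessors of a path. -/
theorem sum_pathsFrom_takeWhile {M : Type*} [AddCommMonoid M] {U : Finset V} {x z : V}
    {β : List V} (hβ : β ++ [z] ∈ pathsFrom U x) (F : List V → M) :
    (∑ γ ∈ pathsFrom U x, if γ.takeWhile (fun v => decide (v ≠ z)) = β then F γ else 0)
      = (if β = [] then 0 else F β)
        + ∑ δ ∈ saws (U \ (β ++ [z]).toFinset), F (β ++ z :: δ) := by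
  have hz : z ∉ β := by
    have := (mem_pathsFrom.1 hβ).1.1
    rw [List.nodup_append] at this
    intro h
    exact this.2.2 z h z (by simp) rfl
  have hmem : ∀ δ, β ++ z :: δ ∈ pathsFrom U x ↔ δ ∈ saws (U \ (β ++ [z]).toFinset) := by
    intro δ
    have e : β ++ z :: δ = (β ++ [z]) ++ δ := by simp
    have hh : (β ++ z :: δ).head? = (β ++ [z]).head? := by cases β <;> simp
    rw [mem_pathsFrom] at hβ
    rw [mem_pathsFrom, mem_saws, hh, e, List.nodup_append]
    constructor
    · rintro ⟨⟨⟨-, h2, h3⟩, h4⟩, -⟩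
      refine ⟨h2, fun a ha => ?_⟩
      rw [Finset.mem_sdiff, List.mem_toFinset]
      exact ⟨h4 a (List.mem_append_right _ ha), fun h => h3 a h a ha rfl⟩
    · rintro ⟨h2, h3⟩
      refine ⟨⟨⟨hβ.1.1, h2, ?_⟩, fun a ha => ?_⟩, hβ.2⟩
      · rintro a ha b hb rfl
        have := h3 a hb
        rw [Finset.mem_sdiff, List.mem_toFinset] at this
        exact this.2 ha
      · rcases List.mem_append.1 ha with ha | ha
        · exact hβ.1.2 a ha
        · exact (Finset.mem_sdiff.1 (h3 a ha)).1
  -- A step to z leads to β z in two ways: from β, by appending z, or from some β z δ, by erasing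
  -- the loop z δ. The empty β is no path and contributes nothing.
  rw [← Finset.sum_filter, ← Finset.sum_filter_add_sum_filter_not _ (fun γ => z ∈ γ), add_comm]
  congr 1
  · rw [Finset.filter_filter]
    have : (pathsFrom U x).filter (fun γ => γ.takeWhile (fun v => decide (v ≠ z)) = β ∧ z ∉ γ)
        = if β = [] then ∅ else {β} := by
      ext γ
      rw [Finset.mem_filter]
      constructor
      · rintro ⟨h1, h2, h3⟩
        rw [takeWhile_ne_of_notMem h3] at h2
        rw [if_neg (h2 ▸ ne_nil_of_mem_pathsFrom h1)]
        simpa using h2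
      · split_ifs with h
        · simp
        · intro h'
          rw [Finset.mem_singleton.1 h']
          refine ⟨?_, takeWhile_ne_of_notMem hz, hz⟩
          rw [mem_pathsFrom] at hβ ⊢
          refine ⟨⟨(List.nodup_append.1 hβ.1.1).1, fun a ha => hβ.1.2 a (by simp [ha])⟩, ?_⟩
          obtain ⟨b, β', rfl⟩ := List.exists_cons_of_ne_nil h
          simpa using hβ.2
    rw [this]
    split_ifs <;> simp
  · rw [Finset.filter_filter]
    have : (pathsFrom U x).filter (fun γ => γ.takeWhile (fun v => decide (v ≠ z)) = β ∧ z ∈ γ)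
        = (saws (U \ (β ++ [z]).toFinset)).image fun δ => β ++ z :: δ := by
      ext γ
      rw [Finset.mem_filter, Finset.mem_image]
      constructor
      · rintro ⟨h1, h2, h3⟩
        obtain ⟨β', δ, rfl, h4⟩ := exists_split_of_mem h3
        rw [takeWhile_ne_append_cons h4] at h2
        subst h2
        exact ⟨δ, (hmem δ).1 h1, rfl⟩
      · rintro ⟨δ, h1, rfl⟩
        exact ⟨(hmem δ).2 h1, takeWhile_ne_append_cons hz, by simp⟩
    rw [this, Finset.sum_image (by simp)]

/-- The probability that the loop closed by a step to `y` is rejected, where the empty loop is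
always rejected. -/
noncomputable def rejectProb (γ : List V) (y : V) : ℝ :=
  if y ∈ γ then (closedProd (fun x y => H.Φ x y) (γ.dropWhile fun v => decide (v ≠ y))).re else 1

variable {R : Type*} [CommRing R] [Algebra ℂ R]

/-- The Green function of the killed loop-erased walk, multiplied by the determinant. -/
noncomputable def pathGreen (t : R) (U : Finset V) (γ : List V) : R :=
  t ^ (γ.length - 1) * algebraMap ℂ R (listProd H.p γ : ℝ) * H.detMinor t (U \ γ.toFinset)

/-- The transition probabilities of the killed loop-erased walk. -/
noncomputable def pathStep (x : V) (γ : List V) (y : V) : ℝ :=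
  H.p (γ.getLastD x) y * H.rejectProb γ y

theorem listProd_append_singleton {R : Type*} [CommMonoid R] (f : V → V → R) {γ : List V}
    (hγ : γ ≠ []) (x y : V) : listProd f (γ ++ [y]) = listProd f γ * f (γ.getLastD x) y := by
  obtain ⟨l, a, rfl⟩ := (List.eq_nil_or_concat' γ).resolve_left hγ
  rw [listProd_append_pair]
  simp

/-- The forward equation for the Green function. -/
theorem pathGreen_eq (hdeg : ∀ x, 0 < H.deg x) (t : R) {U : Finset V} {x : V} {γ' : List V}
    (hγ' : γ' ∈ pathsFrom U x) :
    H.pathGreen t U γ' = (if γ' = [x] then H.detMinor t U else 0)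
      + ∑ γ ∈ pathsFrom U x, ∑ y ∈ U, if nextPath γ y = γ' then
          t * (H.pathGreen t U γ * algebraMap ℂ R (H.pathStep x γ y : ℝ)) else 0 := by
  obtain ⟨β, z, rfl⟩ := (List.eq_nil_or_concat' γ').resolve_left (ne_nil_of_mem_pathsFrom hγ')
  have hmem := mem_pathsFrom.1 hγ'
  have hzU : z ∈ U := hmem.1.2 z (by simp)
  have hz : z ∉ β := by
    have := hmem.1.1
    rw [List.nodup_append] at this
    intro h
    exact this.2.2 z h z (by simp) rfl
  -- S is U without the whole path; putting z back gives U ∖ β. The forward equation will be the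
  -- expansion of the minor on S ∪ {z} at z.
  set S := U \ (β ++ [z]).toFinset with hS
  have hzS : z ∉ S := by simp [hS]
  have hins : insert z S = U \ β.toFinset := by
    ext a
    simp only [hS, Finset.mem_insert, Finset.mem_sdiff, List.mem_toFinset, List.mem_append,
      List.mem_singleton]
    by_cases ha : a = z
    · subst ha; simp [hzU, hz]
    · simp [ha]
  have hsum : ∀ γ, (∑ y ∈ U, if nextPath γ y = β ++ [z] then
      t * (H.pathGreen t U γ * algebraMap ℂ R (H.pathStep x γ y : ℝ)) else 0)
      = if γ.takeWhile (fun v => decide (v ≠ z)) = β then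
      t * (H.pathGreen t U γ * algebraMap ℂ R (H.pathStep x γ z : ℝ)) else 0 := by
    intro γ
    rw [Finset.sum_eq_single_of_mem z hzU]
    · simp [nextPath]
    · intro y _ hy
      rw [if_neg]
      intro h
      have := List.append_inj_right' h rfl
      simp at this
      exact hy this
  simp_rw [hsum]
  rw [sum_pathsFrom_takeWhile hγ' fun γ =>
    t * (H.pathGreen t U γ * algebraMap ℂ R (H.pathStep x γ z : ℝ))]
  -- The predecessor β z δ contributes, up to the common factor t^|β| p(βz), the term of δ in the
  -- cycle expansion: its rejection probability is the real part of the holonomy of z δ.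
  have h1 : ∀ δ ∈ saws S, t * (H.pathGreen t U (β ++ z :: δ) *
      algebraMap ℂ R (H.pathStep x (β ++ z :: δ) z : ℝ))
      = t ^ β.length * algebraMap ℂ R (listProd H.p (β ++ [z]) : ℝ) *
        (t ^ (δ.length + 1) * algebraMap ℂ R (listProd H.p (z :: δ ++ [z]) *
          (listProd (fun x y => H.Φ x y) (z :: δ ++ [z])).re : ℝ) *
          H.detMinor t (S \ δ.toFinset)) := by
    intro δ _
    have e1 : listProd H.p (β ++ [z]) * listProd H.p (z :: δ ++ [z])
        = listProd H.p (β ++ z :: δ) * H.p ((β ++ z :: δ).getLastD x) z := by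
      rw [← listProd_append_singleton _ (by simp), List.cons_append, ← listProd_append]
      simp
    have e2 : U \ (β ++ z :: δ).toFinset = S \ δ.toFinset := by
      ext a; simp [hS]; tauto
    have e3 : H.rejectProb (β ++ z :: δ) z = (listProd (fun x y => H.Φ x y) (z :: δ ++ [z])).re := by
      rw [rejectProb, if_pos (by simp), dropWhile_ne_append_cons hz, closedProd_cons]
    have e4 : (β ++ z :: δ).length - 1 = β.length + δ.length := by simp
    rw [pathGreen, pathStep, e2, e3, e4]
    have e5 : algebraMap ℂ R (listProd H.p (β ++ [z]) : ℝ) *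
        algebraMap ℂ R (listProd H.p (z :: δ ++ [z]) : ℝ) = algebraMap ℂ R
          (listProd H.p (β ++ z :: δ) : ℝ) * algebraMap ℂ R (H.p ((β ++ z :: δ).getLastD x) z : ℝ) := by
      rw [← map_mul, ← map_mul, ← Complex.ofReal_mul, ← Complex.ofReal_mul, e1]
    push_cast
    simp only [pow_add, pow_one]
    linear_combination (-t * t ^ β.length * t ^ δ.length * H.detMinor t (S \ δ.toFinset) *
      algebraMap ℂ R (listProd (fun x y => H.Φ x y) (z :: δ ++ [z])).re) * e5
  rw [Finset.sum_congr rfl h1, ← Finset.mul_sum]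
  -- The source term and the predecessor β exclude each other: β is empty exactly when the path is
  -- [x]. Both give the same expression.
  have h2 : (if β ++ [z] = [x] then H.detMinor t U else 0) + (if β = [] then 0 else
      t * (H.pathGreen t U β * algebraMap ℂ R (H.pathStep x β z : ℝ)))
      = t ^ β.length * algebraMap ℂ R (listProd H.p (β ++ [z]) : ℝ) *
        H.detMinor t (U \ β.toFinset) := by
    rcases eq_or_ne β [] with rfl | hβ
    · have : z = x := by simpa using hmem.2
      simp [this, listProd]
    · rw [if_neg hβ, if_neg, zero_add, listProd_append_singleton _ hβ x, pathGreen, pathStep,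
        rejectProb, if_neg hz]
      · obtain ⟨n, hn⟩ := Nat.exists_eq_succ_of_ne_zero (List.length_pos_iff.2 hβ).ne'
        rw [hn]
        push_cast
        simp only [Nat.succ_eq_add_one, pow_succ]
        ring
      · intro h
        exact hβ (List.append_inj_left' (h.trans (List.nil_append _).symm) rfl)
  rw [← add_assoc, h2, ← mul_add, ← hins, H.detMinor_insert hdeg t hzS, sub_add_cancel, pathGreen]
  simp [hS]

/-- The probability that the walk stops at the step to `y`. -/
noncomputable def pathStop (U : Finset V) (x : V) (γ : List V) (y : V) : ℝ :=
  H.p (γ.getLastD x) y * (if y ∈ U then 1 - H.rejectProb γ y else 1)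

theorem sum_ite_mem_univ (U : Finset V) (f : V → ℝ) :
    (∑ y, if y ∈ U then f y else 0) = ∑ y ∈ U, f y := by
  simp

/-- At `t = 1`, no mass is lost. -/
theorem sum_pathGreen_stopped (hdeg : ∀ x, 0 < H.deg x) {U : Finset V} {x : V} (hx : x ∈ U) :
    ∑ γ ∈ pathsFrom U x, ∑ y, H.pathGreen (1 : ℂ) U γ * (H.pathStop U x γ y : ℂ)
      = H.detMinor (1 : ℂ) U := by
  -- From each path the walk either stops or continues inside U, with total probability one.
  have h1 : ∀ γ, ∑ y, H.pathGreen (1 : ℂ) U γ * (H.pathStop U x γ y : ℂ)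
      = H.pathGreen (1 : ℂ) U γ - ∑ y ∈ U, H.pathGreen (1 : ℂ) U γ * (H.pathStep x γ y : ℂ) := by
    intro γ
    rw [← Finset.mul_sum, ← Finset.mul_sum, ← mul_one_sub]
    congr 1
    rw [eq_sub_iff_add_eq]
    have : ∑ y, H.pathStop U x γ y + ∑ y ∈ U, H.pathStep x γ y = 1 := by
      rw [← H.sum_p hdeg (γ.getLastD x), ← sum_ite_mem_univ U, ← Finset.sum_add_distrib]
      refine Finset.sum_congr rfl fun y _ => ?_
      rw [pathStop, pathStep]
      split_ifs <;> ring
    exact_mod_cast this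
  simp_rw [h1]
  rw [Finset.sum_sub_distrib]
  -- The continuing mass, sorted by its target path, is the right side of the forward equation
  -- without the source. The difference is therefore the source at [x].
  have h2 : ∑ γ ∈ pathsFrom U x, ∑ y ∈ U, H.pathGreen (1 : ℂ) U γ * (H.pathStep x γ y : ℂ)
      = ∑ γ' ∈ pathsFrom U x, ∑ γ ∈ pathsFrom U x, ∑ y ∈ U, if nextPath γ y = γ' then
          1 * (H.pathGreen (1 : ℂ) U γ * algebraMap ℂ ℂ (H.pathStep x γ y : ℝ)) else 0 := by
    symm
    rw [Finset.sum_comm]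
    refine Finset.sum_congr rfl fun γ hγ => ?_
    rw [Finset.sum_comm]
    refine Finset.sum_congr rfl fun y hy => ?_
    rw [Finset.sum_ite_eq, if_pos (nextPath_mem_pathsFrom hγ hy)]
    simp
  have h3 := Finset.sum_congr (s₁ := pathsFrom U x) rfl
    fun γ hγ => H.pathGreen_eq hdeg (1 : ℂ) hγ
  rw [h2, h3, Finset.sum_add_distrib, add_sub_cancel_right, Finset.sum_ite_eq', if_pos]
  rw [mem_pathsFrom]
  simp [hx]

end Green
end U1Graph

/-! ### Uniqueness of the solution of the forward equation in formal power series -/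

namespace U1Graph
section Series
variable {V : Type*} [Fintype V] [DecidableEq V] (H : U1Graph V)

open PowerSeries in
/-- The forward equation determines the generating function of the killed loop-erased walk. -/
theorem mk_mul_detMinor (hdeg : ∀ x, 0 < H.deg x) {U : Finset V} {x : V} (u : ℕ → List V → ℂ)
    (h0 : ∀ γ ∈ pathsFrom U x, u 0 γ = if γ = [x] then 1 else 0)
    (hu : ∀ n, ∀ γ' ∈ pathsFrom U x, u (n + 1) γ' = ∑ γ ∈ pathsFrom U x, ∑ y ∈ U,
      if nextPath γ y = γ' then u n γ * (H.pathStep x γ y : ℂ) else 0)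
    {γ : List V} (hγ : γ ∈ pathsFrom U x) :
    PowerSeries.mk (fun n => u n γ) * H.detMinor (X : ℂ⟦X⟧) U = H.pathGreen (X : ℂ⟦X⟧) U γ := by
  set D := H.detMinor (X : ℂ⟦X⟧) U with hD
  set d : List V → ℂ⟦X⟧ := fun γ => PowerSeries.mk (fun n => u n γ) * D - H.pathGreen X U γ with hd
  have h1 : ∀ γ' ∈ pathsFrom U x, PowerSeries.mk (fun n => u n γ')
      = (if γ' = [x] then 1 else 0) + X * ∑ γ ∈ pathsFrom U x, ∑ y ∈ U, if nextPath γ y = γ' then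
          PowerSeries.mk (fun n => u n γ) * C (H.pathStep x γ y : ℂ) else 0 := by
    intro γ' hγ'
    ext n
    cases n with
    | zero => rw [coeff_mk, h0 _ hγ']; split_ifs <;> simp
    | succ n =>
      rw [coeff_mk, hu n _ hγ', map_add, coeff_succ_X_mul, map_sum]
      have : coeff (n + 1) (if γ' = [x] then (1 : ℂ⟦X⟧) else 0) = 0 := by
        split_ifs <;> simp [coeff_one]
      rw [this, zero_add]
      refine Finset.sum_congr rfl fun γ _ => ?_
      rw [map_sum]
      refine Finset.sum_congr rfl fun y _ => ?_
      split_ifs <;> simp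
  -- The difference d solves the homogeneous equation. Its right side has a factor X, so all
  -- coefficients of d vanish by induction on the degree.
  have h2 : ∀ γ' ∈ pathsFrom U x, d γ' = X * ∑ γ ∈ pathsFrom U x, ∑ y ∈ U,
      if nextPath γ y = γ' then d γ * C (H.pathStep x γ y : ℂ) else 0 := by
    intro γ' hγ'
    simp only [hd]
    rw [h1 γ' hγ', H.pathGreen_eq hdeg X hγ', add_mul, ite_mul, one_mul, zero_mul, mul_assoc,
      add_sub_add_left_eq_sub, Finset.sum_mul, Finset.mul_sum, Finset.mul_sum,
      ← Finset.sum_sub_distrib]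
    refine Finset.sum_congr rfl fun γ _ => ?_
    rw [Finset.sum_mul, Finset.mul_sum, Finset.mul_sum, ← Finset.sum_sub_distrib]
    refine Finset.sum_congr rfl fun y _ => ?_
    split_ifs
    · rw [PowerSeries.algebraMap_eq]; ring
    · simp
  have h3 : ∀ n, ∀ γ ∈ pathsFrom U x, coeff n (d γ) = 0 := by
    intro n
    induction n with
    | zero => intro γ hγ; rw [h2 γ hγ]; simp
    | succ n ih =>
      intro γ' hγ'
      rw [h2 γ' hγ', coeff_succ_X_mul, map_sum]
      refine Finset.sum_eq_zero fun γ hγ => ?_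
      rw [map_sum]
      refine Finset.sum_eq_zero fun y _ => ?_
      split_ifs
      · rw [coeff_mul_C, ih γ hγ, zero_mul]
      · simp
  refine sub_eq_zero.1 ?_
  ext n
  rw [map_zero]
  exact h3 n γ hγ

end Series
end U1Graph

/-! ### Loop-erased trajectories and stopping times -/

section LoopErasure
variable {V : Type*} [DecidableEq V]

theorem loopErasure_succ (X : ℕ → V) (n : ℕ) :
    loopErasure X (n + 1) = nextPath (loopErasure X n) (X (n + 1)) := rfl

theorem loopErasure_congr {X Y : ℕ → V} {n : ℕ} (h : ∀ i ≤ n, X i = Y i) :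
    loopErasure X n = loopErasure Y n := by
  induction n with
  | zero => simp [loopErasure, h]
  | succ n ih =>
    rw [loopErasure_succ, loopErasure_succ, ih fun i hi => h i (by omega), h (n + 1) le_rfl]

theorem loopErasure_nodup (X : ℕ → V) (n : ℕ) : (loopErasure X n).Nodup := by
  cases n with
  | zero => simp [loopErasure]
  | succ n => exact nextPath_nodup (loopErasure_nodup X n)

theorem loopErasure_head (X : ℕ → V) (n : ℕ) : (loopErasure X n).head? = some (X 0) := by
  induction n with
  | zero => simp [loopErasure]
  | succ n ih => exact nextPath_head ih

theorem loopErasure_getLastD (X : ℕ → V) (n : ℕ) (x : V) : (loopErasure X n).getLastD x = X n := by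
  cases n with
  | zero => simp [loopErasure]
  | succ n => simp [loopErasure]

theorem mem_loopErasure {X : ℕ → V} {n : ℕ} {a : V} (h : a ∈ loopErasure X n) :
    ∃ i ≤ n, X i = a := by
  induction n with
  | zero => exact ⟨0, le_rfl, by simpa [loopErasure, eq_comm] using h⟩
  | succ n ih =>
    rcases mem_nextPath h with h | rfl
    · obtain ⟨i, hi, h⟩ := ih h
      exact ⟨i, by omega, h⟩
    · exact ⟨n + 1, le_rfl, rfl⟩

theorem isChain_nextPath {r : V → V → Prop} {γ : List V} {x y : V} (hγ : γ.IsChain r)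
    (hne : γ ≠ []) (h : r (γ.getLastD x) y) : (nextPath γ y).IsChain r := by
  by_cases hy : y ∈ γ
  · obtain ⟨β, δ, rfl, hβ⟩ := exists_split_of_mem hy
    rw [nextPath, takeWhile_ne_append_cons hβ]
    have e : β ++ y :: δ = (β ++ [y]) ++ δ := by simp
    rw [e] at hγ
    exact hγ.left_of_append
  · rw [nextPath, takeWhile_ne_of_notMem hy]
    obtain ⟨l, a, rfl⟩ := (List.eq_nil_or_concat' γ).resolve_left hne
    rw [List.isChain_append]
    refine ⟨hγ, by simp, ?_⟩
    intro b hb c hc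
    simp at hb hc h
    subst hb hc
    exact h

theorem loopErasure_isChain {r : V → V → Prop} {X : ℕ → V} (h : ∀ n, r (X n) (X (n + 1))) (n : ℕ) :
    (loopErasure X n).IsChain r := by
  induction n with
  | zero => simp [loopErasure]
  | succ n ih =>
    refine isChain_nextPath (x := X 0) ih ?_ (by rw [loopErasure_getLastD]; exact h n)
    intro h'
    simpa [h'] using loopErasure_head X n

end LoopErasure

/-! ### Stopping times and the recursion over the stages -/

namespace U1Graph
section Stopping
variable {V : Type*} [DecidableEq V] (H : U1Graph V)

/-- The walk hits `A` or a cycle is accepted at time `n`. -/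
def StopsAt (X : ℕ → V) (b : H.OrientedCycle → ℕ → Bool) (A : Finset V) (n : ℕ) : Prop :=
  X n ∈ A ∨ ∃ c, H.FormedAt X c n ∧ b c n = true

theorem le_stopTime_iff {X : ℕ → V} {b : H.OrientedCycle → ℕ → Bool} {A : Finset V} {m : ℕ∞} :
    m ≤ H.stopTime X b A ↔ ∀ n, H.StopsAt X b A n → m ≤ n := by
  simp only [stopTime, hitTime, cycleTime, le_inf_iff, le_iInf_iff, Set.mem_ofPred_eq, StopsAt]
  constructor
  · rintro ⟨h1, h2⟩ n (h | ⟨c, h⟩)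
    exacts [h1 n h, h2 c n h]
  · intro h
    exact ⟨fun n hn => h n (Or.inl hn), fun c n hn => h n (Or.inr ⟨c, hn⟩)⟩

theorem stopTime_eq_coe_iff {X : ℕ → V} {b : H.OrientedCycle → ℕ → Bool} {A : Finset V} {n : ℕ} :
    H.stopTime X b A = n ↔ H.StopsAt X b A n ∧ ∀ i < n, ¬ H.StopsAt X b A i := by
  constructor
  · intro h
    have h1 : ∀ i, H.StopsAt X b A i → n ≤ i := fun i hi => by
      exact_mod_cast H.le_stopTime_iff.1 h.ge i hi
    refine ⟨?_, fun i hi h' => absurd (h1 i h') (by omega)⟩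
    by_contra h2
    have h3 : ((n + 1 : ℕ) : ℕ∞) ≤ H.stopTime X b A := by
      refine H.le_stopTime_iff.2 fun i hi => ?_
      have : n ≠ i := fun h => h2 (h ▸ hi)
      have := h1 i hi
      exact_mod_cast (by omega : n + 1 ≤ i)
    rw [h] at h3
    have : n + 1 ≤ n := by exact_mod_cast h3
    omega
  · rintro ⟨h1, h2⟩
    refine le_antisymm (H.le_stopTime_iff.1 le_rfl n h1) (H.le_stopTime_iff.2 fun i hi => ?_)
    exact_mod_cast not_lt.1 fun h => h2 i h hi

theorem stopTime_eq_top_iff {X : ℕ → V} {b : H.OrientedCycle → ℕ → Bool} {A : Finset V} :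
    H.stopTime X b A = ⊤ ↔ ∀ n, ¬ H.StopsAt X b A n := by
  rw [← top_le_iff, le_stopTime_iff]
  simp

theorem formedAt_succ {X : ℕ → V} {c : H.OrientedCycle} {n : ℕ} :
    H.FormedAt X c (n + 1) ↔ c.1 =
      (((loopErasure X n).dropWhile (fun v => decide (v ≠ X (n + 1))) : List V) : Cycle V) := by
  simp [FormedAt]

theorem not_formedAt_zero {X : ℕ → V} {c : H.OrientedCycle} : ¬ H.FormedAt X c 0 := by
  simp [FormedAt]

theorem stopsAt_congr {X Y : ℕ → V} {b : H.OrientedCycle → ℕ → Bool} {A : Finset V} {n : ℕ}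
    (h : ∀ i ≤ n, X i = Y i) : H.StopsAt X b A n ↔ H.StopsAt Y b A n := by
  have h1 : ∀ c, H.FormedAt X c n ↔ H.FormedAt Y c n := by
    intro c
    cases n with
    | zero => simp [not_formedAt_zero]
    | succ n =>
      rw [formedAt_succ, formedAt_succ, h (n + 1) le_rfl,
        loopErasure_congr fun i hi => h i (by omega)]
  simp [StopsAt, h1, h n le_rfl]

/-- The steps made by `m` iterations of the algorithm when the nodes in `A` are present. -/
noncomputable def stageSteps [Fintype V] (ι : Fin (Fintype.card V) ≃ V) (X : V → ℕ → V)
    (b : V → H.OrientedCycle → ℕ → Bool) : ℕ → Finset V → ℕ∞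
  | 0, _ => 0
  | m + 1, A => if h : (Finset.univ.filter fun k => ι k ∉ A).Nonempty then
      H.stopTime (X (ι (Finset.min' _ h))) (b (ι (Finset.min' _ h))) A +
        stageSteps ι X b m (A ∪ (newPart (X (ι (Finset.min' _ h)))
          (H.stopTime (X (ι (Finset.min' _ h))) (b (ι (Finset.min' _ h))) A).toNat).toFinset)
      else 0

/-- The choice of the next walk and its stopping time depend on the nodes only, so the edges can be
forgotten. Once all nodes are present, the state is fixed. -/
theorem popStage_iterate_steps [Fintype V] (ι : Fin (Fintype.card V) ≃ V) (X : V → ℕ → V)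
    (b : V → H.OrientedCycle → ℕ → Bool) (m : ℕ) (s : PoppingState V) :
    ((H.popStage ι X b)^[m] s).steps = s.steps + H.stageSteps ι X b m s.nodes := by
  induction m generalizing s with
  | zero => simp [stageSteps]
  | succ m ih =>
    by_cases h : (Finset.univ.filter fun k => ι k ∉ s.nodes).Nonempty
    · rw [Function.iterate_succ_apply, ih, stageSteps, dif_pos h, popStage, dif_pos h, add_assoc]
    · have hs : H.popStage ι X b s = s := by rw [popStage, dif_neg h]
      rw [Function.iterate_fixed hs, stageSteps, dif_neg h, add_zero]

theorem numSteps_eq_stageSteps [Fintype V] (ι : Fin (Fintype.card V) ≃ V) (X : V → ℕ → V)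
    (b : V → H.OrientedCycle → ℕ → Bool) :
    H.numSteps ι X b = H.stageSteps ι X b (Fintype.card V) ∅ := by
  rw [numSteps, popState, popStage_iterate_steps, zero_add]

/-- The first missing node. -/
theorem exists_stageSteps_succ [Fintype V] (ι : Fin (Fintype.card V) ≃ V) {A : Finset V}
    (hA : A ≠ Finset.univ) : ∃ x ∉ A, ∀ (X : V → ℕ → V) (b : V → H.OrientedCycle → ℕ → Bool) (m : ℕ),
      H.stageSteps ι X b (m + 1) A = H.stopTime (X x) (b x) A +
        H.stageSteps ι X b m (A ∪ (newPart (X x) (H.stopTime (X x) (b x) A).toNat).toFinset) := by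
  have h : (Finset.univ.filter fun k => ι k ∉ A).Nonempty := by
    obtain ⟨y, hy⟩ := not_forall.1 (mt Finset.eq_univ_iff_forall.2 hA)
    exact ⟨ι.symm y, by simpa using hy⟩
  refine ⟨ι (Finset.min' _ h), ?_, fun X b m => ?_⟩
  · simpa using Finset.min'_mem _ h
  · rw [stageSteps, dif_pos h]

theorem stageSteps_univ [Fintype V] (ι : Fin (Fintype.card V) ≃ V) (X : V → ℕ → V)
    (b : V → H.OrientedCycle → ℕ → Bool) (m : ℕ) :
    H.stageSteps ι X b m Finset.univ = 0 := by
  cases m with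
  | zero => rfl
  | succ m => rw [stageSteps, dif_neg (by simp)]

end Stopping
end U1Graph

/-! ### Measurability for countable targets -/

section Discrete
variable {Ω α β γ : Type*} {m : MeasurableSpace Ω}

theorem measurable_top_comp {f : Ω → α} (hf : Measurable[m, ⊤] f) (g : α → β) :
    Measurable[m, ⊤] fun ω => g (f ω) :=
  fun s _ => hf (t := g ⁻¹' s) trivial

theorem measurable_top_of_singleton [Countable α] {f : Ω → α}
    (hf : ∀ a, MeasurableSet[m] {ω | f ω = a}) : Measurable[m, ⊤] f :=
  @measurable_to_countable' α Ω ⊤ _ m f hf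

theorem measurable_top_pair [Countable α] [Countable β] {f : Ω → α} {g : Ω → β}
    (hf : Measurable[m, ⊤] f) (hg : Measurable[m, ⊤] g) :
    Measurable[m, ⊤] fun ω => (f ω, g ω) := by
  refine measurable_top_of_singleton fun p => ?_
  have : {ω | (f ω, g ω) = p} = f ⁻¹' {p.1} ∩ g ⁻¹' {p.2} := by
    ext ω; simp [Prod.ext_iff]
  rw [this]
  exact (hf trivial).inter (hg trivial)

theorem measurable_top_map₂ [Countable α] [Countable β] {f : Ω → α} {g : Ω → β}
    (hf : Measurable[m, ⊤] f) (hg : Measurable[m, ⊤] g) (F : α → β → γ) :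
    Measurable[m, ⊤] fun ω => F (f ω) (g ω) :=
  measurable_top_comp (measurable_top_pair hf hg) fun p => F p.1 p.2

theorem measurableSet_of_measurable_top {f : Ω → α} (hf : Measurable[m, ⊤] f) (P : α → Prop) :
    MeasurableSet[m] {ω | P (f ω)} :=
  hf (t := {a | P a}) trivial

/-- A countable choice between measurable functions is measurable. -/
theorem measurable_top_choice [Countable α] [Countable β] {f : Ω → α} {g : α → Ω → β}
    (hf : Measurable[m, ⊤] f) (hg : ∀ a, Measurable[m, ⊤] (g a)) :
    Measurable[m, ⊤] fun ω => g (f ω) ω := by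
  refine measurable_top_of_singleton fun b => ?_
  have : {ω | g (f ω) ω = b} = ⋃ a, {ω | f ω = a} ∩ {ω | g a ω = b} := by
    ext ω; simp
  rw [this]
  exact MeasurableSet.iUnion fun a => (measurableSet_of_measurable_top hf (· = a)).inter
    (measurableSet_of_measurable_top (hg a) (· = b))

end Discrete

/-! ### Measurability with respect to parts of the input -/

namespace U1Graph

instance {V : Type*} [Countable V] (H : U1Graph V) : Countable H.OrientedCycle :=
  haveI : Countable (Cycle V) := Quotient.countable
  inferInstanceAs (Countable {c : Cycle V // c.Nodup ∧ 2 ≤ c.length ∧ c.Chain H.graph.Adj})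

section Input
variable {V : Type*} [Fintype V] [DecidableEq V] {H : U1Graph V} {Ω : Type*}

/-- The `σ`-algebra generated by a part of the input. -/
abbrev inputSigma (X : V → ℕ → Ω → V) (B : V → H.OrientedCycle → ℕ → Ω → Bool)
    (I : Set (V ⊕ V × H.OrientedCycle × ℕ)) : MeasurableSpace Ω :=
  ⨆ j ∈ I, Sum.elim
    (fun x : V => ⨆ n, MeasurableSpace.comap (X x n) ⊤)
    (fun j : V × H.OrientedCycle × ℕ => MeasurableSpace.comap (B j.1 j.2.1 j.2.2) ⊤) j

variable {X : V → ℕ → Ω → V} {B : V → H.OrientedCycle → ℕ → Ω → Bool}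

theorem inputSigma_mono {I J : Set (V ⊕ V × H.OrientedCycle × ℕ)} (h : I ⊆ J) :
    inputSigma X B I ≤ inputSigma X B J :=
  biSup_mono h

theorem measurable_walk_inputSigma {I : Set (V ⊕ V × H.OrientedCycle × ℕ)} {x : V}
    (h : Sum.inl x ∈ I) (n : ℕ) : Measurable[inputSigma X B I, ⊤] (X x n) := by
  refine measurable_iff_comap_le.2 (le_trans ?_ (le_iSup₂ (Sum.inl x) h))
  exact le_iSup (fun n => MeasurableSpace.comap (X x n) ⊤) n

theorem measurable_bernoulli_inputSigma {I : Set (V ⊕ V × H.OrientedCycle × ℕ)} {x : V}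
    {c : H.OrientedCycle} {n : ℕ} (h : Sum.inr (x, c, n) ∈ I) :
    Measurable[inputSigma X B I, ⊤] (B x c n) :=
  measurable_iff_comap_le.2 (le_trans le_rfl
    (le_iSup₂ (f := fun j (_ : j ∈ I) => Sum.elim
    (fun x : V => ⨆ n, MeasurableSpace.comap (X x n) ⊤)
    (fun j : V × H.OrientedCycle × ℕ => MeasurableSpace.comap (B j.1 j.2.1 j.2.2) ⊤) j)
    (Sum.inr (x, c, n)) h))

theorem measurable_loopErasure {I : Set (V ⊕ V × H.OrientedCycle × ℕ)} {x : V}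
    (h : Sum.inl x ∈ I) (n : ℕ) :
    Measurable[inputSigma X B I, ⊤] fun ω => loopErasure (fun n => X x n ω) n := by
  induction n with
  | zero => exact measurable_top_comp (measurable_walk_inputSigma h 0) fun v => [v]
  | succ n ih => exact measurable_top_map₂ ih (measurable_walk_inputSigma h (n + 1)) nextPath

/-- Only the coins of time n are needed. This precision lets the past be separated from the coins of
the next step. -/
theorem measurableSet_stopsAt {I : Set (V ⊕ V × H.OrientedCycle × ℕ)} {x : V} {n : ℕ}
    (h : Sum.inl x ∈ I) (h' : ∀ c, Sum.inr (x, c, n) ∈ I) (A : Finset V) :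
    MeasurableSet[inputSigma X B I]
      {ω | H.StopsAt (fun n => X x n ω) (fun c n => B x c n ω) A n} := by
  have h1 : ∀ c : H.OrientedCycle,
      MeasurableSet[inputSigma X B I] {ω | H.FormedAt (fun n => X x n ω) c n} := by
    intro c
    cases n with
    | zero => simp [not_formedAt_zero]
    | succ n =>
      simp only [formedAt_succ]
      exact measurableSet_of_measurable_top (measurable_top_map₂
        (measurable_loopErasure h n) (measurable_walk_inputSigma h (n + 1))
        fun l v => ((l.dropWhile fun w => decide (w ≠ v) : List V) : Cycle V)) (c.1 = ·)
  have : {ω | H.StopsAt (fun n => X x n ω) (fun c n => B x c n ω) A n}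
      = {ω | X x n ω ∈ A} ∪ ⋃ c, {ω | H.FormedAt (fun n => X x n ω) c n} ∩ {ω | B x c n ω = true} := by
    ext ω
    simp [StopsAt]
  rw [this]
  refine (measurableSet_of_measurable_top (measurable_walk_inputSigma h n) (· ∈ A)).union
    (MeasurableSet.iUnion fun c => (h1 c).inter
      (measurableSet_of_measurable_top (measurable_bernoulli_inputSigma (h' c)) (· = true)))

theorem measurable_stopTime {I : Set (V ⊕ V × H.OrientedCycle × ℕ)} {x : V}
    (h : Sum.inl x ∈ I) (h' : ∀ c n, Sum.inr (x, c, n) ∈ I) (A : Finset V) :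
    Measurable[inputSigma X B I, ⊤]
      fun ω => H.stopTime (fun n => X x n ω) (fun c n => B x c n ω) A := by
  have hs := fun n => measurableSet_stopsAt (X := X) (B := B) h (fun c => h' c n) A
  have hc : Countable ℕ∞ := inferInstanceAs (Countable (Option ℕ))
  refine measurable_top_of_singleton fun a => ?_
  induction a using ENat.recTopCoe with
  | top =>
    simp only [stopTime_eq_top_iff, Set.ofPred_forall]
    exact MeasurableSet.iInter fun n => (hs n).compl
  | coe n =>
    simp only [stopTime_eq_coe_iff, Set.ofPred_and, Set.ofPred_forall]
    exact (hs n).inter (MeasurableSet.iInter fun i => MeasurableSet.iInter fun _ => (hs i).compl)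

theorem measurable_newPart {I : Set (V ⊕ V × H.OrientedCycle × ℕ)} {x : V}
    (h : Sum.inl x ∈ I) (n : ℕ) :
    Measurable[inputSigma X B I, ⊤] fun ω => newPart (fun n => X x n ω) n :=
  measurable_top_map₂ (measurable_loopErasure h (n - 1)) (measurable_walk_inputSigma h n)
    fun l v => l ++ [v]

/-- The part of the input attached to the nodes in `S`. -/
def nodeInput (H : U1Graph V) (S : Set V) : Set (V ⊕ V × H.OrientedCycle × ℕ) :=
  {j | Sum.elim id Prod.fst j ∈ S}

theorem inl_mem_nodeInput {S : Set V} {x : V} (h : x ∈ S) : Sum.inl x ∈ H.nodeInput S := h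

theorem inr_mem_nodeInput {S : Set V} {x : V} (h : x ∈ S) (c : H.OrientedCycle) (n : ℕ) :
    Sum.inr (x, c, n) ∈ H.nodeInput S := h

theorem nodeInput_mono {S T : Set V} (h : S ⊆ T) : H.nodeInput S ⊆ H.nodeInput T :=
  fun _ hj => h hj

theorem disjoint_nodeInput {S T : Set V} (h : Disjoint S T) :
    Disjoint (H.nodeInput S) (H.nodeInput T) :=
  Disjoint.preimage _ h

/-- A node already present never starts a walk, so the input of the missing nodes suffices. This is
the source of the independence between a stage and the later ones. -/
theorem measurable_stageSteps (ι : Fin (Fintype.card V) ≃ V) (m : ℕ) (A : Finset V) :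
    Measurable[inputSigma X B (H.nodeInput {x | x ∉ A}), ⊤]
      fun ω => H.stageSteps ι (fun x n => X x n ω) (fun x c n => B x c n ω) m A := by
  have hc : Countable ℕ∞ := inferInstanceAs (Countable (Option ℕ))
  induction m generalizing A with
  | zero => simp only [stageSteps]; exact measurable_const
  | succ m ih =>
    by_cases hA : A = Finset.univ
    · subst hA; simp only [stageSteps_univ]; exact measurable_const
    · obtain ⟨x, hx, hst⟩ := H.exists_stageSteps_succ ι hA
      simp only [hst]
      have h1 := inl_mem_nodeInput (H := H) (S := {x | x ∉ A}) hx
      have h2 := inr_mem_nodeInput (H := H) (S := {x | x ∉ A}) hx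
      have hτ := measurable_stopTime (X := X) (B := B) h1 h2 A
      refine measurable_top_map₂ hτ ?_ (· + ·)
      -- The next set of nodes is random: its added part takes countably many values J, and each is
      -- treated as a constant.
      refine measurable_top_choice (f := fun ω => newPart (fun n => X x n ω)
        (H.stopTime (fun n => X x n ω) (fun c n => B x c n ω) A).toNat)
        (g := fun J ω => H.stageSteps ι (fun x n => X x n ω) (fun x c n => B x c n ω) m
          (A ∪ J.toFinset)) ?_ fun J => ?_
      · exact measurable_top_choice (g := fun k ω => newPart (fun n => X x n ω) (ENat.toNat k)) hτ
          fun k => measurable_newPart h1 _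
      · refine (ih (A ∪ J.toFinset)).mono (inputSigma_mono (nodeInput_mono fun y hy => ?_)) le_rfl
        simp only [Finset.mem_union, not_or, Set.mem_ofPred_eq] at hy ⊢
        exact hy.1

end Input
end U1Graph

/-! ### The law of one walk -/

theorem measure_eq_sum_fiber {Ω β : Type*} [MeasurableSpace Ω] {μ : Measure Ω} [Fintype β]
    {f : Ω → β} (hf : ∀ b, MeasurableSet (f ⁻¹' {b})) (S : Set Ω) :
    μ S = ∑ b, μ (f ⁻¹' {b} ∩ S) := by
  have h := sum_measure_preimage_singleton (μ := μ.restrict S) Finset.univ (f := f) fun b _ => hf b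
  simp only [Measure.restrict_apply (hf _)] at h
  rw [h]
  simp

namespace U1Graph
section Law
variable {V : Type*} [Fintype V] [DecidableEq V] {H : U1Graph V} {Ω : Type*} [MeasurableSpace Ω]
  {μ : Measure Ω} [IsProbabilityMeasure μ]
  {X : V → ℕ → Ω → V} {B : V → H.OrientedCycle → ℕ → Ω → Bool}

theorem IsRandomInput.inputSigma_le (hXB : H.IsRandomInput μ X B)
    (I : Set (V ⊕ V × H.OrientedCycle × ℕ)) : inputSigma X B I ≤ ‹MeasurableSpace Ω› := by
  refine iSup₂_le fun j _ => ?_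
  cases j with
  | inl x => exact iSup_le fun n => measurable_iff_comap_le.1 (hXB.measurable_walk x n)
  | inr j => exact measurable_iff_comap_le.1 (hXB.measurable_bernoulli j.1 j.2.1 j.2.2)

theorem IsRandomInput.measure_inter (hXB : H.IsRandomInput μ X B)
    {I J : Set (V ⊕ V × H.OrientedCycle × ℕ)} (hIJ : Disjoint I J) {s t : Set Ω}
    (hs : MeasurableSet[inputSigma X B I] s) (ht : MeasurableSet[inputSigma X B J] t) :
    μ (s ∩ t) = μ s * μ t := by
  refine (Indep_iff _ _ μ).1 (indep_iSup_of_disjoint (fun j => ?_) hXB.indep hIJ) s t hs ht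
  have := hXB.inputSigma_le {j}
  rwa [inputSigma, iSup_singleton] at this

theorem IsRandomInput.measure_walk_succ (hXB : H.IsRandomInput μ X B) (x : V) (v : ℕ → V) (n : ℕ) :
    μ {ω | ∀ i ≤ n + 1, X x i ω = v i}
      = ENNReal.ofReal (H.p (v n) (v (n + 1))) * μ {ω | ∀ i ≤ n, X x i ω = v i} := by
  rw [hXB.walk_law, hXB.walk_law, ← ENNReal.ofReal_mul (H.p_nonneg _ _)]
  congr 1
  split_ifs
  · rw [Finset.prod_range_succ, mul_comm]
  · simp

theorem IsRandomInput.ae_start (hXB : H.IsRandomInput μ X B) (x : V) : ∀ᵐ ω ∂μ, X x 0 ω = x := by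
  have h := hXB.walk_law x 0 fun _ => x
  simp only [nonpos_iff_eq_zero, forall_eq, if_true, Finset.range_zero, Finset.prod_empty,
    ENNReal.ofReal_one] at h
  refine (prob_compl_eq_zero_iff ?_).2 h
  exact (hXB.measurable_walk x 0) (t := {x}) trivial

/-- The event that the loop-erased path at time `n` is `γ` and the walk has not been stopped. -/
def pathEvent (X : V → ℕ → Ω → V) (B : V → H.OrientedCycle → ℕ → Ω → Bool) (x : V) (A : Finset V)
    (n : ℕ) (γ : List V) : Set Ω :=
  {ω | loopErasure (fun n => X x n ω) n = γ ∧
    ∀ i ≤ n, ¬ H.StopsAt (fun n => X x n ω) (fun c n => B x c n ω) A i}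

/-- The walk from `x` and its acceptance variables up to time `n`. -/
def pastInput (H : U1Graph V) (x : V) (n : ℕ) : Set (V ⊕ V × H.OrientedCycle × ℕ) :=
  {j | Sum.elim (· = x) (fun k => k.1 = x ∧ k.2.2 ≤ n) j}

/-- The acceptance variables of `x` at time `n`. -/
def coinInput (H : U1Graph V) (x : V) (n : ℕ) : Set (V ⊕ V × H.OrientedCycle × ℕ) :=
  {j | Sum.elim (fun _ => False) (fun k => k.1 = x ∧ k.2.2 = n) j}

/-- `pastInput` contains the whole walk, including the step at time n + 1. The coins of that time
are thus independent of the past path and the new step jointly. -/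
theorem disjoint_pastInput_coinInput (x : V) (n : ℕ) :
    Disjoint (H.pastInput x n) (H.coinInput x (n + 1)) := by
  rw [Set.disjoint_left]
  rintro (y | ⟨y, c, i⟩) h h'
  · exact h'
  · have h1 : i ≤ n := h.2
    have h2 : i = n + 1 := h'.2
    omega

theorem measurableSet_pathEvent (x : V) (A : Finset V) (n : ℕ) (γ : List V) :
    MeasurableSet[inputSigma X B (H.pastInput x n)] (pathEvent X B x A n γ) := by
  have h : Sum.inl x ∈ H.pastInput x n := rfl
  have h' : ∀ i ≤ n, ∀ c, Sum.inr (x, c, i) ∈ H.pastInput x n := fun i hi c => ⟨rfl, hi⟩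
  simp only [pathEvent, Set.ofPred_and, Set.ofPred_forall]
  exact (measurableSet_of_measurable_top (measurable_loopErasure h n) (· = γ)).inter
    (MeasurableSet.iInter fun i => MeasurableSet.iInter fun hi =>
      (measurableSet_stopsAt h (h' i hi) A).compl)

theorem measurableSet_walk_prefix {I : Set (V ⊕ V × H.OrientedCycle × ℕ)} {x : V}
    (h : Sum.inl x ∈ I) (w : ℕ → V) (m : ℕ) :
    MeasurableSet[inputSigma X B I] {ω | ∀ i ≤ m, X x i ω = w i} := by
  simp only [Set.ofPred_forall]
  exact MeasurableSet.iInter fun i => MeasurableSet.iInter fun _ =>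
    measurableSet_of_measurable_top (measurable_walk_inputSigma h i) (· = w i)

theorem measurableSet_stopsAt_const {I : Set (V ⊕ V × H.OrientedCycle × ℕ)} {x : V} {n : ℕ}
    (h : ∀ c, Sum.inr (x, c, n) ∈ I) (w : ℕ → V) (A : Finset V) :
    MeasurableSet[inputSigma X B I] {ω | H.StopsAt w (fun c n => B x c n ω) A n} := by
  have e : {ω | H.StopsAt w (fun c n => B x c n ω) A n}
      = {_ω | w n ∈ A} ∪ ⋃ c, {_ω | H.FormedAt w c n} ∩ {ω | B x c n ω = true} := by
    ext ω
    simp [StopsAt]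
  rw [e]
  exact (MeasurableSet.const _).union (MeasurableSet.iUnion fun c => (MeasurableSet.const _).inter
    (measurableSet_of_measurable_top (measurable_bernoulli_inputSigma (h c)) (· = true)))

theorem disjoint_singleton_inl_isRight (x : V) :
    Disjoint ({Sum.inl x} : Set (V ⊕ V × H.OrientedCycle × ℕ)) {j | j.isRight = true} := by
  rw [Set.disjoint_left]
  intro j hj
  rw [Set.mem_singleton_iff.1 hj]
  exact Bool.false_ne_true

/-- The trajectory up to time `n`. -/
def trajectory (X : V → ℕ → Ω → V) (x : V) (n : ℕ) (ω : Ω) : Fin (n + 1) → V :=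
  fun i => X x i ω

/-- The law of the walk is stated for infinite sequences. Extending v by the constant y lets one
sequence w describe both the prefix and the next step. -/
theorem trajectory_eq_iff {x : V} {n : ℕ} (v : Fin (n + 1) → V) (y : V) :
    ∃ w : ℕ → V, w (n + 1) = y ∧
      ∀ ω, trajectory X x n ω = v ↔ ∀ i ≤ n, X x i ω = w i := by
  refine ⟨fun i => if h : i ≤ n then v ⟨i, by omega⟩ else y, by simp, fun ω => ?_⟩
  simp only [trajectory, funext_iff, Fin.forall_iff]
  refine forall_congr' fun i => ?_
  constructor
  · intro h hi; simp [hi, h (by omega)]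
  · intro h hi; simpa [(by omega : i ≤ n)] using h (by omega)

theorem IsRandomInput.measurableSet_trajectory (hXB : H.IsRandomInput μ X B) (x : V) (n : ℕ)
    (v : Fin (n + 1) → V) : MeasurableSet (trajectory X x n ⁻¹' {v}) := by
  have : trajectory X x n ⁻¹' {v} = ⋂ i : Fin (n + 1), {ω | X x i ω = v i} := by
    ext ω; simp [trajectory, funext_iff]
  rw [this]
  exact MeasurableSet.iInter fun i =>
    measurableSet_of_measurable_top (hXB.measurable_walk x i) (· = v i)

theorem IsRandomInput.ae_adj (hXB : H.IsRandomInput μ X B) (x : V) :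
    ∀ᵐ ω ∂μ, ∀ n, H.graph.Adj (X x n ω) (X x (n + 1) ω) := by
  rw [ae_all_iff]
  intro n
  have hae : ∀ a b : V, ¬ H.graph.Adj a b → ∀ᵐ ω ∂μ, ¬ (X x n ω = a ∧ X x (n + 1) ω = b) := by
    intro a b hab
    rw [ae_iff, measure_eq_sum_fiber (hXB.measurableSet_trajectory x n)]
    refine Finset.sum_eq_zero fun v _ => ?_
    obtain ⟨w, hw, hfib⟩ := trajectory_eq_iff (X := X) (x := x) v b
    by_cases hwn : w n = a
    · refine measure_mono_null (t := {ω | ∀ i ≤ n + 1, X x i ω = w i}) ?_ ?_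
      · rintro ω ⟨h1, h2⟩ i hi
        simp only [not_not, Set.mem_ofPred_eq] at h2
        rcases Nat.lt_or_ge n i with h | h
        · obtain rfl : i = n + 1 := by omega
          rw [h2.2, hw]
        · exact (hfib ω).1 h1 i h
      · rw [hXB.measure_walk_succ, hwn, hw, H.p_eq_zero hab]
        simp
    · refine measure_mono_null (t := ∅) ?_ measure_empty
      rintro ω ⟨h1, h2⟩
      simp only [not_not, Set.mem_ofPred_eq] at h2
      exact hwn (((hfib ω).1 h1 n le_rfl).symm.trans h2.1)
  have := ae_all_iff.2 fun a => ae_all_iff.2 fun b => ae_all_iff.2 (hae a b)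
  filter_upwards [this] with ω hω
  by_contra h
  exact hω _ _ h ⟨rfl, rfl⟩

/-- The Markov property. On a fixed trajectory up to time n, not having stopped is an event about
the coins alone, independent of the walk; the law of the walk then gives the factor for one more
step. -/
theorem IsRandomInput.measure_pathEvent_step (hXB : H.IsRandomInput μ X B) (x : V) (A : Finset V)
    (n : ℕ) (γ : List V) (y : V) :
    μ (pathEvent X B x A n γ ∩ {ω | X x (n + 1) ω = y})
      = ENNReal.ofReal (H.p (γ.getLastD x) y) * μ (pathEvent X B x A n γ) := by
  rw [measure_eq_sum_fiber (hXB.measurableSet_trajectory x n),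
    measure_eq_sum_fiber (hXB.measurableSet_trajectory x n) (pathEvent X B x A n γ), Finset.mul_sum]
  refine Finset.sum_congr rfl fun v _ => ?_
  obtain ⟨w, hwn, hfib⟩ := trajectory_eq_iff (X := X) (x := x) v y
  by_cases hγ : loopErasure w n = γ
  · set R : Set Ω := {ω | ∀ i ≤ n, ¬ H.StopsAt w (fun c n => B x c n ω) A i} with hR
    have hRm : MeasurableSet[inputSigma X B {j | j.isRight = true}] R := by
      simp only [hR, Set.ofPred_forall]
      exact MeasurableSet.iInter fun i => MeasurableSet.iInter fun _ =>
        (measurableSet_stopsAt_const (fun c => rfl) w A).compl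
    have hT := fun m => measurableSet_walk_prefix (X := X) (B := B) (Set.mem_singleton (Sum.inl x)) w m
    have hd := disjoint_singleton_inl_isRight (H := H) x
    have key : ∀ ω, trajectory X x n ω = v → (ω ∈ pathEvent X B x A n γ ↔ ω ∈ R) := by
      intro ω hω
      rw [hfib] at hω
      have h1 : loopErasure (fun n => X x n ω) n = loopErasure w n := loopErasure_congr hω
      simp only [pathEvent, hR, Set.mem_ofPred_eq, h1, hγ, true_and]
      refine forall_congr' fun i => forall_congr' fun hi => not_congr ?_
      exact H.stopsAt_congr fun j hj => hω j (by omega)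
    have e1 : trajectory X x n ⁻¹' {v} ∩ pathEvent X B x A n γ = {ω | ∀ i ≤ n, X x i ω = w i} ∩ R := by
      ext ω
      simp only [Set.mem_inter_iff, Set.mem_preimage, Set.mem_singleton_iff, Set.mem_ofPred_eq]
      rw [← hfib]
      exact and_congr_right fun h => key ω h
    have e2 : trajectory X x n ⁻¹' {v} ∩ (pathEvent X B x A n γ ∩ {ω | X x (n + 1) ω = y})
        = {ω | ∀ i ≤ n + 1, X x i ω = w i} ∩ R := by
      ext ω
      simp only [Set.mem_inter_iff, Set.mem_preimage, Set.mem_singleton_iff, Set.mem_ofPred_eq]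
      have : (∀ i ≤ n + 1, X x i ω = w i) ↔ trajectory X x n ω = v ∧ X x (n + 1) ω = y := by
        rw [hfib]
        constructor
        · intro h
          exact ⟨fun i hi => h i (by omega), (h (n + 1) le_rfl).trans hwn⟩
        · rintro ⟨h1, h2⟩ i hi
          rcases Nat.lt_or_ge n i with h | h
          · obtain rfl : i = n + 1 := by omega
            rw [h2, hwn]
          · exact h1 i h
      rw [this]
      constructor
      · rintro ⟨h1, h2, h3⟩
        exact ⟨⟨h1, h3⟩, (key ω h1).1 h2⟩
      · rintro ⟨⟨h1, h3⟩, h2⟩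
        exact ⟨h1, (key ω h1).2 h2, h3⟩
    rw [e1, e2, hXB.measure_inter hd (hT _) hRm, hXB.measure_inter hd (hT _) hRm,
      hXB.measure_walk_succ, ← hγ, loopErasure_getLastD, hwn, mul_assoc]
  · have e : ∀ ω, trajectory X x n ω = v → ω ∉ pathEvent X B x A n γ := by
      intro ω hω h
      rw [hfib] at hω
      exact hγ ((loopErasure_congr hω).symm.trans h.1)
    have e1 : trajectory X x n ⁻¹' {v} ∩ pathEvent X B x A n γ = ∅ :=
      Set.eq_empty_of_forall_notMem fun ω h => e ω h.1 h.2
    have e2 : trajectory X x n ⁻¹' {v} ∩ (pathEvent X B x A n γ ∩ {ω | X x (n + 1) ω = y}) = ∅ :=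
      Set.eq_empty_of_forall_notMem fun ω h => e ω h.1 h.2.1
    rw [e1, e2]
    simp

end Law
end U1Graph

/-! ### Rejection and stopping probabilities of one step -/

namespace U1Graph
section Law
variable {V : Type*} [Fintype V] [DecidableEq V] {H : U1Graph V} {Ω : Type*} [MeasurableSpace Ω]
  {μ : Measure Ω} [IsProbabilityMeasure μ]
  {X : V → ℕ → Ω → V} {B : V → H.OrientedCycle → ℕ → Ω → Bool}

theorem hol_eq {c : H.OrientedCycle} {l : List V} (h : c.1 = (l : Cycle V)) :
    H.hol c = closedProd (fun x y => H.Φ x y) l := by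
  obtain ⟨c, hc⟩ := c
  subst h
  rfl

/-- A loop that closes a self-avoiding walk in the graph is an oriented cycle. -/
theorem exists_orientedCycle {γ : List V} {x y : V} (hnd : γ.Nodup)
    (hch : γ.IsChain H.graph.Adj) (hy : y ∈ γ) (hadj : H.graph.Adj (γ.getLastD x) y) :
    ∃ c : H.OrientedCycle, c.1 = ((γ.dropWhile fun v => decide (v ≠ y) : List V) : Cycle V) := by
  obtain ⟨β, δ, rfl, hβ⟩ := exists_split_of_mem hy
  rw [dropWhile_ne_append_cons hβ]
  have h1 : (y :: δ).Nodup := (List.nodup_append.1 hnd).2.1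
  have h2 : (y :: δ).IsChain H.graph.Adj := hch.right_of_append
  have h3 : (β ++ y :: δ).getLastD x = (y :: δ).getLast (by simp) := by
    rw [List.getLastD_eq_getLast?, List.getLast?_append]
    simp [List.getLast?_eq_some_getLast]
  rw [h3] at hadj
  -- A loop with one vertex would be a step from y to itself, which the simple graph forbids; hence
  -- the length is at least two.
  have hδ : δ ≠ [] := by
    rintro rfl
    exact hadj.ne (by simp)
  refine ⟨⟨(y :: δ : List V), Cycle.nodup_coe_iff.2 h1, ?_, ?_⟩, rfl⟩
  · have := List.length_pos_iff.2 hδ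
    simp only [Cycle.length_coe, List.length_cons]
    omega
  · rw [Cycle.chain_coe_cons, ← List.cons_append, List.isChain_append]
    refine ⟨h2, by simp, ?_⟩
    intro a ha b hb
    rw [List.getLast?_eq_some_getLast (by simp)] at ha
    simp at ha hb
    subst hb
    rw [← ha]
    simpa using hadj

theorem norm_listProd_Φ_le (l : List V) : ‖listProd (fun x y => H.Φ x y) l‖ ≤ 1 := by
  induction l with
  | nil => simp [listProd]
  | cons a l ih =>
    cases l with
    | nil => simp [listProd]
    | cons b l =>
      rw [listProd, norm_mul]
      refine mul_le_one₀ ?_ (norm_nonneg _) ih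
      by_cases h : H.graph.Adj a b
      · exact (H.Φ_norm a b h).le
      · simp [H.Φ_zero a b h]

theorem α_nonneg (c : H.OrientedCycle) : 0 ≤ H.α c := by
  rw [α, sub_nonneg]
  refine (Complex.re_le_norm _).trans ?_
  obtain ⟨l, hl⟩ : ∃ l : List V, c.1 = (l : Cycle V) :=
    (Quotient.exists_rep c.1).imp fun _ h => h.symm
  rw [hol_eq hl]
  cases l with
  | nil => simp [closedProd]
  | cons a l => rw [closedProd_cons]; exact norm_listProd_Φ_le _

theorem IsRandomInput.measure_coin (hXB : H.IsRandomInput μ X B)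
    (x : V) (c : H.OrientedCycle) (n : ℕ) :
    μ {ω | B x c n ω = false} = ENNReal.ofReal (H.hol c).re := by
  have hBm : MeasurableSet {ω | B x c n ω = true} :=
    measurableSet_of_measurable_top (hXB.measurable_bernoulli x c n) (· = true)
  have h : {ω | B x c n ω = false} = {ω | B x c n ω = true}ᶜ := by
    ext ω
    simp
  rw [h, prob_compl_eq_one_sub hBm, hXB.bernoulli_law, ← ENNReal.ofReal_one,
    ← ENNReal.ofReal_sub _ (α_nonneg c)]
  congr 1
  rw [α]
  ring

/-- Away from a null set, a step to a vertex of the path closes an oriented cycle. -/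
theorem IsRandomInput.measure_pathEvent_eq_zero (hXB : H.IsRandomInput μ X B) (x : V)
    (A : Finset V) (n : ℕ) (γ : List V) {y : V} (hyγ : y ∈ γ)
    (hval : ¬ ∃ c : H.OrientedCycle,
      c.1 = ((γ.dropWhile fun v => decide (v ≠ y) : List V) : Cycle V)) :
    μ (pathEvent X B x A n γ ∩ {ω | X x (n + 1) ω = y}) = 0 := by
  have : ∀ᵐ ω ∂μ, ω ∉ pathEvent X B x A n γ ∩ {ω | X x (n + 1) ω = y} := by
    filter_upwards [hXB.ae_adj x] with ω hω hωE
    have h4 : loopErasure (fun n => X x n ω) n = γ := hωE.1.1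
    have h5 : X x (n + 1) ω = y := hωE.2
    refine hval (exists_orientedCycle (x := x) ?_ ?_ hyγ ?_)
    · rw [← h4]; exact loopErasure_nodup _ _
    · rw [← h4]; exact loopErasure_isChain hω _
    · rw [← h4, loopErasure_getLastD, ← h5]; exact hω n
  exact measure_eq_zero_iff_ae_notMem.2 this

/-- All coins for the loop closed by a step to `y` reject. -/
def rejectEvent (B : V → H.OrientedCycle → ℕ → Ω → Bool) (x : V) (n : ℕ) (γ : List V) (y : V) :
    Set Ω :=
  {ω | ∀ c : H.OrientedCycle,
    c.1 = ((γ.dropWhile fun v => decide (v ≠ y) : List V) : Cycle V) → B x c (n + 1) ω = false}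

theorem pathEvent_inter_not_stopsAt (x : V) (A : Finset V) (n : ℕ) (γ : List V) {y : V}
    (hy : y ∉ A) :
    pathEvent X B x A n γ ∩ {ω | X x (n + 1) ω = y} ∩
        {ω | ¬ H.StopsAt (fun n => X x n ω) (fun c n => B x c n ω) A (n + 1)}
      = pathEvent X B x A n γ ∩ {ω | X x (n + 1) ω = y} ∩ rejectEvent B x n γ y := by
  ext ω
  refine and_congr_right fun h => ?_
  have h2 : loopErasure (fun n => X x n ω) n = γ := h.1.1
  have h3 : X x (n + 1) ω = y := h.2
  simp only [rejectEvent, Set.mem_ofPred_eq]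
  simp only [StopsAt, formedAt_succ, h2, h3, hy, false_or, not_exists, not_and,
    Bool.not_eq_true]

/-- The path and the step determine at most one formed cycle, so a single fresh coin decides. Weak
inconsistency enters here: a negative cosine would be truncated to 0 by `ENNReal.ofReal`. Without a
cycle, either y is new to the path or the event is null. -/
theorem IsRandomInput.measure_pathEvent_reject (hXB : H.IsRandomInput μ X B)
    (hweak : H.WeaklyInconsistent) (x : V) (A : Finset V) (n : ℕ) (γ : List V) {y : V}
    (hy : y ∉ A) :
    μ.real (pathEvent X B x A n γ ∩ {ω | X x (n + 1) ω = y} ∩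
        {ω | ¬ H.StopsAt (fun n => X x n ω) (fun c n => B x c n ω) A (n + 1)})
      = H.rejectProb γ y * μ.real (pathEvent X B x A n γ ∩ {ω | X x (n + 1) ω = y}) := by
  rw [pathEvent_inter_not_stopsAt x A n γ hy]
  have hx : Sum.inl x ∈ H.pastInput x n := rfl
  have hEm : MeasurableSet[inputSigma X B (H.pastInput x n)]
      (pathEvent X B x A n γ ∩ {ω | X x (n + 1) ω = y}) :=
    MeasurableSet.inter (measurableSet_pathEvent x A n γ)
      (measurableSet_of_measurable_top (measurable_walk_inputSigma hx (n + 1)) (· = y))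
  by_cases hval : ∃ c : H.OrientedCycle,
      c.1 = ((γ.dropWhile fun v => decide (v ≠ y) : List V) : Cycle V)
  · obtain ⟨c, hc⟩ := hval
    have h2 : rejectEvent B x n γ y = {ω | B x c (n + 1) ω = false} := by
      ext ω
      simp only [rejectEvent, Set.mem_ofPred_eq]
      refine ⟨fun h => h c hc, fun h c' hc' => ?_⟩
      rwa [show c' = c from Subtype.ext (hc'.trans hc.symm)]
    have hc' : Sum.inr (x, c, n + 1) ∈ H.coinInput x (n + 1) := ⟨rfl, rfl⟩
    have hBm : MeasurableSet[inputSigma X B (H.coinInput x (n + 1))]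
        {ω | B x c (n + 1) ω = false} :=
      measurableSet_of_measurable_top (measurable_bernoulli_inputSigma hc') (· = false)
    have hyγ : y ∈ γ := by
      by_contra hyγ
      have h3 := c.2.2.1
      rw [hc, dropWhile_ne_of_notMem hyγ] at h3
      simp at h3
    rw [measureReal_def, h2, hXB.measure_inter (disjoint_pastInput_coinInput x n) hEm hBm, mul_comm,
      hXB.measure_coin, rejectProb, if_pos hyγ, ← H.hol_eq hc, ENNReal.toReal_mul,
      ENNReal.toReal_ofReal (hweak c), measureReal_def]
  · have h2 : rejectEvent B x n γ y = Set.univ :=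
      Set.eq_univ_of_forall fun ω c hc => absurd ⟨c, hc⟩ hval
    rw [h2, Set.inter_univ]
    by_cases hyγ : y ∈ γ
    · rw [measureReal_def, hXB.measure_pathEvent_eq_zero x A n γ hyγ hval, ENNReal.toReal_zero,
        mul_zero]
    · rw [rejectProb, if_neg hyγ, one_mul]

theorem IsRandomInput.measurableSet_pathEvent (hXB : H.IsRandomInput μ X B) (x : V) (A : Finset V)
    (n : ℕ) (γ : List V) : MeasurableSet (pathEvent X B x A n γ) :=
  hXB.inputSigma_le _ _ (U1Graph.measurableSet_pathEvent x A n γ)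

theorem IsRandomInput.measurableSet_stopsAt (hXB : H.IsRandomInput μ X B) (x : V) (A : Finset V)
    (n : ℕ) : MeasurableSet {ω | H.StopsAt (fun n => X x n ω) (fun c n => B x c n ω) A n} :=
  hXB.inputSigma_le Set.univ _
    (U1Graph.measurableSet_stopsAt (Set.mem_univ _) (fun _ => Set.mem_univ _) A)

theorem IsRandomInput.real_pathEvent_step (hXB : H.IsRandomInput μ X B) (x : V) (A : Finset V)
    (n : ℕ) (γ : List V) (y : V) :
    μ.real (pathEvent X B x A n γ ∩ {ω | X x (n + 1) ω = y})
      = H.p (γ.getLastD x) y * μ.real (pathEvent X B x A n γ) := by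
  rw [measureReal_def, hXB.measure_pathEvent_step, ENNReal.toReal_mul,
    ENNReal.toReal_ofReal (H.p_nonneg _ _), measureReal_def]

theorem IsRandomInput.real_pathEvent_continue (hXB : H.IsRandomInput μ X B)
    (hweak : H.WeaklyInconsistent) (x : V) (A : Finset V) (n : ℕ) (γ : List V) {y : V}
    (hy : y ∉ A) :
    μ.real (pathEvent X B x A n γ ∩ {ω | X x (n + 1) ω = y} ∩
        {ω | ¬ H.StopsAt (fun n => X x n ω) (fun c n => B x c n ω) A (n + 1)})
      = μ.real (pathEvent X B x A n γ) * H.pathStep x γ y := by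
  rw [hXB.measure_pathEvent_reject hweak x A n γ hy, hXB.real_pathEvent_step, pathStep]
  ring

theorem IsRandomInput.real_pathEvent_stopped (hXB : H.IsRandomInput μ X B)
    (hweak : H.WeaklyInconsistent) (x : V) (A : Finset V) (n : ℕ) (γ : List V) (y : V) :
    μ.real (pathEvent X B x A n γ ∩ {ω | X x (n + 1) ω = y} ∩
        {ω | H.StopsAt (fun n => X x n ω) (fun c n => B x c n ω) A (n + 1)})
      = μ.real (pathEvent X B x A n γ) * H.pathStop Aᶜ x γ y := by
  have h := measureReal_inter_add_sdiff (μ := μ)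
    (s := pathEvent X B x A n γ ∩ {ω | X x (n + 1) ω = y}) (hXB.measurableSet_stopsAt x A (n + 1))
  rw [hXB.real_pathEvent_step] at h
  have hd : (pathEvent X B x A n γ ∩ {ω | X x (n + 1) ω = y}) \
      {ω | H.StopsAt (fun n => X x n ω) (fun c n => B x c n ω) A (n + 1)}
      = pathEvent X B x A n γ ∩ {ω | X x (n + 1) ω = y} ∩
        {ω | ¬ H.StopsAt (fun n => X x n ω) (fun c n => B x c n ω) A (n + 1)} := rfl
  rw [hd] at h
  rw [pathStop, eq_sub_of_add_eq h]
  by_cases hy : y ∈ A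
  · have : pathEvent X B x A n γ ∩ {ω | X x (n + 1) ω = y} ∩
        {ω | ¬ H.StopsAt (fun n => X x n ω) (fun c n => B x c n ω) A (n + 1)} = ∅ := by
      refine Set.eq_empty_of_forall_notMem fun ω hω => hω.2 (Or.inl ?_)
      have h3 : X x (n + 1) ω = y := hω.1.2
      change X x (n + 1) ω ∈ A
      rwa [h3]
    rw [this, measureReal_empty, if_neg (by simpa using hy)]
    ring
  · rw [hXB.real_pathEvent_continue hweak x A n γ hy, if_pos (by simpa using hy), pathStep]
    ring

theorem IsRandomInput.real_pathEvent_zero (hXB : H.IsRandomInput μ X B) {x : V} {A : Finset V}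
    (hx : x ∉ A) (γ : List V) :
    μ.real (pathEvent X B x A 0 γ) = if γ = [x] then 1 else 0 := by
  have h : ∀ᵐ ω ∂μ, (ω ∈ pathEvent X B x A 0 γ ↔ γ = [x]) := by
    filter_upwards [hXB.ae_start x] with ω hω
    rw [eq_comm (a := γ)]
    simp [pathEvent, loopErasure, StopsAt, hω, hx, not_formedAt_zero]
  split_ifs with hγ
  · have h1 : μ (pathEvent X B x A 0 γ) = 1 := by
      refine (mem_ae_iff_prob_eq_one (hXB.measurableSet_pathEvent x A 0 γ)).1 ?_
      filter_upwards [h] with ω hω using hω.2 hγ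
    rw [measureReal_def, h1, ENNReal.toReal_one]
  · rw [measureReal_def, measure_eq_zero_iff_ae_notMem.2, ENNReal.toReal_zero]
    filter_upwards [h] with ω hω h'
    exact hγ (hω.1 h')

/-- A path that occurs is self-avoiding, starts at `x`, and avoids `A`. -/
theorem mem_pathsFrom_of_mem_pathEvent {x : V} {A : Finset V} {n : ℕ} {γ : List V} {ω : Ω}
    (hω : ω ∈ pathEvent X B x A n γ) (h0 : X x 0 ω = x) : γ ∈ pathsFrom Aᶜ x := by
  obtain ⟨rfl, h⟩ := hω
  rw [mem_pathsFrom, loopErasure_head, h0]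
  refine ⟨⟨loopErasure_nodup _ _, fun a ha => ?_⟩, rfl⟩
  obtain ⟨i, hi, rfl⟩ := mem_loopErasure ha
  rw [Finset.mem_compl]
  exact fun h' => h i hi (Or.inl h')

/-- This is the recursion that `mk_mul_detMinor` requires. Up to the null set where the walk does
not start at x, the event splits disjointly according to the previous path and the new vertex. -/
theorem IsRandomInput.real_pathEvent_succ (hXB : H.IsRandomInput μ X B)
    (hweak : H.WeaklyInconsistent) (x : V) (A : Finset V) (n : ℕ) (γ' : List V) :
    μ.real (pathEvent X B x A (n + 1) γ') = ∑ γ ∈ pathsFrom Aᶜ x, ∑ y ∈ Aᶜ,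
      if nextPath γ y = γ' then μ.real (pathEvent X B x A n γ) * H.pathStep x γ y else 0 := by
  set G : List V × V → Set Ω := fun q => if nextPath q.1 q.2 = γ' then
    pathEvent X B x A n q.1 ∩ {ω | X x (n + 1) ω = q.2} ∩
      {ω | ¬ H.StopsAt (fun n => X x n ω) (fun c n => B x c n ω) A (n + 1)} else ∅ with hG
  have hGm : ∀ q, MeasurableSet (G q) := by
    intro q
    simp only [hG]
    split_ifs
    · exact ((hXB.measurableSet_pathEvent x A n q.1).inter
        (measurableSet_of_measurable_top (hXB.measurable_walk x (n + 1)) (· = q.2))).inter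
        (hXB.measurableSet_stopsAt x A (n + 1)).compl
    · exact MeasurableSet.empty
  have hGmem : ∀ q ω, ω ∈ G q ↔ nextPath q.1 q.2 = γ' ∧ ω ∈ pathEvent X B x A n q.1 ∧
      X x (n + 1) ω = q.2 ∧
      ¬ H.StopsAt (fun n => X x n ω) (fun c n => B x c n ω) A (n + 1) := by
    intro q ω
    simp only [hG]
    split_ifs with h
    · simp only [h, true_and]
      exact and_assoc
    · simp [h]
  have hdisj : (↑(pathsFrom Aᶜ x ×ˢ Aᶜ) : Set (List V × V)).PairwiseDisjoint G := by
    intro q _ q' _ hne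
    rw [Function.onFun, Set.disjoint_left]
    intro ω h h'
    rw [hGmem] at h h'
    exact hne (Prod.ext (h.2.1.1.symm.trans h'.2.1.1) (h.2.2.1.symm.trans h'.2.2.1))
  have hae : pathEvent X B x A (n + 1) γ' =ᵐ[μ] ⋃ q ∈ pathsFrom Aᶜ x ×ˢ Aᶜ, G q := by
    refine eventuallyEq_set.2 ?_
    filter_upwards [hXB.ae_start x] with ω hω
    simp only [Set.mem_iUnion, exists_prop]
    constructor
    · rintro ⟨h1, h2⟩
      have h3 : ω ∈ pathEvent X B x A n (loopErasure (fun n => X x n ω) n) :=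
        ⟨rfl, fun i hi => h2 i (by omega)⟩
      refine ⟨(loopErasure (fun n => X x n ω) n, X x (n + 1) ω), ?_, ?_⟩
      · rw [Finset.mem_product]
        refine ⟨mem_pathsFrom_of_mem_pathEvent h3 hω, ?_⟩
        rw [Finset.mem_compl]
        exact fun h => h2 (n + 1) le_rfl (Or.inl h)
      · rw [hGmem]
        exact ⟨h1, h3, rfl, h2 (n + 1) le_rfl⟩
    · rintro ⟨q, -, hq⟩
      rw [hGmem] at hq
      obtain ⟨h1, ⟨h2, h3⟩, h4, h5⟩ := hq
      refine ⟨?_, fun i hi => ?_⟩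
      · rw [loopErasure_succ, h2, h4, h1]
      · rcases Nat.lt_or_ge n i with h | h
        · obtain rfl : i = n + 1 := by omega
          exact h5
        · exact h3 i h
  rw [measureReal_congr hae, measureReal_biUnion_finset hdisj fun q _ => hGm q, Finset.sum_product]
  refine Finset.sum_congr rfl fun γ _ => Finset.sum_congr rfl fun y hy => ?_
  simp only [hG]
  split_ifs
  · exact hXB.real_pathEvent_continue hweak x A n γ (Finset.mem_compl.1 hy)
  · exact measureReal_empty

end Law
end U1Graph

/-! ### The law of the number of steps -/

namespace U1Graph
section NumSteps
variable {V : Type*} [Fintype V] [DecidableEq V] {H : U1Graph V} {Ω : Type*} [MeasurableSpace Ω]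
  {μ : Measure Ω} [IsProbabilityMeasure μ]
  {X : V → ℕ → Ω → V} {B : V → H.OrientedCycle → ℕ → Ω → Bool}

/-- The event that the walk from `x` stops at time `n + 1` and adds `γ ++ [y]`. -/
def stageEvent (X : V → ℕ → Ω → V) (B : V → H.OrientedCycle → ℕ → Ω → Bool) (x : V) (A : Finset V)
    (n : ℕ) (γ : List V) (y : V) : Set Ω :=
  {ω | H.stopTime (fun n => X x n ω) (fun c n => B x c n ω) A = (n + 1 : ℕ) ∧
    newPart (fun n => X x n ω) (n + 1) = γ ++ [y]}

theorem mem_stageEvent_iff {x : V} {A : Finset V} {n : ℕ} {γ : List V} {y : V} {ω : Ω} :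
    ω ∈ stageEvent X B x A n γ y ↔ ω ∈ pathEvent X B x A n γ ∧ X x (n + 1) ω = y ∧
      H.StopsAt (fun n => X x n ω) (fun c n => B x c n ω) A (n + 1) := by
  have h : newPart (fun n => X x n ω) (n + 1) = γ ++ [y] ↔
      loopErasure (fun n => X x n ω) n = γ ∧ X x (n + 1) ω = y := by
    rw [newPart, Nat.add_sub_cancel]
    refine ⟨fun h => ⟨List.append_inj_left' h rfl, ?_⟩, fun h => by rw [h.1, h.2]⟩
    simpa using List.append_inj_right' h rfl
  simp only [stageEvent, pathEvent, Set.mem_ofPred_eq, stopTime_eq_coe_iff, h, Nat.lt_succ_iff]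
  tauto

theorem IsRandomInput.real_stageEvent (hXB : H.IsRandomInput μ X B)
    (hweak : H.WeaklyInconsistent) (x : V) (A : Finset V) (n : ℕ) (γ : List V) (y : V) :
    μ.real (stageEvent X B x A n γ y)
      = μ.real (pathEvent X B x A n γ) * H.pathStop Aᶜ x γ y := by
  rw [← hXB.real_pathEvent_stopped hweak]
  congr 1
  ext ω
  rw [mem_stageEvent_iff, ← and_assoc]
  rfl

theorem measurableSet_stageEvent {I : Set (V ⊕ V × H.OrientedCycle × ℕ)} {x : V}
    (h : Sum.inl x ∈ I) (h' : ∀ c n, Sum.inr (x, c, n) ∈ I) (A : Finset V) (n : ℕ) (γ : List V)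
    (y : V) : MeasurableSet[inputSigma X B I] (stageEvent X B x A n γ y) := by
  simp only [stageEvent, Set.ofPred_and]
  exact (measurableSet_of_measurable_top (measurable_stopTime h h' A) (· = ((n + 1 : ℕ) : ℕ∞))).inter
    (measurableSet_of_measurable_top (measurable_newPart h (n + 1)) (· = γ ++ [y]))

/-- The event that `m` iterations starting from the nodes in `A` make `k` steps. -/
def stepsEvent (ι : Fin (Fintype.card V) ≃ V) (X : V → ℕ → Ω → V)
    (B : V → H.OrientedCycle → ℕ → Ω → Bool) (m : ℕ) (A : Finset V) (k : ℕ) : Set Ω :=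
  {ω | H.stageSteps ι (fun x n => X x n ω) (fun x c n => B x c n ω) m A = k}

theorem measurableSet_stepsEvent (ι : Fin (Fintype.card V) ≃ V) (m : ℕ) (A : Finset V) (k : ℕ) :
    MeasurableSet[inputSigma X B (H.nodeInput {x | x ∉ A})] (stepsEvent ι X B m A k) :=
  measurableSet_of_measurable_top (measurable_stageSteps ι m A) (· = (k : ℕ∞))

/-- As x ∈ A', the later stages never use the walk from x or its coins. -/
theorem IsRandomInput.real_stage_inter_steps (hXB : H.IsRandomInput μ X B)
    (ι : Fin (Fintype.card V) ≃ V) (x : V) (A A' : Finset V) (hx : x ∈ A') (n m k : ℕ)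
    (γ : List V) (y : V) :
    μ.real (stageEvent X B x A n γ y ∩ stepsEvent ι X B m A' k)
      = μ.real (stageEvent X B x A n γ y) * μ.real (stepsEvent ι X B m A' k) := by
  have hd : Disjoint (H.nodeInput {x}) (H.nodeInput {z | z ∉ A'}) := by
    refine disjoint_nodeInput ?_
    rw [Set.disjoint_left]
    intro z hz hz'
    rw [Set.mem_singleton_iff.1 hz] at hz'
    exact hz' hx
  have h1 : MeasurableSet[inputSigma X B (H.nodeInput {x})] (stageEvent X B x A n γ y) :=
    measurableSet_stageEvent (inl_mem_nodeInput (Set.mem_singleton x))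
      (inr_mem_nodeInput (Set.mem_singleton x)) A n γ y
  rw [measureReal_def, hXB.measure_inter hd h1 (measurableSet_stepsEvent ι m A' k),
    ENNReal.toReal_mul, measureReal_def, measureReal_def]

/-- The first stage is sorted by its path γ, its last vertex y and its duration i + 1 ≤ k. The next
set of nodes is A ∪ γ, since y adds nothing new with positive probability. -/
theorem IsRandomInput.real_stepsEvent_succ (hXB : H.IsRandomInput μ X B)
    (hweak : H.WeaklyInconsistent) (ι : Fin (Fintype.card V) ≃ V) {A : Finset V} {x : V}
    (hx : x ∉ A) {m : ℕ}
    (hst : ∀ (X : V → ℕ → V) (b : V → H.OrientedCycle → ℕ → Bool),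
      H.stageSteps ι X b (m + 1) A = H.stopTime (X x) (b x) A +
        H.stageSteps ι X b m (A ∪ (newPart (X x) (H.stopTime (X x) (b x) A).toNat).toFinset))
    (k : ℕ) :
    μ.real (stepsEvent ι X B (m + 1) A k) = ∑ γ ∈ pathsFrom Aᶜ x, ∑ y, ∑ i ∈ Finset.range k,
      μ.real (pathEvent X B x A i γ) * H.pathStop Aᶜ x γ y *
        μ.real (stepsEvent ι X B m (A ∪ γ.toFinset) (k - 1 - i)) := by
  set G : List V × V × ℕ → Set Ω := fun q => stageEvent X B x A q.2.2 q.1 q.2.1 ∩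
    stepsEvent ι X B m (A ∪ (q.1 ++ [q.2.1]).toFinset) (k - 1 - q.2.2) with hG
  have hGm : ∀ q, MeasurableSet (G q) := fun q =>
    (hXB.inputSigma_le Set.univ _ (measurableSet_stageEvent (Set.mem_univ _)
      (fun _ _ => Set.mem_univ _) A _ _ _)).inter
      (hXB.inputSigma_le _ _ (measurableSet_stepsEvent ι m _ _))
  set s := pathsFrom Aᶜ x ×ˢ (Finset.univ : Finset V) ×ˢ Finset.range k with hs
  have hdisj : (↑s : Set (List V × V × ℕ)).PairwiseDisjoint G := by
    intro q _ q' _ hne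
    rw [Function.onFun, Set.disjoint_left]
    rintro ω ⟨h, -⟩ ⟨h', -⟩
    have h1 : q.2.2 = q'.2.2 := by
      have := h.1.symm.trans h'.1
      have : q.2.2 + 1 = q'.2.2 + 1 := by exact_mod_cast this
      omega
    rw [mem_stageEvent_iff] at h h'
    rw [h1] at h
    exact hne (Prod.ext (h.1.1.symm.trans h'.1.1) (Prod.ext (h.2.1.symm.trans h'.2.1) h1))
  have hae : stepsEvent ι X B (m + 1) A k =ᵐ[μ] ⋃ q ∈ s, G q := by
    refine eventuallyEq_set.2 ?_
    filter_upwards [hXB.ae_start x] with ω hω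
    simp only [Set.mem_iUnion, exists_prop, stepsEvent, Set.mem_ofPred_eq, hst]
    constructor
    · intro h
      set τ := H.stopTime (fun n => X x n ω) (fun c n => B x c n ω) A with hτ
      have hτtop : τ ≠ ⊤ := by
        intro h'
        rw [h', top_add] at h
        exact ENat.natCast_ne_top _ h.symm
      obtain ⟨t, ht⟩ := ENat.ne_top_iff_exists.1 hτtop
      -- The walk starts outside A, and no cycle is formed at time 0.
      have ht0 : t ≠ 0 := by
        rintro rfl
        have := (H.stopTime_eq_coe_iff.1 (hτ.symm.trans ht.symm)).1
        rcases this with h' | ⟨c, h', -⟩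
        · exact hx (hω ▸ h')
        · exact not_formedAt_zero H h'
      obtain ⟨i, rfl⟩ := Nat.exists_eq_succ_of_ne_zero ht0
      rw [← ht, ENat.toNat_natCast] at h
      obtain ⟨r, hr⟩ : ∃ r : ℕ, (r : ℕ∞) = H.stageSteps ι (fun x n => X x n ω)
          (fun x c n => B x c n ω) m (A ∪ (newPart (fun n => X x n ω) i.succ).toFinset) := by
        refine ENat.ne_top_iff_exists.1 fun h' => ?_
        rw [h', add_top] at h
        exact ENat.natCast_ne_top _ h.symm
      rw [← hr] at h
      have hk : i + 1 + r = k := by exact_mod_cast h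
      have hmem : ω ∈ stageEvent X B x A i (loopErasure (fun n => X x n ω) i) (X x (i + 1) ω) :=
        ⟨hτ.symm.trans ht.symm, rfl⟩
      refine ⟨(loopErasure (fun n => X x n ω) i, X x (i + 1) ω, i), ?_, hmem, ?_⟩
      · simp only [hs, Finset.mem_product, Finset.mem_univ, true_and, Finset.mem_range]
        exact ⟨mem_pathsFrom_of_mem_pathEvent (mem_stageEvent_iff.1 hmem).1 hω, by omega⟩
      · change H.stageSteps ι (fun x n => X x n ω) (fun x c n => B x c n ω) m
          (A ∪ (newPart (fun n => X x n ω) i.succ).toFinset) = _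
        rw [← hr]
        congr 1
        change r = k - 1 - i
        omega
    · rintro ⟨⟨γ, y, i⟩, hq, hq1, hq2⟩
      simp only [hs, Finset.mem_product, Finset.mem_univ, true_and, Finset.mem_range] at hq
      obtain ⟨h1, h2⟩ := hq1
      simp only at h1 h2
      rw [h1, ENat.toNat_natCast, h2]
      change H.stageSteps ι (fun x n => X x n ω) (fun x c n => B x c n ω) m
          (A ∪ (γ ++ [y]).toFinset) = ((k - 1 - i : ℕ) : ℕ∞) at hq2
      rw [hq2]
      have : i + 1 + (k - 1 - i) = k := by omega
      exact_mod_cast this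
  rw [measureReal_congr hae, measureReal_biUnion_finset hdisj fun q _ => hGm q, hs,
    Finset.sum_product]
  refine Finset.sum_congr rfl fun γ hγ => ?_
  rw [Finset.sum_product]
  refine Finset.sum_congr rfl fun y _ => Finset.sum_congr rfl fun i _ => ?_
  have hxγ : x ∈ γ := List.mem_of_mem_head? (mem_pathsFrom.1 hγ).2
  simp only [hG]
  rw [hXB.real_stage_inter_steps ι x A _ (by simp [hxγ]), hXB.real_stageEvent hweak]
  by_cases hy : y ∈ A ∪ γ.toFinset
  · congr 3
    ext a
    simp only [List.toFinset_append, Finset.mem_union, List.mem_toFinset, List.mem_singleton] at hy ⊢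
    constructor
    · rintro (h | h | rfl)
      exacts [Or.inl h, Or.inr h, hy]
    · tauto
  -- A step to a vertex outside A and γ closes no loop, so the walk cannot stop there.
  · have : H.pathStop Aᶜ x γ y = 0 := by
      simp only [Finset.mem_union, List.mem_toFinset, not_or] at hy
      rw [pathStop, if_pos (by simpa using hy.1), rejectProb, if_neg hy.2, sub_self, mul_zero]
    rw [this]
    simp

open PowerSeries in
theorem mk_stepsEvent_univ (ι : Fin (Fintype.card V) ≃ V) (m : ℕ) :
    PowerSeries.mk (fun k => (μ.real (stepsEvent ι X B m Finset.univ k) : ℂ)) = 1 := by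
  ext k
  rw [coeff_mk, coeff_one]
  simp only [stepsEvent, stageSteps_univ]
  rcases eq_or_ne k 0 with rfl | hk
  · simp
  · have : ¬ ((0 : ℕ∞) = k) := by exact_mod_cast hk.symm
    simp [this, hk]

open PowerSeries in
/-- The generating function of the number of steps. -/
theorem IsRandomInput.mk_stepsEvent (hXB : H.IsRandomInput μ X B) (hweak : H.WeaklyInconsistent)
    (hdeg : ∀ x, 0 < H.deg x) (ι : Fin (Fintype.card V) ≃ V) (m : ℕ) (A : Finset V)
    (hm : Aᶜ.card ≤ m) :
    PowerSeries.mk (fun k => (μ.real (stepsEvent ι X B m A k) : ℂ)) *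
        H.detMinor (PowerSeries.X : ℂ⟦X⟧) Aᶜ
      = PowerSeries.X ^ Aᶜ.card * C (H.detMinor (1 : ℂ) Aᶜ) := by
  induction m generalizing A with
  | zero =>
    obtain rfl : A = Finset.univ :=
      compl_eq_bot.1 (Finset.card_eq_zero.1 (Nat.le_zero.1 hm))
    rw [mk_stepsEvent_univ]
    simp [detMinor, detOn_empty]
  | succ m ih =>
    by_cases hA : A = Finset.univ
    · subst hA
      rw [mk_stepsEvent_univ]
      simp [detMinor, detOn_empty]
    obtain ⟨x, hx, hst⟩ := H.exists_stageSteps_succ ι hA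
    have hxU : x ∈ Aᶜ := Finset.mem_compl.2 hx
    have key : PowerSeries.mk (fun k => (μ.real (stepsEvent ι X B (m + 1) A k) : ℂ))
        = ∑ γ ∈ pathsFrom Aᶜ x, ∑ y, PowerSeries.X *
          (PowerSeries.mk (fun n => (μ.real (pathEvent X B x A n γ) : ℂ)) *
            (C (H.pathStop Aᶜ x γ y : ℂ) *
            PowerSeries.mk (fun k => (μ.real (stepsEvent ι X B m (A ∪ γ.toFinset) k) : ℂ)))) := by
      ext k
      rw [coeff_mk, hXB.real_stepsEvent_succ hweak ι hx fun X b => hst X b m, map_sum]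
      push_cast
      refine Finset.sum_congr rfl fun γ _ => ?_
      rw [map_sum]
      refine Finset.sum_congr rfl fun y _ => ?_
      cases k with
      | zero => simp
      | succ k =>
        rw [coeff_succ_X_mul, coeff_mul, Finset.Nat.sum_antidiagonal_eq_sum_range_succ_mk]
        refine Finset.sum_congr rfl fun i _ => ?_
        rw [coeff_C_mul, coeff_mk, coeff_mk, Nat.add_sub_cancel, mul_assoc]
    have hterm : ∀ γ ∈ pathsFrom Aᶜ x, ∀ y, (PowerSeries.X *
          (PowerSeries.mk (fun n => (μ.real (pathEvent X B x A n γ) : ℂ)) *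
            (C (H.pathStop Aᶜ x γ y : ℂ) *
            PowerSeries.mk (fun k => (μ.real (stepsEvent ι X B m (A ∪ γ.toFinset) k) : ℂ))))) *
            H.detMinor (PowerSeries.X : ℂ⟦X⟧) Aᶜ
        = PowerSeries.X ^ Aᶜ.card *
          C (H.pathGreen (1 : ℂ) Aᶜ γ * (H.pathStop Aᶜ x γ y : ℂ)) := by
      intro γ hγ y
      have hγ' := mem_pathsFrom.1 hγ
      have hxγ : x ∈ γ := List.mem_of_mem_head? hγ'.2
      have hsub : γ.toFinset ⊆ Aᶜ := fun a ha => hγ'.1.2 a (List.mem_toFinset.1 ha)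
      have hcompl : (A ∪ γ.toFinset)ᶜ = Aᶜ \ γ.toFinset := by
        ext a; simp
      have hcard : Aᶜ.card = 1 + (γ.length - 1) + (Aᶜ \ γ.toFinset).card := by
        -- The exponent |U| splits into 1 for the stopping step, |γ| - 1 from the Green function and
        -- |U ∖ γ| from the later stages.
        have h1 := Finset.card_sdiff_add_card_eq_card hsub
        have h2 := List.toFinset_card_of_nodup hγ'.1.1
        have h3 := List.length_pos_of_mem hxγ
        omega
      have hgreen := H.mk_mul_detMinor hdeg (U := Aᶜ) (x := x)
        (fun n γ => (μ.real (pathEvent X B x A n γ) : ℂ))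
        (fun γ _ => by rw [hXB.real_pathEvent_zero hx]; split_ifs <;> simp)
        (fun n γ' _ => by
          rw [hXB.real_pathEvent_succ hweak]
          push_cast
          refine Finset.sum_congr rfl fun β _ => Finset.sum_congr rfl fun z _ => ?_
          split_ifs <;> simp) hγ
      -- The minor on U ∖ γ in the Green function is exactly the factor that the induction
      -- hypothesis needs; it is replaced by its value at t = 1.
      have hih := ih (A ∪ γ.toFinset) (by rw [hcompl]; omega)
      rw [hcompl] at hih
      have h1 : ∀ a b c d e : ℂ⟦X⟧, a * (b * (c * d)) * e = a * c * (b * e) * d :=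
        fun a b c d e => by ring
      rw [h1, hgreen, pathGreen, pathGreen, PowerSeries.algebraMap_eq, hcard, pow_add, pow_add]
      have h2 : ∀ a b c d e f : ℂ⟦X⟧, a * b * (c * d * e) * f = a * b * c * d * (f * e) :=
        fun a b c d e f => by ring
      rw [h2, hih]
      simp only [one_pow, one_mul, map_mul, pow_one, Algebra.algebraMap_self, RingHom.id_apply]
      ring
    rw [key, Finset.sum_mul, ← H.sum_pathGreen_stopped hdeg hxU, map_sum, Finset.mul_sum]
    refine Finset.sum_congr rfl fun γ hγ => ?_
    rw [Finset.sum_mul, map_sum, Finset.mul_sum]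
    exact Finset.sum_congr rfl fun y _ => hterm γ hγ y

end NumSteps
end U1Graph

/-! ### The matrix `1 - z Π` is invertible for `|z| ≤ 1` -/

namespace U1Graph
section Invertible
variable {V : Type*} [Fintype V] [DecidableEq V] {H : U1Graph V}

theorem p_pos (hdeg : ∀ x, 0 < H.deg x) {x y : V} (h : H.graph.Adj x y) : 0 < H.p x y :=
  div_pos (H.W_pos x y h) (hdeg x)

theorem exists_rep_orientedCycle (c : H.OrientedCycle) : ∃ a b l,
    c.1 = ((a :: b :: l : List V) : Cycle V) ∧ (a :: (b :: l) ++ [a]).IsChain H.graph.Adj := by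
  obtain ⟨l, hl⟩ : ∃ l : List V, c.1 = (l : Cycle V) :=
    (Quotient.exists_rep c.1).imp fun _ h => h.symm
  have hlen := c.2.2.1
  have hchain := c.2.2.2
  rw [hl] at hlen hchain
  match l, hlen with
  | a :: b :: l, _ => exact ⟨a, b, l, hl, by simpa [Cycle.chain_coe_cons] using hchain⟩

theorem adj_of_isChain {a b : V} {l : List V} (h : (a :: (b :: l) ++ [a]).IsChain H.graph.Adj) :
    H.graph.Adj a b := by
  simp only [List.cons_append, List.isChain_cons_cons] at h
  exact h.1

theorem deg_pos (hconn : H.graph.Connected) (hnontriv : H.NonTrivial) (x : V) : 0 < H.deg x := by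
  have hW : ∀ x y, 0 ≤ H.W x y := fun x y => by
    by_cases h : H.graph.Adj x y
    · exact (H.W_pos x y h).le
    · exact (H.W_zero x y h).ge
  have hV : Nontrivial V := by
    obtain ⟨c, -⟩ := hnontriv
    obtain ⟨a, b, l, -, hl⟩ := exists_rep_orientedCycle c
    exact ⟨a, b, (adj_of_isChain hl).ne⟩
  obtain ⟨y, hy⟩ := hconn.preconnected.exists_adj_of_nontrivial x
  exact Finset.sum_pos' (fun y _ => hW x y) ⟨y, Finset.mem_univ y, H.W_pos x y hy⟩

/-- At a point where an eigenvector has maximal modulus, it is parallel along the edges. -/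
theorem parallel_of_max (hdeg : ∀ x, 0 < H.deg x) {z : ℂ} (hz : ‖z‖ ≤ 1) {f : V → ℂ} {x : V}
    (hfx : f x ≠ 0) (hmax : ∀ y, ‖f y‖ ≤ ‖f x‖) (heq : f x = z * ∑ y, H.transMat x y * f y)
    {y : V} (hxy : H.graph.Adj x y) : z * H.Φ x y * f y = f x := by
  set m := ‖f x‖ with hm
  set g : V → ℂ := fun y => conj (f x) * (z * H.Φ x y * f y) with hg
  have hnorm : ∀ y, ‖g y‖ ≤ m ^ 2 := by
    intro y
    have hΦ : ‖H.Φ x y‖ ≤ 1 := by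
      by_cases h : H.graph.Adj x y
      · exact (H.Φ_norm x y h).le
      · simp [H.Φ_zero x y h]
    have h1 : ‖z‖ * ‖H.Φ x y‖ ≤ 1 := mul_le_one₀ hz (norm_nonneg _) hΦ
    have h2 : ‖z‖ * ‖H.Φ x y‖ * ‖f y‖ ≤ m := by
      calc _ ≤ 1 * ‖f y‖ := by gcongr
        _ ≤ m := by rw [one_mul]; exact hmax y
    simp only [hg, norm_mul, RCLike.norm_conj]
    rw [sq]
    exact mul_le_mul_of_nonneg_left h2 (norm_nonneg _)
  -- The real parts of g are at most m² and their p-average is m². A sum of nonnegative terms that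
  -- vanishes then forces equality at every neighbour.
  have hsum : ∑ y, H.p x y * (m ^ 2 - (g y).re) = 0 := by
    have h1 : ∑ y, (H.p x y : ℂ) * g y = ((m ^ 2 : ℝ) : ℂ) := by
      have : ∑ y, (H.p x y : ℂ) * g y = conj (f x) * (z * ∑ y, H.transMat x y * f y) := by
        rw [Finset.mul_sum, Finset.mul_sum]
        refine Finset.sum_congr rfl fun y _ => ?_
        simp only [hg, transMat, Matrix.of_apply]
        ring
      rw [this, ← heq, mul_comm, Complex.mul_conj, Complex.normSq_eq_norm_sq]
    have h2 : ∑ y, H.p x y * (g y).re = m ^ 2 := by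
      have := congrArg Complex.re h1
      rw [Complex.ofReal_re, Complex.re_sum] at this
      simpa using this
    simp only [mul_sub]
    rw [Finset.sum_sub_distrib, ← Finset.sum_mul, H.sum_p hdeg, h2]
    ring
  have hre : (g y).re = m ^ 2 := by
    have h1 := (Finset.sum_eq_zero_iff_of_nonneg fun y _ => mul_nonneg (H.p_nonneg x y)
      (sub_nonneg.2 ((Complex.re_le_norm _).trans (hnorm y)))).1 hsum y (Finset.mem_univ y)
    rcases mul_eq_zero.1 h1 with h | h
    · exact absurd h (p_pos hdeg hxy).ne'
    · linarith
  -- The modulus is at most m² and the real part equals m², which leaves no room for an imaginary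
  -- part.
  have him : (g y).im = 0 := by
    have h1 := Complex.sq_norm (g y)
    rw [Complex.normSq_apply, hre] at h1
    have h2 : ‖g y‖ ^ 2 ≤ (m ^ 2) ^ 2 := by
      gcongr
      exact hnorm y
    nlinarith [mul_self_nonneg (g y).im]
  have hgy : conj (f x) * (z * H.Φ x y * f y) = conj (f x) * f x := by
    rw [mul_comm _ (f x), Complex.mul_conj, Complex.normSq_eq_norm_sq]
    refine Complex.ext ?_ ?_
    · rw [Complex.ofReal_re]; exact hre
    · rw [Complex.ofReal_im]; exact him
  exact mul_left_cancel₀ (by simpa using hfx) hgy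

theorem listProd_mul_of_parallel {z : ℂ} {f : V → ℂ}
    (hpar : ∀ x y, H.graph.Adj x y → z * H.Φ x y * f y = f x) (l : List V) (x y : V)
    (hl : (x :: l ++ [y]).IsChain H.graph.Adj) :
    listProd (fun x y => z * H.Φ x y) (x :: l ++ [y]) * f y = f x := by
  induction l generalizing x with
  | nil => simpa [listProd] using hpar x y (by simpa using hl)
  | cons a l ih =>
    simp only [List.cons_append, List.isChain_cons_cons] at hl
    have := ih a hl.2
    simp only [List.cons_append, listProd] at this ⊢
    rw [mul_assoc, this, hpar x a hl.1]

/-- By the maximum principle and connectedness, a kernel vector has constant modulus and is parallel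
for zΦ along every edge. Going back and forth on an edge gives z² = 1, so z^k hol(c) = 1 on a cycle
of length k forces hol(c) = ±1. Non-triviality excludes 1 for some cycle, and cos θ ≥ 0 excludes -1.
-/
theorem det_one_sub_smul_ne_zero (hconn : H.graph.Connected) (hnontriv : H.NonTrivial)
    (hweak : H.WeaklyInconsistent) {z : ℂ} (hz : ‖z‖ ≤ 1) : (1 - z • H.transMat).det ≠ 0 := by
  intro hdet
  have hdeg := deg_pos hconn hnontriv
  obtain ⟨f, hf0, hf⟩ := Matrix.exists_mulVec_eq_zero_iff.2 hdet
  have heq : ∀ x, f x = z * ∑ y, H.transMat x y * f y := by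
    intro x
    have := congrFun hf x
    rw [Matrix.sub_mulVec, Matrix.one_mulVec, Matrix.smul_mulVec, Pi.sub_apply, Pi.smul_apply,
      Pi.zero_apply, sub_eq_zero, smul_eq_mul] at this
    exact this
  have := hconn.nonempty
  obtain ⟨x₀, hx₀⟩ := Finite.exists_max fun x => ‖f x‖
  have hfx₀ : f x₀ ≠ 0 := by
    intro h
    refine hf0 (funext fun y => ?_)
    have := hx₀ y
    rw [h, norm_zero] at this
    simpa using this
  have hall : ∀ x, ‖f x‖ = ‖f x₀‖ := by
    intro x
    obtain ⟨w⟩ := hconn.preconnected x x₀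
    induction w with
    | nil => rfl
    | @cons a b c hab w ih =>
      have hb := ih hx₀ hfx₀
      have hb0 : f b ≠ 0 := by
        rw [← norm_ne_zero_iff, hb]; exact norm_ne_zero_iff.2 hfx₀
      have h1 := parallel_of_max hdeg hz hb0 (fun y => by rw [hb]; exact hx₀ y) (heq b) hab.symm
      refine le_antisymm (hx₀ a) ?_
      rw [← hb, ← h1, norm_mul, norm_mul, H.Φ_norm b a hab.symm, mul_one]
      exact mul_le_of_le_one_left (norm_nonneg _) hz
  have hne : ∀ x, f x ≠ 0 := fun x => by
    rw [← norm_ne_zero_iff, hall x]; exact norm_ne_zero_iff.2 hfx₀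
  have hpar : ∀ x y, H.graph.Adj x y → z * H.Φ x y * f y = f x := fun x y hxy =>
    parallel_of_max hdeg hz (hne x) (fun y => by rw [hall y, hall x]) (heq x) hxy
  obtain ⟨c, hc⟩ := hnontriv
  obtain ⟨a, b, l, hl, hchain⟩ := exists_rep_orientedCycle c
  have hre := hweak c
  rw [hol_eq hl] at hc hre
  have hab := adj_of_isChain hchain
  have hz2 : z ^ 2 = 1 := by
    have h1 := hpar a b hab
    rw [← hpar b a hab.symm, H.Φ_conj a b hab] at h1
    have h2 : H.Φ a b * conj (H.Φ a b) = 1 := by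
      rw [Complex.mul_conj, Complex.normSq_eq_norm_sq, H.Φ_norm a b hab]
      simp
    refine mul_right_cancel₀ (hne a) ?_
    linear_combination h1 - z ^ 2 * f a * h2
  have h3 := listProd_mul_of_parallel hpar (b :: l) a a hchain
  rw [listProd_mul (fun _ _ => z) (fun x y => H.Φ x y), listProd_const, ← closedProd_cons] at h3
  have h4 := mul_right_cancel₀ (hne a) (h3.trans (one_mul _).symm)
  set w := z ^ ((a :: b :: l ++ [a]).length - 1) with hw
  have hw2 : (w - 1) * (w + 1) = 0 := by
    have : w ^ 2 = 1 := by rw [hw, ← pow_mul, mul_comm, pow_mul, hz2, one_pow]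
    linear_combination this
  rcases mul_eq_zero.1 hw2 with h | h
  · rw [sub_eq_zero.1 h, one_mul] at h4
    exact hc h4
  · rw [eq_neg_of_add_eq_zero_left h, neg_one_mul] at h4
    rw [← neg_eq_iff_eq_neg.2 h4.symm] at hre
    norm_num at hre

end Invertible
end U1Graph

/-! ### The logarithmic derivative of `det (1 - X N)` -/

section Jacobi
variable {n K A : Type*} [Fintype n] [DecidableEq n] [CommRing K] [CommRing A] [Algebra K A]

theorem Derivation.map_finset_prod {ι : Type*} [DecidableEq ι] (d : Derivation K A A)
    (s : Finset ι) (f : ι → A) :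
    d (∏ i ∈ s, f i) = ∑ i ∈ s, d (f i) * ∏ j ∈ s.erase i, f j := by
  induction s using Finset.induction_on with
  | empty => simp
  | insert a s ha ih =>
    rw [Finset.prod_insert ha, Derivation.leibniz, ih, Finset.sum_insert ha,
      Finset.erase_insert ha, add_comm, smul_eq_mul, smul_eq_mul, mul_comm (∏ i ∈ s, f i),
      Finset.mul_sum]
    congr 1
    refine Finset.sum_congr rfl fun i hi => ?_
    have hia : a ≠ i := fun h => ha (h ▸ hi)
    rw [Finset.erase_insert_of_ne hia, Finset.prod_insert fun h => ha (Finset.mem_of_mem_erase h)]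
    ring

/-- Jacobi's formula. -/
theorem Derivation.map_det (d : Derivation K A A) (M : Matrix n n A) :
    d M.det = (M.adjugate * M.map d).trace := by
  have h1 : d M.det = ∑ i, (M.updateCol i fun j => d (M j i)).det := by
    simp_rw [Matrix.det_apply, map_sum, Units.smul_def, map_zsmul]
    rw [Finset.sum_comm]
    refine Finset.sum_congr rfl fun σ _ => ?_
    rw [← Finset.smul_sum]
    congr 1
    rw [d.map_finset_prod]
    refine Finset.sum_congr rfl fun i hi => ?_
    rw [← Finset.mul_prod_erase _ _ hi, Matrix.updateCol_self]
    congr 1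
    refine Finset.prod_congr rfl fun j hj => ?_
    rw [Matrix.updateCol_ne (Finset.ne_of_mem_erase hj)]
  rw [h1, Matrix.trace]
  refine Finset.sum_congr rfl fun i _ => ?_
  rw [← Matrix.cramer_apply, Matrix.cramer_eq_adjugate_mulVec, Matrix.diag_apply, Matrix.mul_apply]
  rfl

open PowerSeries in
/-- The logarithmic derivative of `det (1 - X N)` is minus the generating function of the traces of
the powers of `N`. -/
theorem derivative_charpolyRev (N : Matrix n n ℂ) :
    ((Polynomial.derivative N.charpolyRev : Polynomial ℂ) : ℂ⟦X⟧)
      = -((N.charpolyRev : ℂ⟦X⟧) * PowerSeries.mk fun k => (N ^ (k + 1)).trace) := by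
  set G : Matrix n n ℂ⟦X⟧ := Matrix.of fun i j => PowerSeries.mk fun k => (N ^ k) i j with hG
  set P : Matrix n n ℂ⟦X⟧ := 1 - (PowerSeries.X : ℂ⟦X⟧) • N.map C with hP
  have hdet : (N.charpolyRev : ℂ⟦X⟧) = P.det := by
    have : (N.charpolyRev : ℂ⟦X⟧) = Polynomial.coeToPowerSeries.ringHom N.charpolyRev := rfl
    rw [this, Matrix.charpolyRev, RingHom.map_det]
    congr 1
    ext i j
    rcases eq_or_ne i j with rfl | h
    · simp [hP]
      exact mul_comm _ _
    · simp [hP, h]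
      exact mul_comm _ _
  -- G is the geometric series ∑ X^k N^k.
  have hPG : P * G = 1 := by
    rw [hP, Matrix.sub_mul, Matrix.one_mul, Matrix.smul_mul]
    ext i j k
    have h1 : ∀ k, coeff k ((N.map C * G) i j) = (N ^ (k + 1)) i j := by
      intro k
      simp [Matrix.mul_apply, hG, pow_succ']
    rw [Matrix.sub_apply, Matrix.smul_apply, smul_eq_mul, map_sub]
    cases k with
    | zero => simp [hG, Matrix.one_apply]
    | succ k =>
      rw [coeff_succ_X_mul, h1]
      rcases eq_or_ne i j with rfl | h
      · simp [hG, coeff_one]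
      · simp [hG, h]
  have hGN : (G * N.map C).trace = PowerSeries.mk fun k => (N ^ (k + 1)).trace := by
    ext k
    simp only [Matrix.trace, Matrix.diag_apply, Matrix.mul_apply, map_sum, coeff_mk, pow_succ]
    refine Finset.sum_congr rfl fun i _ => Finset.sum_congr rfl fun j _ => ?_
    rw [Matrix.map_apply, coeff_mul_C]
    simp [hG]
  -- With the inverse of P at hand, the adjugate in Jacobi's formula becomes det P times G.
  have hadj : P.adjugate = P.det • G := by
    calc P.adjugate = P.adjugate * (P * G) := by rw [hPG, mul_one]
      _ = P.det • G := by rw [← mul_assoc, Matrix.adjugate_mul, Matrix.smul_mul, one_mul]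
  rw [← derivative_coe, hdet]
  have hd := (PowerSeries.derivative ℂ).map_det P
  have hmap : P.map (PowerSeries.derivative ℂ) = -N.map C := by
    ext i j
    rcases eq_or_ne i j with rfl | h
    · simp [hP, mul_comm]
    · simp [hP, h, mul_comm]
  rw [hmap, hadj] at hd
  have : d⁄dX ℂ P.det = (P.det • G * -N.map C).trace := hd
  rw [this, Matrix.mul_neg, Matrix.trace_neg, Matrix.smul_mul, Matrix.trace_smul, hGN, smul_eq_mul]

end Jacobi

/-! ### Absolutely convergent power series -/

namespace PowerSeries

/-- The power series `f` converges absolutely at `z`. -/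
def SummableAt (f : PowerSeries ℂ) (z : ℂ) : Prop := Summable fun k => ‖coeff k f * z ^ k‖

/-- The value of a power series at a point. -/
noncomputable def value (f : PowerSeries ℂ) (z : ℂ) : ℂ := ∑' k, coeff k f * z ^ k

theorem coeff_mul_pow (f g : PowerSeries ℂ) (z : ℂ) (k : ℕ) :
    coeff k (f * g) * z ^ k = ∑ q ∈ Finset.HasAntidiagonal.antidiagonal k,
      (coeff q.1 f * z ^ q.1) * (coeff q.2 g * z ^ q.2) := by
  rw [coeff_mul, Finset.sum_mul]
  refine Finset.sum_congr rfl fun q hq => ?_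
  rw [← Finset.HasAntidiagonal.mem_antidiagonal.1 hq, pow_add]
  ring

theorem SummableAt.mul {f g : PowerSeries ℂ} {z : ℂ} (hf : f.SummableAt z) (hg : g.SummableAt z) :
    (f * g).SummableAt z := by
  simp only [SummableAt, coeff_mul_pow]
  exact summable_norm_sum_mul_antidiagonal_of_summable_norm (f := fun k => coeff k f * z ^ k)
    (g := fun k => coeff k g * z ^ k) hf hg

theorem SummableAt.value_mul {f g : PowerSeries ℂ} {z : ℂ} (hf : f.SummableAt z)
    (hg : g.SummableAt z) : (f * g).value z = f.value z * g.value z := by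
  simp only [value, coeff_mul_pow]
  exact (tsum_mul_tsum_eq_tsum_sum_antidiagonal_of_summable_norm hf hg).symm

theorem SummableAt.add {f g : PowerSeries ℂ} {z : ℂ} (hf : f.SummableAt z) (hg : g.SummableAt z) :
    (f + g).SummableAt z := by
  refine Summable.of_nonneg_of_le (fun _ => norm_nonneg _) (fun k => ?_) (Summable.add hf hg)
  rw [map_add, add_mul]
  exact norm_add_le _ _

theorem SummableAt.value_add {f g : PowerSeries ℂ} {z : ℂ} (hf : f.SummableAt z)
    (hg : g.SummableAt z) : (f + g).value z = f.value z + g.value z := by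
  simp only [value, map_add, add_mul]
  exact Summable.tsum_add (Summable.of_norm hf) (Summable.of_norm hg)

theorem SummableAt.mono {f : PowerSeries ℂ} {z w : ℂ} (hf : f.SummableAt z) (h : ‖w‖ ≤ ‖z‖) :
    f.SummableAt w := by
  refine Summable.of_nonneg_of_le (fun _ => norm_nonneg _) (fun k => ?_) hf
  rw [norm_mul, norm_mul, norm_pow, norm_pow]
  gcongr

theorem hasSum_polynomial (p : Polynomial ℂ) (z : ℂ) :
    HasSum (fun k => coeff k (p : PowerSeries ℂ) * z ^ k) (p.eval z) := by
  simp only [Polynomial.coeff_coe]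
  rw [Polynomial.eval_eq_sum_range]
  refine hasSum_sum_of_ne_finset_zero fun k hk => ?_
  rw [Polynomial.coeff_eq_zero_of_natDegree_lt, zero_mul]
  simpa using hk

theorem summableAt_polynomial (p : Polynomial ℂ) (z : ℂ) : (p : PowerSeries ℂ).SummableAt z :=
  (hasSum_polynomial p z).summable.norm

theorem value_polynomial (p : Polynomial ℂ) (z : ℂ) : (p : PowerSeries ℂ).value z = p.eval z :=
  (hasSum_polynomial p z).tsum_eq

/-- A rational power series without poles in the closed unit disc converges in a larger disc. -/
theorem exists_summableAt_of_mul_eq (p : Polynomial ℂ) (hp : ∀ z : ℂ, ‖z‖ ≤ 1 → p.eval z ≠ 0)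
    (f : PowerSeries ℂ) (q : Polynomial ℂ) (h : f * (p : PowerSeries ℂ) = q) :
    ∃ r : ℝ, 1 < r ∧ f.SummableAt r := by
  -- The roots w are split off one by one. Each has |w| > 1, so division by X - w multiplies by a
  -- geometric series that converges beyond the closed unit disc.
  induction hd : p.natDegree generalizing p f q with
  | zero =>
    obtain ⟨c, rfl⟩ := Polynomial.natDegree_eq_zero.1 hd
    have hc : c ≠ 0 := by simpa using hp 0 (by simp)
    refine ⟨2, one_lt_two, ?_⟩
    have : f = ((q * Polynomial.C c⁻¹ : Polynomial ℂ) : PowerSeries ℂ) := by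
      rw [Polynomial.coe_mul, ← h, Polynomial.coe_C, Polynomial.coe_C, mul_assoc, ← map_mul,
        mul_inv_cancel₀ hc, map_one, mul_one]
    rw [this]
    exact summableAt_polynomial _ _
  | succ d ih =>
    obtain ⟨w, hw⟩ := IsAlgClosed.exists_root p (by
      intro h0
      have := Polynomial.natDegree_eq_zero_iff_degree_le_zero.2 h0.le
      omega)
    have hw1 : 1 < ‖w‖ := not_le.1 fun h' => hp w h' hw
    have hw0 : w ≠ 0 := norm_pos_iff.1 (one_pos.trans hw1)
    obtain ⟨p', rfl⟩ := Polynomial.dvd_iff_isRoot.2 hw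
    have hp'0 : p' ≠ 0 := by
      rintro rfl
      simp at hd
    rw [Polynomial.natDegree_mul (Polynomial.X_sub_C_ne_zero w) hp'0,
      Polynomial.natDegree_X_sub_C] at hd
    obtain ⟨r, hr1, hr⟩ := ih p' (fun z hz h0 => hp z hz (by simp [h0]))
      (f * ((Polynomial.X - Polynomial.C w : Polynomial ℂ) : PowerSeries ℂ)) q
      (by rw [mul_assoc, ← Polynomial.coe_mul, h]) (by omega)
    set g : PowerSeries ℂ := PowerSeries.mk fun k => -w⁻¹ ^ (k + 1) with hg
    have hgw : ((Polynomial.X - Polynomial.C w : Polynomial ℂ) : PowerSeries ℂ) * g = 1 := by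
      ext k
      rw [Polynomial.coe_sub, Polynomial.coe_X, Polynomial.coe_C, sub_mul, map_sub, coeff_C_mul,
        coeff_one]
      cases k with
      | zero => simp [hg, hw0]
      | succ k =>
        rw [coeff_succ_X_mul, hg, coeff_mk, coeff_mk, pow_succ _ (k + 1)]
        field_simp
        simp
    have hfg : f = (f * ((Polynomial.X - Polynomial.C w : Polynomial ℂ) : PowerSeries ℂ)) * g := by
      rw [mul_assoc, hgw, mul_one]
    obtain ⟨s, hs1, hsw⟩ := exists_between hw1
    refine ⟨min r s, lt_min hr1 hs1, ?_⟩
    have hmin : 0 < min r s := one_pos.trans (lt_min hr1 hs1)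
    rw [hfg]
    refine SummableAt.mul (hr.mono ?_) ?_
    · rw [Complex.norm_real, Complex.norm_real, Real.norm_of_nonneg hmin.le,
        Real.norm_of_nonneg (one_pos.trans hr1).le]
      exact min_le_left _ _
    · have hsum : Summable fun k : ℕ => ‖w‖⁻¹ * (‖w‖⁻¹ * min r s) ^ k := by
        refine (summable_geometric_of_lt_one (by positivity) ?_).mul_left _
        rw [inv_mul_lt_one₀ (one_pos.trans hw1)]
        exact (min_le_right _ _).trans_lt hsw
      refine hsum.congr fun k => ?_
      rw [hg, coeff_mk, norm_mul, norm_neg, norm_pow, norm_pow, norm_inv, Complex.norm_real,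
        Real.norm_of_nonneg hmin.le]
      ring

/-- The derivative converges absolutely inside the disc of convergence. -/
theorem SummableAt.derivative {f : PowerSeries ℂ} {r s : ℝ} (hf : f.SummableAt r) (hs : 0 < s)
    (hsr : s < r) : (derivative ℂ f).SummableAt s := by
  have hr : 0 < r := hs.trans hsr
  have h1 : Summable fun k : ℕ => ((k : ℝ) + 1) * (s / r) ^ k := by
    have hlt : ‖s / r‖ < 1 := by
      rw [Real.norm_of_nonneg (by positivity), div_lt_one hr]
      exact hsr
    have := (summable_pow_mul_geometric_of_norm_lt_one 1 hlt).add
      (summable_geometric_of_norm_lt_one hlt)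
    refine this.congr fun k => ?_
    ring
  obtain ⟨K, hK⟩ : ∃ K, ∀ k, ‖coeff k f * (r : ℂ) ^ k‖ ≤ K := by
    obtain ⟨K, hK⟩ := hf.tendsto_atTop_zero.bddAbove_range
    exact ⟨K, fun k => hK ⟨k, rfl⟩⟩
  refine Summable.of_nonneg_of_le (fun _ => norm_nonneg _) (fun k => ?_) (h1.mul_left (K / r))
  have h2 := hK (k + 1)
  rw [norm_mul, norm_pow, Complex.norm_real, Real.norm_of_nonneg hr.le] at h2
  rw [coeff_derivative, norm_mul, norm_mul, norm_pow, Complex.norm_real,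
    Real.norm_of_nonneg hs.le]
  have h3 : ‖(k : ℂ) + 1‖ = (k : ℝ) + 1 := by
    rw [← Nat.cast_add_one, Complex.norm_natCast, Nat.cast_add_one]
  rw [h3]
  have h4 : ‖coeff (k + 1) f‖ ≤ K / r ^ (k + 1) := by
    rwa [le_div_iff₀ (by positivity)]
  calc ‖coeff (k + 1) f‖ * ((k : ℝ) + 1) * s ^ k
      ≤ K / r ^ (k + 1) * ((k : ℝ) + 1) * s ^ k := by gcongr
    _ = K / r * (((k : ℝ) + 1) * (s / r) ^ k) := by
      rw [div_pow, pow_succ]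
      field_simp

/-- A power series may be differentiated inside the disc of convergence. -/
theorem SummableAt.hasDerivAt_value {f : PowerSeries ℂ} {r : ℝ} (hf : f.SummableAt r) {z : ℂ}
    (hz : ‖z‖ < r) : HasDerivAt f.value ((PowerSeries.derivative ℂ f).value z) z := by
  obtain ⟨s, hs1, hs2⟩ := exists_between hz
  have hs0 : 0 < s := (norm_nonneg z).trans_lt hs1
  have hd := hf.derivative hs0 hs2
  have hu : Summable fun k : ℕ => ‖coeff k f * (k * (s : ℂ) ^ (k - 1))‖ := by
    rw [← summable_nat_add_iff 1]
    refine hd.congr fun k => ?_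
    rw [coeff_derivative]
    push_cast
    rw [mul_assoc]
  have hder := hasDerivAt_tsum_of_isPreconnected (𝕜 := ℂ) (g := fun k z => coeff k f * z ^ k)
    (g' := fun k z => coeff k f * (k * z ^ (k - 1))) (t := Metric.ball 0 s) (y₀ := 0) (y := z) hu
    Metric.isOpen_ball (convex_ball (0 : ℂ) s).isPreconnected
    (fun k y _ => (hasDerivAt_pow k y).const_mul _)
    (fun k y hy => by
      rw [mem_ball_zero_iff] at hy
      simp only [norm_mul, norm_pow, Complex.norm_real, Real.norm_of_nonneg hs0.le]
      gcongr)
    (by simpa using hs0)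
    ((hf.mono (w := 0) (by simp)).of_norm) (by simpa using hs1)
  have hu' : Summable fun k : ℕ => coeff k f * (k * z ^ (k - 1)) := by
    refine Summable.of_norm_bounded hu fun k => ?_
    simp only [norm_mul, norm_pow, Complex.norm_real, Real.norm_of_nonneg hs0.le]
    gcongr
  have hval : (PowerSeries.derivative ℂ f).value z = ∑' k : ℕ, coeff k f * (k * z ^ (k - 1)) := by
    rw [hu'.tsum_eq_zero_add]
    simp [value, coeff_derivative, mul_assoc]
  rw [hval]
  exact hder

end PowerSeries

/-! ### Determinants and exponentials of traces, and moments -/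

section Trace
variable {n : Type*} [Fintype n] [DecidableEq n]

theorem eval_charpolyRev_eq_det (N : Matrix n n ℂ) (z : ℂ) :
    N.charpolyRev.eval z = (1 - z • N).det := by
  rw [Matrix.charpolyRev, ← Polynomial.coe_evalRingHom, RingHom.map_det]
  congr 1
  ext i j
  rcases eq_or_ne i j with rfl | h
  · simp
    exact mul_comm _ _
  · simp [h]
    exact mul_comm _ _

open PowerSeries in
theorem mul_trace_series (N : Matrix n n ℂ) :
    (PowerSeries.mk fun k => (N ^ (k + 1)).trace) * (N.charpolyRev : ℂ⟦X⟧)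
      = ((-Polynomial.derivative N.charpolyRev : Polynomial ℂ) : ℂ⟦X⟧) := by
  rw [Polynomial.coe_neg, derivative_charpolyRev, neg_neg, mul_comm]

/-- The traces of the powers of a matrix with spectral radius less than one are summable. -/
theorem summable_trace_pow {N : Matrix n n ℂ} (hN : ∀ z ∈ spectrum ℂ N, ‖z‖ < 1) :
    Summable fun k : ℕ => ‖(N ^ (k + 1)).trace‖ := by
  -- A zero z of det(1 - zN) is the inverse of an eigenvalue, so none lies in the closed disc. The
  -- trace series, minus the logarithmic derivative, is rational with poles only at such zeros.
  have h0 : ∀ z : ℂ, ‖z‖ ≤ 1 → N.charpolyRev.eval z ≠ 0 := by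
    intro z hz h
    rw [eval_charpolyRev_eq_det] at h
    have hz0 : z ≠ 0 := by
      rintro rfl
      simp at h
    have hmem : z⁻¹ ∈ spectrum ℂ N := by
      rw [spectrum.mem_iff]
      intro hu
      have e : 1 - z • N = z • (algebraMap ℂ (Matrix n n ℂ) z⁻¹ - N) := by
        rw [smul_sub, Algebra.algebraMap_eq_smul_one, smul_smul, mul_inv_cancel₀ hz0, one_smul]
      rw [e, Matrix.det_smul] at h
      rcases mul_eq_zero.1 h with h | h
      · exact hz0 (eq_zero_of_pow_eq_zero h)
      · exact (((Matrix.isUnit_iff_isUnit_det _).1 hu).ne_zero) h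
    have := hN _ hmem
    rw [norm_inv, inv_lt_one₀ (norm_pos_iff.2 hz0)] at this
    linarith
  obtain ⟨r, hr, hs⟩ := PowerSeries.exists_summableAt_of_mul_eq _ h0 _ _ (mul_trace_series N)
  have h1 := hs.mono (w := 1) (by
    rw [norm_one, Complex.norm_real, Real.norm_of_nonneg (by linarith)]
    exact hr.le)
  refine h1.congr fun k => ?_
  simp

/-- `det (1 - N) = exp (-∑ tr (N ^ k) / k)` whenever the series converges. -/
theorem det_mul_exp_trace {N : Matrix n n ℂ} {S : ℂ}
    (hS : Tendsto (fun m => ∑ k ∈ Finset.range m, (N ^ k).trace / (k : ℂ)) atTop (𝓝 S)) :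
    (1 - N).det * Complex.exp S = 1 := by
  -- The term k = 0 is a division by zero, hence 0, so L has no constant term.
  set L : PowerSeries ℂ := PowerSeries.mk fun k => (N ^ k).trace / (k : ℂ) with hL
  set E := N.charpolyRev with hE
  have hdL : PowerSeries.derivative ℂ L = PowerSeries.mk fun k => (N ^ (k + 1)).trace := by
    ext k
    rw [PowerSeries.coeff_derivative, hL, PowerSeries.coeff_mk, PowerSeries.coeff_mk]
    push_cast
    rw [div_mul_cancel₀]
    exact_mod_cast Nat.succ_ne_zero k
  -- Convergence at 1 may be conditional, but it bounds the terms, and this gives absolute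
  -- convergence in the open disc.
  obtain ⟨K, hK⟩ : ∃ K, ∀ k : ℕ, ‖(N ^ k).trace / (k : ℂ)‖ ≤ K := by
    have h0 : Tendsto (fun k : ℕ => (N ^ k).trace / (k : ℂ)) atTop (𝓝 0) := by
      have := (hS.comp (tendsto_add_atTop_nat 1)).sub hS
      rw [sub_self] at this
      refine this.congr fun k => ?_
      simp [Finset.sum_range_succ]
    obtain ⟨K, hK⟩ := h0.norm.bddAbove_range
    exact ⟨K, fun k => hK ⟨k, rfl⟩⟩
  have hsum : ∀ r : ℝ, 0 < r → r < 1 → L.SummableAt r := by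
    intro r hr0 hr1
    refine Summable.of_nonneg_of_le (fun _ => norm_nonneg _) (fun k => ?_)
      ((summable_geometric_of_lt_one hr0.le hr1).mul_left K)
    rw [norm_mul, norm_pow, Complex.norm_real, Real.norm_of_nonneg hr0.le, hL,
      PowerSeries.coeff_mk]
    gcongr
    exact hK k
  -- Since L' E = -E', the product E exp(L) is constant on the disc, with value 1 at the origin.
  have hder : ∀ z ∈ Metric.ball (0 : ℂ) 1,
      HasDerivAt (fun z => E.eval z * Complex.exp (L.value z)) 0 z := by
    intro z hz
    rw [mem_ball_zero_iff] at hz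
    obtain ⟨s, hs1, hs2⟩ := exists_between hz
    obtain ⟨r, hr1, hr2⟩ := exists_between hs2
    have hs0 := (norm_nonneg z).trans_lt hs1
    have h1 := hsum r (hs0.trans hr1) hr2
    have h2 := h1.derivative hs0 hr1
    have h3 : (PowerSeries.derivative ℂ L).SummableAt z := h2.mono (by
      rw [Complex.norm_real, Real.norm_of_nonneg hs0.le]; exact hs1.le)
    have h4 := (E.hasDerivAt z).mul (h1.hasDerivAt_value (hs1.trans hr1)).cexp
    have h5 : (PowerSeries.derivative ℂ L).value z * E.eval z = -(Polynomial.derivative E).eval z := by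
      rw [← Polynomial.eval_neg, ← PowerSeries.value_polynomial, ← PowerSeries.value_polynomial,
        ← h3.value_mul (PowerSeries.summableAt_polynomial E z), hdL, hE, mul_trace_series]
    refine h4.congr_deriv ?_
    linear_combination Complex.exp (L.value z) * h5
  have hconst : ∀ r : ℝ, 0 < r → r < 1 → E.eval (r : ℂ) * Complex.exp (L.value r) = 1 := by
    intro r hr0 hr1
    have h1 := Metric.isOpen_ball.is_const_of_deriv_eq_zero
      (convex_ball (0 : ℂ) 1).isPreconnected
      (fun z hz => (hder z hz).differentiableAt.differentiableWithinAt)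
      (fun z hz => (hder z hz).deriv) (x := (r : ℂ)) (y := 0)
      (by rw [mem_ball_zero_iff, Complex.norm_real, Real.norm_of_nonneg hr0.le]; exact hr1)
      (by simp)
    have h2 : L.value 0 = 0 := by
      rw [PowerSeries.value, tsum_eq_single 0]
      · simp [hL]
      · intro k hk
        simp [hk]
    rw [h1, h2, hE, Matrix.eval_charpolyRev]
    simp
  -- Abel's limit theorem carries the identity to the boundary point 1.
  have hlim : Tendsto (fun r : ℝ => E.eval (r : ℂ) * Complex.exp (L.value r)) (𝓝[<] 1)
      (𝓝 (E.eval 1 * Complex.exp S)) := by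
    refine Tendsto.mul ?_ ?_
    · have : Continuous fun r : ℝ => E.eval (r : ℂ) :=
        E.continuous.comp Complex.continuous_ofReal
      have h := (this.tendsto 1).mono_left (nhdsWithin_le_nhds (s := Set.Iio 1))
      simpa using h
    · refine (Complex.continuous_exp.tendsto S).comp ?_
      have h := Complex.tendsto_tsum_powerSeries_nhdsWithin_lt hS
      rw [tendsto_map'_iff] at h
      refine h.congr fun r => ?_
      simp [PowerSeries.value, hL]
  have h1 : E.eval 1 * Complex.exp S = 1 := by
    refine tendsto_nhds_unique hlim (Tendsto.congr' ?_ tendsto_const_nhds)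
    filter_upwards [Ioo_mem_nhdsLT (zero_lt_one' ℝ)] with r hr
    exact (hconst r hr.1 hr.2).symm
  rwa [hE, eval_charpolyRev_eq_det, one_smul] at h1

/-- The coefficients of degree 0 and 1 in the logarithmic derivative formula. -/
theorem derivative_charpolyRev_eval_zero (N : Matrix n n ℂ) :
    (Polynomial.derivative N.charpolyRev).eval 0 = -N.trace ∧
    (Polynomial.derivative (Polynomial.derivative N.charpolyRev)).eval 0
      = N.trace ^ 2 - (N ^ 2).trace := by
  have h := derivative_charpolyRev N
  have h0 := congrArg (PowerSeries.coeff 0) h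
  have h1 := congrArg (PowerSeries.coeff 1) h
  have e0 : N.charpolyRev.coeff 0 = 1 := by
    rw [Polynomial.coeff_zero_eq_eval_zero, Matrix.eval_charpolyRev]
  simp only [Polynomial.coeff_coe, map_neg, PowerSeries.coeff_mul, PowerSeries.coeff_mk,
    Finset.Nat.antidiagonal_succ, Finset.Nat.antidiagonal_zero] at h0 h1
  simp [e0, Polynomial.coeff_derivative] at h0 h1
  rw [← Polynomial.coeff_zero_eq_eval_zero, ← Polynomial.coeff_zero_eq_eval_zero]
  simp only [Polynomial.coeff_derivative]
  simp
  linear_combination h1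

/-- The moments encoded by the generating function `z ^ n det (1 - P) / det (1 - z P)`. -/
theorem moments_of_generating_function {d : ℕ} {P M : Matrix n n ℂ}
    (hP : ∀ z : ℂ, ‖z‖ ≤ 1 → P.charpolyRev.eval z ≠ 0)
    (hM : ∀ s : ℂ, P.charpolyRev.eval (1 + s) = P.charpolyRev.eval 1 * M.charpolyRev.eval s)
    {f : PowerSeries ℂ}
    (hf : f * (P.charpolyRev : PowerSeries ℂ)
      = PowerSeries.X ^ d * PowerSeries.C (P.charpolyRev.eval 1)) :
    (∃ r : ℝ, 1 < r ∧ f.SummableAt r) ∧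
    (∀ z : ℂ, ‖z‖ ≤ 1 → f.value z * P.charpolyRev.eval z = z ^ d * P.charpolyRev.eval 1) ∧
    (PowerSeries.derivative ℂ f).value 1 = d + M.trace ∧
    (PowerSeries.derivative ℂ (PowerSeries.derivative ℂ f)).value 1
      = d * (d - 1) + 2 * (d + M.trace) * M.trace - (M.trace ^ 2 - (M ^ 2).trace) := by
  set p := P.charpolyRev with hp
  set c := p.eval 1 with hc
  have hc0 : c ≠ 0 := hP 1 (by simp)
  set q : Polynomial ℂ := Polynomial.C c * Polynomial.X ^ d with hq
  have hfq : f * (p : PowerSeries ℂ) = (q : PowerSeries ℂ) := by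
    rw [hf, hq, mul_comm]; simp
  obtain ⟨r, hr1, hr⟩ := PowerSeries.exists_summableAt_of_mul_eq p hP f q hfq
  obtain ⟨s, hs1, hsr⟩ := exists_between hr1
  obtain ⟨u, hu1, hus⟩ := exists_between hs1
  have hs := hr.derivative (by linarith) hsr
  have hu := hs.derivative (by linarith) hus
  have hone : ∀ {g : PowerSeries ℂ} {v : ℝ}, 1 < v → g.SummableAt v → ∀ z : ℂ, ‖z‖ ≤ 1 →
      g.SummableAt z := by
    intro g v hv hg z hz
    refine hg.mono ?_
    rw [Complex.norm_real, Real.norm_of_nonneg (by linarith)]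
    linarith
  have hn1 : ‖(1 : ℂ)‖ ≤ 1 := by simp
  have s0 := hone hr1 hr 1 hn1
  have s1 := hone hs1 hs 1 hn1
  have s2 := hone hu1 hu 1 hn1
  have hval : ∀ z : ℂ, ‖z‖ ≤ 1 → f.value z * p.eval z = z ^ d * c := by
    intro z hz
    rw [← PowerSeries.value_polynomial, ← (hone hr1 hr z hz).value_mul
      (PowerSeries.summableAt_polynomial p z), hfq, PowerSeries.value_polynomial, hq,
      mul_comm (z ^ d)]
    simp
  -- Recentring at 1 turns the derivatives of p at 1 into derivatives of det(1 - sM) at s = 0, that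
  -- is, into traces of M and M².
  have hcomp : p.comp (1 + Polynomial.X) = Polynomial.C c * M.charpolyRev := by
    refine Polynomial.funext fun s => ?_
    rw [Polynomial.eval_comp, Polynomial.eval_mul, Polynomial.eval_C, Polynomial.eval_add,
      Polynomial.eval_one, Polynomial.eval_X]
    exact hM s
  obtain ⟨t1, t2⟩ := derivative_charpolyRev_eval_zero M
  have hp1 : (Polynomial.derivative p).eval 1 = -c * M.trace := by
    have := congrArg (fun g => (Polynomial.derivative g).eval 0) hcomp
    simp [Polynomial.derivative_comp, t1] at this
    rw [this]
    ring
  have hp2 : (Polynomial.derivative (Polynomial.derivative p)).eval 1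
      = c * (M.trace ^ 2 - (M ^ 2).trace) := by
    have := congrArg (fun g => (Polynomial.derivative (Polynomial.derivative g)).eval 0) hcomp
    simpa [Polynomial.derivative_comp, t2] using this
  have hf1 : f.value 1 = 1 := by
    have := hval 1 hn1
    rw [one_pow, one_mul] at this
    exact mul_right_cancel₀ hc0 (this.trans (one_mul c).symm)
  -- Differentiating f p = q twice and evaluating at 1 gives linear equations for f'(1) and f''(1).
  have d1 := congrArg (PowerSeries.derivative ℂ) hfq
  have d2 := congrArg (PowerSeries.derivative ℂ) d1
  simp only [Derivation.leibniz, map_add, PowerSeries.derivative_coe, smul_eq_mul] at d1 d2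
  have pp := fun g : Polynomial ℂ => PowerSeries.summableAt_polynomial g 1
  have v1 := congrArg (fun g => PowerSeries.value g 1) d1
  have v2 := congrArg (fun g => PowerSeries.value g 1) d2
  rw [PowerSeries.SummableAt.value_add (s0.mul (pp _)) ((pp _).mul s1), s0.value_mul (pp _),
    (pp _).value_mul s1] at v1
  rw [PowerSeries.SummableAt.value_add ((s0.mul (pp _)).add ((pp _).mul s1))
    (((pp _).mul s2).add (s1.mul (pp _))), PowerSeries.SummableAt.value_add (s0.mul (pp _))
    ((pp _).mul s1), PowerSeries.SummableAt.value_add ((pp _).mul s2) (s1.mul (pp _)),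
    s0.value_mul (pp _), (pp _).value_mul s1, (pp _).value_mul s2, s1.value_mul (pp _)] at v2
  simp only [PowerSeries.value_polynomial, hf1, hp1, hp2, ← hc] at v1 v2
  have q1 : (Polynomial.derivative q).eval 1 = d * c := by
    simp [hq, Polynomial.derivative_X_pow]
    ring
  have q2 : (Polynomial.derivative (Polynomial.derivative q)).eval 1 = d * (d - 1) * c := by
    rcases d with _ | d
    · simp [hq]
    · simp [hq, Polynomial.derivative_X_pow]
      ring
  rw [q1] at v1
  rw [q2] at v2
  have m1 : (PowerSeries.derivative ℂ f).value 1 = d + M.trace := by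
    refine mul_left_cancel₀ hc0 ?_
    linear_combination v1
  refine ⟨⟨r, hr1, hr⟩, hval, m1, ?_⟩
  rw [m1] at v2
  refine mul_left_cancel₀ hc0 ?_
  linear_combination v2

end Trace

/-! ### Integrals of functions of the number of steps -/

section Integral
variable {Ω : Type*} [MeasurableSpace Ω] {μ : Measure Ω} [IsProbabilityMeasure μ]

/-- The integral of a function of a random natural number. -/
theorem integral_comp_nat {Y : Ω → ℕ} (hY : Measurable Y) {a : ℕ → ℝ}
    (ha : ∀ k, μ.real (Y ⁻¹' {k}) = a k) (g : ℕ → ℝ)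
    (hg : Summable fun k => ‖(a k : ℂ) * (g k : ℂ)‖) :
    Integrable (fun ω => g (Y ω)) μ ∧
      ((∫ ω, g (Y ω) ∂μ : ℝ) : ℂ) = ∑' k, (a k : ℂ) * (g k : ℂ) := by
  have hmap : ∀ k, (μ.map Y).real {k} = a k := fun k => by
    rw [map_measureReal_apply hY (measurableSet_singleton k), ha]
  have ha0 : ∀ k, 0 ≤ a k := fun k => by rw [← ha]; exact measureReal_nonneg
  have hgm : Measurable g := measurable_from_top
  have hint : Integrable g (μ.map Y) := by
    refine ⟨hgm.aestronglyMeasurable, ?_⟩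
    rw [HasFiniteIntegral, lintegral_countable']
    have h1 : ∀ k, ‖g k‖ₑ * (μ.map Y) {k} = ENNReal.ofReal ‖(a k : ℂ) * (g k : ℂ)‖ := by
      intro k
      rw [← ofReal_measureReal, hmap, ← ofReal_norm,
        ← ENNReal.ofReal_mul (norm_nonneg _), norm_mul, Complex.norm_real, Complex.norm_real,
        Real.norm_of_nonneg (ha0 k), mul_comm]
    simp_rw [h1]
    rw [← ENNReal.ofReal_tsum_of_nonneg (fun _ => norm_nonneg _) hg]
    exact ENNReal.ofReal_lt_top
  refine ⟨hint.comp_measurable hY, ?_⟩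
  rw [← integral_map hY.aemeasurable hgm.aestronglyMeasurable (f := g), integral_countable hint,
    Complex.ofReal_tsum]
  refine tsum_congr fun k => ?_
  rw [hmap]
  simp

end Integral

/-! ### Moments as derivatives of the generating function at 1 -/

namespace PowerSeries

theorem SummableAt.hasSum_mul_natCast {f : PowerSeries ℂ} (hf : (PowerSeries.derivative ℂ f).SummableAt 1) :
    (Summable fun k : ℕ => ‖coeff k f * (k : ℂ)‖) ∧
      ∑' k : ℕ, coeff k f * (k : ℂ) = (PowerSeries.derivative ℂ f).value 1 := by
  have h1 : Summable fun k : ℕ => ‖coeff k f * (k : ℂ)‖ := by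
    rw [← summable_nat_add_iff 1]
    refine hf.congr fun k => ?_
    rw [coeff_derivative]
    simp
  refine ⟨h1, ?_⟩
  rw [h1.of_norm.tsum_eq_zero_add]
  simp [value, coeff_derivative]

theorem SummableAt.hasSum_mul_sq {f : PowerSeries ℂ} (hf : (PowerSeries.derivative ℂ f).SummableAt 1)
    (hf' : (PowerSeries.derivative ℂ (PowerSeries.derivative ℂ f)).SummableAt 1) :
    (Summable fun k : ℕ => ‖coeff k f * (k : ℂ) ^ 2‖) ∧
      ∑' k : ℕ, coeff k f * (k : ℂ) ^ 2
        = (PowerSeries.derivative ℂ (PowerSeries.derivative ℂ f)).value 1 + (PowerSeries.derivative ℂ f).value 1 := by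
  obtain ⟨h1, h2⟩ := hf'.hasSum_mul_natCast
  have e : ∀ k : ℕ, coeff (k + 1) f * ((k + 1 : ℕ) : ℂ) ^ 2
      = coeff k (PowerSeries.derivative ℂ f) * (k : ℂ) + coeff k (PowerSeries.derivative ℂ f) * 1 ^ k := by
    intro k
    rw [coeff_derivative]
    push_cast
    ring
  have h3 : Summable fun k : ℕ => ‖coeff k f * (k : ℂ) ^ 2‖ := by
    rw [← summable_nat_add_iff 1]
    refine Summable.of_nonneg_of_le (fun _ => norm_nonneg _) (fun k => ?_) (h1.add hf)
    rw [e]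
    exact norm_add_le _ _
  refine ⟨h3, ?_⟩
  rw [h3.of_norm.tsum_eq_zero_add]
  simp_rw [e]
  rw [Summable.tsum_add h1.of_norm (Summable.of_norm hf), h2, value]
  simp [value]

end PowerSeries

open scoped Pointwise in
theorem mem_spectrum_smul {n : Type*} [Fintype n] [DecidableEq n] {M : Matrix n n ℂ} {c z : ℂ}
    (hc : c ≠ 0) (hz : z ∈ spectrum ℂ (c • M)) : ∃ w ∈ spectrum ℂ M, z = c * w := by
  have h := spectrum.unit_smul_eq_smul M (Units.mk0 c hc)
  have h' : spectrum ℂ (c • M) = (Units.mk0 c hc) • spectrum ℂ M := h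
  rw [h'] at hz
  obtain ⟨w, hw, rfl⟩ := hz
  exact ⟨w, hw, rfl⟩

/-! ### The minors on the whole vertex set and the conclusion -/

namespace U1Graph
section Final
variable {V : Type*} [Fintype V] [DecidableEq V] {H : U1Graph V}

theorem detMinor_univ_X : H.detMinor (PowerSeries.X : PowerSeries ℂ) Finset.univ
    = (H.transMat.charpolyRev : PowerSeries ℂ) := by
  have h : (H.transMat.charpolyRev : PowerSeries ℂ)
      = Polynomial.coeToPowerSeries.ringHom H.transMat.charpolyRev := rfl
  rw [detMinor, detOn_univ, h, Matrix.charpolyRev, RingHom.map_det]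
  congr 1
  ext i j : 2
  rcases eq_or_ne i j with rfl | h
  · simp [PowerSeries.algebraMap_eq]
    exact mul_comm _ _
  · simp [PowerSeries.algebraMap_eq, h]
    exact mul_comm _ _

theorem detMinor_univ_one : H.detMinor (1 : ℂ) Finset.univ = H.transMat.charpolyRev.eval 1 := by
  rw [detMinor, detOn_univ, eval_charpolyRev_eq_det]
  congr 1

end Final
end U1Graph

theorem proposition4p7 {V : Type*} [Fintype V] [DecidableEq V] (H : U1Graph V)
    (hconn : H.graph.Connected) (hnontriv : H.NonTrivial) (hweak : H.WeaklyInconsistent)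
    (ι : Fin (Fintype.card V) ≃ V)
    {Ω : Type*} [MeasurableSpace Ω] (μ : Measure Ω) [IsProbabilityMeasure μ]
    (X : V → ℕ → Ω → V) (B : V → H.OrientedCycle → ℕ → Ω → Bool)
    (hXB : H.IsRandomInput μ X B)
    (T : Ω → ℕ∞)
    (hT : ∀ ω, T ω = H.numSteps ι (fun x n => X x n ω) (fun x c n => B x c n ω))
    (M : Matrix V V ℂ) (hM : M = H.PiMat * (1 - H.PiMat)⁻¹) :
    -- the inverse and the quotient below make sense, `T` is almost surely finite,
    -- and it has a second moment
    IsUnit (1 - H.PiMat).det ∧ (H.PiMat + 1).det ≠ 0 ∧ (∀ᵐ ω ∂μ, T ω ≠ ⊤) ∧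
    MemLp (fun ω => ((T ω).toNat : ℝ)) 2 μ ∧
    -- the generating function, for all `t` for which the series converges
    (∀ t ∈ Set.Icc (-1 : ℝ) 1,
      ((∀ z ∈ spectrum ℂ M, |1 - t| * ‖z‖ < 1) →
        Summable fun k : ℕ => ((t : ℂ) - 1) ^ (k + 1) / ((k + 1 : ℕ) : ℂ) * (M ^ (k + 1)).trace) ∧
      ∀ S : ℂ,
        Tendsto (fun N : ℕ => ∑ k ∈ Finset.Icc 1 N, ((t : ℂ) - 1) ^ k / (k : ℂ) * (M ^ k).trace)
          atTop (𝓝 S) →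
        ((∫ ω, t ^ (T ω).toNat ∂μ : ℝ) : ℂ) = (t : ℂ) ^ Fintype.card V * Complex.exp S) ∧
    -- the mean, the variance and the expected parity
    ((∫ ω, ((T ω).toNat : ℝ) ∂μ : ℝ) : ℂ) = (Fintype.card V : ℂ) + M.trace ∧
    ((variance (fun ω => ((T ω).toNat : ℝ)) μ : ℝ) : ℂ) = M.trace + (M ^ 2).trace ∧
    ((∫ ω, (-1 : ℝ) ^ (T ω).toNat ∂μ : ℝ) : ℂ)
      = (H.PiMat - 1).det / (H.PiMat + 1).det := by
  have hdeg := U1Graph.deg_pos hconn hnontriv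
  set P := H.transMat with hPdef
  rw [H.PiMat_eq_transMat hdeg, ← hPdef] at hM ⊢
  have hne : ∀ z : ℂ, ‖z‖ ≤ 1 → P.charpolyRev.eval z ≠ 0 := fun z hz => by
    rw [eval_charpolyRev_eq_det]
    exact U1Graph.det_one_sub_smul_ne_zero hconn hnontriv hweak hz
  have hdet1 : P.charpolyRev.eval 1 = (1 - P).det := by rw [eval_charpolyRev_eq_det, one_smul]
  have hdetm1 : P.charpolyRev.eval (-1) = (P + 1).det := by
    rw [eval_charpolyRev_eq_det, neg_one_smul, sub_neg_eq_add, add_comm]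
  have hunit : IsUnit (1 - P).det := by
    rw [isUnit_iff_ne_zero, ← hdet1]
    exact hne 1 (by simp)
  -- With s = t - 1, this factorisation exchanges Π for M and moves the centre of the expansion to t
  -- = 1.
  have hshift : ∀ s : ℂ, 1 - (1 + s) • P = (1 - s • M) * (1 - P) := by
    intro s
    rw [hM, sub_mul, one_mul, Matrix.smul_mul, Matrix.mul_assoc, Matrix.nonsing_inv_mul _ hunit,
      mul_one, add_smul, one_smul]
    abel
  have hcomp : ∀ s : ℂ, P.charpolyRev.eval (1 + s)
      = P.charpolyRev.eval 1 * M.charpolyRev.eval s := by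
    intro s
    rw [eval_charpolyRev_eq_det, hshift, Matrix.det_mul, hdet1, eval_charpolyRev_eq_det, mul_comm]
  -- the law of `T`
  set Y : Ω → ℕ := fun ω => (T ω).toNat with hY
  set a : ℕ → ℝ := fun k => μ.real {ω | T ω = k} with ha
  have hTm : Measurable[_, ⊤] T := by
    have : T = fun ω => H.stageSteps ι (fun x n => X x n ω) (fun x c n => B x c n ω)
        (Fintype.card V) ∅ := by
      funext ω
      rw [hT, H.numSteps_eq_stageSteps]
    rw [this]
    exact (U1Graph.measurable_stageSteps ι (Fintype.card V) ∅).mono (hXB.inputSigma_le _) le_rfl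
  have hgf : PowerSeries.mk (fun k => (a k : ℂ)) * (P.charpolyRev : PowerSeries ℂ)
      = PowerSeries.X ^ Fintype.card V * PowerSeries.C (P.charpolyRev.eval 1) := by
    have h := hXB.mk_stepsEvent hweak hdeg ι (Fintype.card V) ∅ (by simp)
    rw [Finset.compl_empty, Finset.card_univ, U1Graph.detMinor_univ_X,
      U1Graph.detMinor_univ_one] at h
    rw [← h]
    congr 2
    ext k
    simp only [ha, U1Graph.stepsEvent, hT, H.numSteps_eq_stageSteps]
  obtain ⟨⟨r, hr1, hr⟩, hval, hm1, hm2⟩ := moments_of_generating_function hne hcomp hgf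
  set f : PowerSeries ℂ := PowerSeries.mk fun k => (a k : ℂ) with hf
  obtain ⟨s, hs1, hsr⟩ := exists_between hr1
  obtain ⟨u, hu1, hus⟩ := exists_between hs1
  have hs := hr.derivative (by linarith) hsr
  have hu := hs.derivative (by linarith) hus
  have hone : ∀ {g : PowerSeries ℂ} {v : ℝ}, 1 < v → g.SummableAt v → ∀ z : ℂ, ‖z‖ ≤ 1 →
      g.SummableAt z := by
    intro g v hv hg z hz
    refine hg.mono ?_
    rw [Complex.norm_real, Real.norm_of_nonneg (by linarith)]
    linarith
  have hn1 : ‖(1 : ℂ)‖ ≤ 1 := by simp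
  have hsing : ∀ k : ℕ, MeasurableSet {ω | T ω = k} := fun k =>
    measurableSet_of_measurable_top hTm (· = (k : ℕ∞))
  -- The probabilities of the finite values sum to f(1) = 1.
  have hfin : ∀ᵐ ω ∂μ, T ω ≠ ⊤ := by
    have h1 : ∑' k, a k = 1 := by
      have h := hval 1 hn1
      rw [one_pow, one_mul] at h
      have h' := mul_right_cancel₀ (hne 1 hn1) (h.trans (one_mul _).symm)
      rw [PowerSeries.value] at h'
      simp only [hf, PowerSeries.coeff_mk, one_pow, mul_one] at h'
      exact_mod_cast h'
    -- A divergent sum has the default value 0, so the value 1 implies summability.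
    have h2 : Summable a := by
      by_contra h
      rw [tsum_eq_zero_of_not_summable h] at h1
      exact zero_ne_one h1
    have h3 : μ (⋃ k : ℕ, {ω | T ω = k}) = 1 := by
      rw [measure_iUnion _ hsing]
      · have : ∀ k : ℕ, μ {ω | T ω = k} = ENNReal.ofReal (a k) := fun k =>
          (ofReal_measureReal).symm
        simp_rw [this]
        rw [← ENNReal.ofReal_tsum_of_nonneg (fun k => measureReal_nonneg) h2, h1,
          ENNReal.ofReal_one]
      · intro i j hij
        rw [Function.onFun, Set.disjoint_left]
        intro ω h h'
        have h4 : (i : ℕ∞) = j := Eq.trans (Eq.symm h) h'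
        exact hij (by exact_mod_cast h4)
    have h4 := (mem_ae_iff_prob_eq_one (MeasurableSet.iUnion hsing)).2 h3
    filter_upwards [h4] with ω hω
    obtain ⟨k, hk⟩ := Set.mem_iUnion.1 hω
    have hk' : T ω = k := hk
    rw [hk']
    exact ENat.natCast_ne_top k
  have hYm : Measurable Y := measurable_top_comp hTm ENat.toNat
  have hYa : ∀ k, μ.real (Y ⁻¹' {k}) = a k := by
    intro k
    refine measureReal_congr (eventuallyEq_set.2 ?_)
    filter_upwards [hfin] with ω hω
    obtain ⟨j, hj⟩ := ENat.ne_top_iff_exists.1 hω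
    simp [hY, ← hj]
  have hgen : ∀ t ∈ Set.Icc (-1 : ℝ) 1, Integrable (fun ω => t ^ Y ω) μ ∧
      ((∫ ω, t ^ Y ω ∂μ : ℝ) : ℂ) * P.charpolyRev.eval (t : ℂ)
        = (t : ℂ) ^ Fintype.card V * P.charpolyRev.eval 1 := by
    intro t ht
    have hnt : ‖(t : ℂ)‖ ≤ 1 := by
      rw [Complex.norm_real, Real.norm_eq_abs]
      exact abs_le.2 ht
    have h := integral_comp_nat hYm hYa (fun k => t ^ k) ((hone hr1 hr _ hnt).congr fun k => by
      rw [hf, PowerSeries.coeff_mk]; push_cast; rfl)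
    refine ⟨h.1, ?_⟩
    rw [h.2, ← hval _ hnt]
    congr 1
    refine tsum_congr fun k => ?_
    rw [hf, PowerSeries.coeff_mk]
    push_cast
    rfl
  obtain ⟨hsum1, htsum1⟩ := PowerSeries.SummableAt.hasSum_mul_natCast (hone hs1 hs 1 hn1)
  obtain ⟨hsum2, htsum2⟩ := PowerSeries.SummableAt.hasSum_mul_sq (hone hs1 hs 1 hn1)
    (hone hu1 hu 1 hn1)
  simp only [hf, PowerSeries.coeff_mk] at hsum1 htsum1 hsum2 htsum2
  rw [← hf] at htsum1 htsum2
  have hmean := integral_comp_nat hYm hYa (fun k => (k : ℝ)) (by exact_mod_cast hsum1)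
  have hsq := integral_comp_nat hYm hYa (fun k => (k : ℝ) ^ 2) (by exact_mod_cast hsum2)
  have hmean' : ((∫ ω, (Y ω : ℝ) ∂μ : ℝ) : ℂ) = (Fintype.card V : ℂ) + M.trace := by
    rw [hmean.2, ← hm1, ← htsum1]
    push_cast
    rfl
  have hsq' : ((∫ ω, (Y ω : ℝ) ^ 2 ∂μ : ℝ) : ℂ)
      = (PowerSeries.derivative ℂ (PowerSeries.derivative ℂ f)).value 1 +
        (PowerSeries.derivative ℂ f).value 1 := by
    rw [hsq.2, ← htsum2]
    push_cast
    rfl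
  have hmem : MemLp (fun ω => (Y ω : ℝ)) 2 μ := by
    rw [memLp_two_iff_integrable_sq hmean.1.aestronglyMeasurable]
    exact hsq.1
  refine ⟨hunit, ?_, hfin, hmem, fun t ht => ⟨fun hspec => ?_, fun S hS => ?_⟩, hmean', ?_, ?_⟩
  · rw [← hdetm1]
    exact hne (-1) (by simp)
  · have hN : ∀ z ∈ spectrum ℂ (((t : ℂ) - 1) • M), ‖z‖ < 1 := by
      intro z hz
      rcases eq_or_ne ((t : ℂ) - 1) 0 with h0 | h0
      · rw [h0, zero_smul] at hz
        have : z = 0 := by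
          by_contra hz0
          refine hz ?_
          rw [spectrum.mem_resolventSet_iff, sub_zero]
          exact (IsUnit.mk0 z hz0).map (algebraMap ℂ (Matrix V V ℂ))
        rw [this, norm_zero]
        exact one_pos
      · obtain ⟨w, hw, rfl⟩ := mem_spectrum_smul h0 hz
        have h1 := hspec w hw
        rwa [norm_mul, show ‖(t : ℂ) - 1‖ = |1 - t| by
          rw [← Complex.ofReal_one, ← Complex.ofReal_sub, Complex.norm_real, Real.norm_eq_abs,
            abs_sub_comm]]
    refine Summable.of_norm_bounded (summable_trace_pow hN) fun k => ?_
    rw [smul_pow, Matrix.trace_smul, smul_eq_mul, div_mul_eq_mul_div, norm_div, Complex.norm_natCast]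
    refine div_le_self (norm_nonneg _) ?_
    exact_mod_cast Nat.succ_le_succ (Nat.zero_le k)
  -- The range sum has an extra term k = 0, which is 0 because it is divided by zero.
  · have hS' : Tendsto (fun m => ∑ k ∈ Finset.range m,
        ((((t : ℂ) - 1) • M) ^ k).trace / (k : ℂ)) atTop (𝓝 S) := by
      rw [← tendsto_add_atTop_iff_nat 1]
      refine hS.congr fun m => ?_
      rw [Finset.range_eq_Ico, Finset.sum_eq_sum_Ico_succ_bot (Nat.succ_pos m), Nat.cast_zero,
        div_zero, zero_add]
      refine Finset.sum_congr
        (by ext; simp only [Finset.mem_Icc, Finset.mem_Ico]; omega) fun k _ => ?_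
      rw [smul_pow, Matrix.trace_smul, smul_eq_mul, div_mul_eq_mul_div]
    have h1 := det_mul_exp_trace hS'
    rw [← eval_charpolyRev_eq_det] at h1
    have h2 := (hgen t ht).2
    have h3 := hcomp ((t : ℂ) - 1)
    rw [add_sub_cancel] at h3
    rw [h3] at h2
    -- The factor det(1 - (t-1)M) is nonzero because its product with exp S is 1; no bound on the
    -- spectral radius is needed.
    refine mul_right_cancel₀ (mul_ne_zero (hne 1 hn1) (left_ne_zero_of_mul_eq_one h1)) ?_
    rw [h2]
    linear_combination (-(t : ℂ) ^ Fintype.card V * P.charpolyRev.eval 1) * h1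
  · have h1 := variance_eq_sub hmem
    change ((variance (fun ω => (Y ω : ℝ)) μ : ℝ) : ℂ) = _
    rw [h1]
    have h2 : ∫ ω, ((fun ω => (Y ω : ℝ)) ^ 2) ω ∂μ = ∫ ω, (Y ω : ℝ) ^ 2 ∂μ := rfl
    rw [h2]
    push_cast
    rw [hsq', hmean', hm1, hm2]
    ring
  · have h := (hgen (-1) (by simp)).2
    rw [Complex.ofReal_neg, Complex.ofReal_one, hdetm1, hdet1] at h
    have h2 : (P + 1).det ≠ 0 := by
      rw [← hdetm1]
      exact hne (-1) (by simp)
    rw [eq_div_iff h2]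
    refine h.trans ?_
    -- The sign (-1)^n, the value of t^n at t = -1, is the one relating det(Π - 1) to det(1 - Π).
    rw [← neg_sub 1 P, Matrix.det_neg]
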